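/- Let $\Omega=[-1,1]$. Let $r\in C^1(\Omega)$ be a probability density on $\Omega$ and $d\varrho(\alpha)=r(\alpha)\,d\alpha$. For continuous $f:\Omega\to\mathbb R$ and $n\ge 1$, let $g_n$ be either the $L^2(\Omega)$-orthogonal projection of $f$ onto the polynomials of degree $\le n$ (the truncated Legendre expansion), or the polynomial of degree $<n$ that interpolates $f$ at the $n$ roots of the Legendre polynomial of degree $n$. Put $\mu=f_\ast\varrho$, $\nu_n=(g_n)_\ast\varrho$, and write $p_\mu,p_{\nu_n}$ for their densities with respect to Lebesgue measure on $\mathbb R$. For an integer $s$, $H^s(\Omega)$ is the space of functions whose weak derivatives up to order $s$ lie in $L^2(\Omega)$, with $\|u\|_{H^s}^2=\sum_{j\le s}\|u^{(j)}\|_{L^2}^2$; elements of $H^s(\Omega)$, $s\ge1$, are identified with their continuous representatives. **(1)** For every integer $\sigma\ge 6$ there is a constant $K=K(\sigma)$ such that the following holds for every $r$ as above, every $f\in H^\sigma(\Omega)$ and either choice of $g_n$. (a) Suppose that the zeros of $f'$ in $\Omega$ are finitely many points $\alpha_1,\dots,\alpha_J$, and that for each $j$ there is an integer $k_j\ge1$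 such that the derivative $f^{(k_j+1)}(\alpha_j)$ exists and is nonzero. Let $k=\max_j k_j$ ($k=0$ if $J=0$). Then $\mu$ is absolutely continuous, $\nu_n$ is absolutely continuous for all sufficiently large $n$, and there is a constant $C$, independent of $n$, such that for all $n\ge1$ $$\|p_\mu-p_{\nu_n}\|_{L^1(\mathbb R)}\le C\,\|f-g_n\|_{H^1(\Omega)}^{\frac1{2k+1}},\qquad \|f-g_n\|_{H^1(\Omega)}^{\frac1{2k+1}}\le K\,\|f\|_{H^\sigma(\Omega)}^{\frac1{2k+1}}\,n^{-\frac{2\sigma-3}{2(2k+1)}},$$ the first inequality being asserted for those $n$ for which $\nu_n$ is absolutely continuous. (b) In particular, if $|f'|>\kappa_f$ on $\Omega$ for some $\kappa_f>0$, then $\mu$ is absolutely continuous, $\nu_n$ is absolutely continuous for all sufficiently large $n$, and there is a constant $C$, independent of $n$, such that for all $n\ge1$ $$\|p_\mu-p_{\nu_n}\|_{L^1(\mathbb R)}\le C\,\|f-g_n\|_{H^1(\Omega)},\qquad \|f-g_n\|_{H^1(\Omega)}\le K\,\|f\|_{H^\sigma(\Omega)}\,n^{\frac32-\sigma},$$ again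 with the first inequality for those $n$ for which $\nu_n$ is absolutely continuous. **(2)** Let $\rho>1$, and let $f$ be a non-constant function on $\Omega$ that extends to an analytic function on the open region bounded by the ellipse in $\mathbb C$ with foci $\pm1$ whose semi-axes sum to $\rho$. Then, for every $r$ as above and either choice of $g_n$, $\mu$ is absolutely continuous, $\nu_n$ is absolutely continuous for all sufficiently large $n$, and $n^m\,\|p_\mu-p_{\nu_n}\|_{L^1(\mathbb R)}\to0$ as $n\to\infty$ for every $m\in\mathbb N$. -/

import Mathlib

open MeasureTheory Filter Topology Polynomial
open scoped ContDiff ENNReal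

noncomputable section

namespace GPC

/-- The physical domain `Ω = [-1, 1]`. -/
def dom : Set ℝ := Set.Icc (-1) 1

/-! ### Sobolev spaces on `(-1, 1)` -/

/-- `w` is a weak derivative of order `j` of `u` on `(-1, 1)`. -/
def IsWeakDeriv (j : ℕ) (u w : ℝ → ℝ) : Prop :=
  LocallyIntegrableOn u (Set.Ioo (-1) 1) ∧
  LocallyIntegrableOn w (Set.Ioo (-1) 1) ∧
  ∀ φ : ℝ → ℝ, ContDiff ℝ ∞ φ → HasCompactSupport φ → tsupport φ ⊆ Set.Ioo (-1) 1 →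
    ∫ x in Set.Ioo (-1) 1, u x * iteratedDeriv j φ x =
      (-1) ^ j * ∫ x in Set.Ioo (-1) 1, w x * φ x

/-- `u ∈ H^s(Ω)`: every weak derivative up to order `s` exists and is square integrable. -/
def MemH (s : ℕ) (u : ℝ → ℝ) : Prop :=
  ∀ j ≤ s, ∃ w, IsWeakDeriv j u w ∧ MemLp w 2 (volume.restrict dom)

open Classical in
/-- The weak derivative of order `j` of `u` (unique up to null sets; `0` if there is none). -/
def weakDeriv (j : ℕ) (u : ℝ → ℝ) : ℝ → ℝ :=
  if h : ∃ w, IsWeakDeriv j u w then h.choose else 0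

/-- The norm of `H^s(Ω)`, meaningful for `u ∈ H^s(Ω)`:
the square root of the sum of the `‖D^j u‖²` in `L²`, `j ≤ s`. -/
def hNorm (s : ℕ) (u : ℝ → ℝ) : ℝ :=
  √(∑ j ∈ Finset.range (s + 1),
      (eLpNorm (weakDeriv j u) 2 (volume.restrict dom)).toReal ^ 2)

/-! ### Classical derivatives on the closed interval `Ω` (one-sided at the endpoints) -/

/-- The classical derivative of order `m` of `f` exists at the point `x ∈ Ω`: the lower ones
exist on a neighbourhood of `x` in `Ω`, and the one of order `m - 1` is differentiable at `x`. -/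
def HasDerivsAt (m : ℕ) (f : ℝ → ℝ) (x : ℝ) : Prop :=
  (∀ i, i + 1 < m →
    ∀ᶠ z in 𝓝[dom] x, DifferentiableWithinAt ℝ (iteratedDerivWithin i f dom) dom z) ∧
  ∀ i < m, DifferentiableWithinAt ℝ (iteratedDerivWithin i f dom) dom x

/-! ### Generalized polynomial chaos -/

/-- The classical Legendre polynomial `Pₙ` (Rodrigues' formula). -/
def legendre (n : ℕ) : ℝ[X] :=
  C (1 / (2 ^ n * (n.factorial : ℝ))) * derivative^[n] ((X ^ 2 - 1) ^ n)

/-- The Legendre polynomial `pₙ`, normalized in `L²(Ω)`. -/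
def legendreNormalized (n : ℕ) : ℝ[X] :=
  C (√((2 * (n : ℝ) + 1) / 2)) * legendre n

/-- The Galerkin expansion of order `n`: `∑_{j ≤ n} ⟨p_j, f⟩ p_j`. -/
def galerkin (f : ℝ → ℝ) (n : ℕ) : ℝ[X] :=
  ∑ j ∈ Finset.range (n + 1),
    C (∫ x in dom, (legendreNormalized j).eval x * f x) * legendreNormalized j

/-- The collocation polynomial of order `n`: the Lagrange interpolant of `f`, of degree `< n`, at
the `n` Gauss-Legendre points, that is, the roots of the Legendre polynomial of degree `n`. -/
def collocation (f : ℝ → ℝ) (n : ℕ) : ℝ[X] :=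
  Lagrange.interpolate (legendre n).roots.toFinset id f

/-- The two types of gPC approximation. -/
inductive Kind
  | galerkin
  | collocation

/-- The gPC approximation `g_n` of `f`, of either type, as a polynomial. -/
def approx : Kind → (ℝ → ℝ) → ℕ → ℝ[X]
  | .galerkin => galerkin
  | .collocation => collocation

/-- The gPC approximation `g_n` of `f`, as a function. -/
def approxFun (t : Kind) (f : ℝ → ℝ) (n : ℕ) : ℝ → ℝ := fun x => (approx t f n).eval x

/-! ### Push-forward measures and their densities -/

/-- `r` is a probability density on `Ω` of class `C¹(Ω)`. -/
structure IsC1Density (r : ℝ → ℝ) : Prop where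
  contDiffOn : ContDiffOn ℝ 1 r dom
  nonneg : ∀ x ∈ dom, 0 ≤ r x
  integral_eq_one : ∫ x in dom, r x = 1

/-- The measure `dϱ = r(α) dα` on `Ω`. -/
def inputMeasure (r : ℝ → ℝ) : Measure ℝ :=
  (volume.restrict dom).withDensity fun x => ENNReal.ofReal (r x)

/-- The push-forward of `ϱ` by `f`. -/
def push (r f : ℝ → ℝ) : Measure ℝ := (inputMeasure r).map f

/-- The PDF of a measure on the line: its Radon-Nikodym derivative. -/
def density (μ : Measure ℝ) : ℝ → ℝ := fun y => (μ.rnDeriv volume y).toReal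

/-- `‖p_μ - p_ν‖` in `L¹(ℝ)`. -/
def l1Dist (μ ν : Measure ℝ) : ℝ≥0∞ := eLpNorm (fun y => density μ y - density ν y) 1 volume

/-- The open region enclosed by the ellipse with foci `±1` whose semi-axes sum to `ρ`. -/
def bernsteinEllipse (ρ : ℝ) : Set ℂ := {z | ‖z - 1‖ + ‖z + 1‖ < ρ + ρ⁻¹}

end GPC

end

/-!
The argument has two independent halves.

*Approximation in `H¹`.* An element of `H^s(Ω)` is represented by the chain of its derivatives
(`MemH.exists_isChain`). The Legendre projection converges in `L²` at the rate `n^{-s}`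
(`exists_l2_sub_galerkin_le`). To control the derivative, subtract from `f` the polynomial `q` that
agrees with `f` at `±1` and has as derivative the Legendre projection of `f'`. The residual
`v = f - q` gains a power of `n` over `v'`, even in the norm with weight `1 / (1 - x²)`
(`l2_div_weight_le`), and both approximations reproduce `q`. The projection of `v` consists of two
Legendre polynomials only, whose derivatives cost a factor `√n` (`exists_galerkin_error`). The
interpolant of `v` is bounded by its samples. Their discrete norm is compared with integrals near
the Gauss-Legendre points (`sum_nodes_le`), by means of the bound for the weights (`weight_le`, from
the monotonicity of Sonin's function), and the spacing of the points; a correction at the end points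
costs the factor `√n` again (`collocation_residual_le`). Both errors are therefore of order
`n^{3/2 - s}`.

*Stability of the densities.* The `L¹` distance of the densities is the supremum over continuous
test functions `|φ| ≤ 1` of `∫ (φ(f) - φ(g)) r`. Writing `r = r e / (f'² + e) + w f'` with
`w = r f' / (f'² + e)`, the first summand contributes at most `∫ e / (f'² + e)`, while in the second
one `φ(f) f'` is a derivative, so that an integration by parts leaves an error of order
`‖f - g‖_{H¹} / min (f'² + e)` (`test_difference_le`). If `|f'| ≥ c |x - a|^k` near each critical
point `a`, the choice `e = (c δ^k)²` makes these terms of order `δ` and `h / δ^{2k}` with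
`h = ‖f - g‖_{H¹}`, and `δ = h^{1/(2k+1)}` balances them (`exists_l1Dist_push_le`). The lower bound
for `f'` follows from its Peano expansion, respectively from analyticity, and compactness of `Ω`. An
analytic function lies in every `H^s(Ω)` with one and the same `k`, which gives convergence faster
than any power of `n`.
-/

namespace GPC

/-! ### Square integrable functions on `Ω` -/

theorem measurableSet_dom : MeasurableSet dom := measurableSet_Icc

theorem uIcc_eq_dom : Set.uIcc (-1 : ℝ) 1 = dom := Set.uIcc_of_le (by norm_num)

theorem integral_dom (h : ℝ → ℝ) : ∫ x in dom, h x = ∫ x in (-1 : ℝ)..1, h x := by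
  rw [dom, integral_Icc_eq_integral_Ioc, intervalIntegral.integral_of_le (by norm_num)]

theorem integrableOn_dom_iff {h : ℝ → ℝ} :
    IntegrableOn h dom ↔ IntervalIntegrable h volume (-1) 1 := by
  rw [dom, intervalIntegrable_iff_integrableOn_Icc_of_le (by norm_num)]

instance : IsFiniteMeasure (volume.restrict dom) :=
  ⟨by rw [Measure.restrict_apply_univ]; exact isCompact_Icc.measure_lt_top⟩

theorem volume_dom : volume.real dom = 2 := by
  rw [dom, Real.volume_real_Icc]; norm_num

/-- `u` is square integrable on `Ω`. -/
abbrev L2 (u : ℝ → ℝ) : Prop := MemLp u 2 (volume.restrict dom)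

/-- The norm of `L²(Ω)` as a real number. It is the norm only for `u` in `L²(Ω)`, since the integral
of a non-integrable function is `0`. -/
noncomputable def l2 (u : ℝ → ℝ) : ℝ := √(∫ x in dom, u x ^ 2)

theorem L2.integrableOn {u : ℝ → ℝ} (hu : L2 u) : IntegrableOn u dom :=
  hu.integrable (by norm_num)

theorem L2.mul {u v : ℝ → ℝ} (hu : L2 u) (hv : L2 v) :
    IntegrableOn (fun x => u x * v x) dom := MemLp.integrable_mul hu hv

theorem L2.sq {u : ℝ → ℝ} (hu : L2 u) : IntegrableOn (fun x => u x ^ 2) dom := by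
  simpa only [pow_two] using hu.mul hu

theorem L2.of_continuousOn {u : ℝ → ℝ} (hu : ContinuousOn u dom) : L2 u := by
  obtain ⟨C, hC⟩ := isCompact_Icc.exists_bound_of_continuousOn hu
  exact MemLp.of_bound (hu.aestronglyMeasurable measurableSet_dom) C
    ((ae_restrict_iff' measurableSet_dom).2 (ae_of_all _ hC))

theorem L2.continuousOn_mul {u v : ℝ → ℝ} (hu : ContinuousOn u dom) (hv : L2 v) :
    L2 (fun x => u x * v x) := by
  obtain ⟨C, hC⟩ := isCompact_Icc.exists_bound_of_continuousOn hu
  refine MemLp.of_le_mul (c := C) hv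
    ((hu.aestronglyMeasurable measurableSet_dom).mul hv.aestronglyMeasurable)
    ((ae_restrict_iff' measurableSet_dom).2 (ae_of_all _ fun x hx => ?_))
  rw [norm_mul]
  exact mul_le_mul_of_nonneg_right (hC x hx) (norm_nonneg _)

theorem l2_nonneg (u : ℝ → ℝ) : 0 ≤ l2 u := Real.sqrt_nonneg _

theorem sq_l2 (u : ℝ → ℝ) : l2 u ^ 2 = ∫ x in dom, u x ^ 2 :=
  Real.sq_sqrt (integral_nonneg fun _ => sq_nonneg _)

theorem toReal_eLpNorm_eq_l2 {u : ℝ → ℝ} (hu : L2 u) :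
    (eLpNorm u 2 (volume.restrict dom)).toReal = l2 u := by
  rw [hu.eLpNorm_eq_integral_rpow_norm (by norm_num) (by norm_num), ENNReal.toReal_ofReal
    (by positivity), l2, Real.sqrt_eq_rpow]
  norm_num

theorem integral_add_mul_sq {u v : ℝ → ℝ} (hu : L2 u) (hv : L2 v) (t : ℝ) :
    ∫ x in dom, (u x + t * v x) ^ 2 = (∫ x in dom, v x ^ 2) * (t * t) +
      (2 * ∫ x in dom, u x * v x) * t + ∫ x in dom, u x ^ 2 := by
  have h1 : IntegrableOn (fun x => v x ^ 2 * (t * t)) dom := hv.sq.mul_const _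
  have h2 : IntegrableOn (fun x => 2 * (u x * v x) * t) dom :=
    ((hu.mul hv).const_mul _).mul_const _
  have h3 : IntegrableOn (fun x => v x ^ 2 * (t * t) + 2 * (u x * v x) * t) dom := h1.add h2
  rw [← integral_mul_const, ← integral_const_mul, ← integral_mul_const, ← integral_add h1 h2,
    ← integral_add h3 hu.sq]
  exact integral_congr_ae (ae_of_all _ fun x => by ring)

/-- The Cauchy-Schwarz inequality on `Ω`. -/
theorem integral_mul_le_l2 {u v : ℝ → ℝ} (hu : L2 u) (hv : L2 v) :
    |∫ x in dom, u x * v x| ≤ l2 u * l2 v := by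
  have key : ∀ t : ℝ, 0 ≤ (∫ x in dom, v x ^ 2) * (t * t) +
      (2 * ∫ x in dom, u x * v x) * t + ∫ x in dom, u x ^ 2 := fun t => by
    rw [← integral_add_mul_sq hu hv]
    exact integral_nonneg fun _ => sq_nonneg _
  have := discrim_le_zero key
  rw [discrim, ← sq_l2, ← sq_l2] at this
  exact abs_le_of_sq_le_sq (by nlinarith) (mul_nonneg (l2_nonneg _) (l2_nonneg _))

theorem l2_add_le {u v : ℝ → ℝ} (hu : L2 u) (hv : L2 v) :
    l2 (fun x => u x + v x) ≤ l2 u + l2 v := by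
  refine abs_le_of_sq_le_sq' ?_ (add_nonneg (l2_nonneg _) (l2_nonneg _)) |>.2
  have := integral_add_mul_sq hu hv 1
  simp only [one_mul, mul_one] at this
  rw [sq_l2, this, ← sq_l2, ← sq_l2]
  nlinarith [le_abs_self (∫ x in dom, u x * v x), integral_mul_le_l2 hu hv]

theorem l2_const_mul (c : ℝ) (u : ℝ → ℝ) : l2 (fun x => c * u x) = |c| * l2 u := by
  unfold l2
  simp only [mul_pow]
  rw [integral_const_mul, Real.sqrt_mul (sq_nonneg c), Real.sqrt_sq_eq_abs]

theorem l2_sub_le {u v : ℝ → ℝ} (hu : L2 u) (hv : L2 v) :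
    l2 (fun x => u x - v x) ≤ l2 u + l2 v := by
  have h := l2_add_le hu (hv.const_mul (-1))
  rw [l2_const_mul] at h
  simpa [sub_eq_add_neg] using h

theorem l2_mono {u v : ℝ → ℝ} (hv : L2 v) (h : ∀ x ∈ dom, |u x| ≤ |v x|) : l2 u ≤ l2 v := by
  refine Real.sqrt_le_sqrt (integral_mono_of_nonneg (ae_of_all _ fun _ => sq_nonneg _) hv.sq
    ((ae_restrict_iff' measurableSet_dom).2 (ae_of_all _ fun x hx => ?_)))
  exact sq_le_sq.2 (h x hx)

theorem l2_le_of_bound {u : ℝ → ℝ} {c : ℝ} (hc : 0 ≤ c) (h : ∀ x ∈ dom, |u x| ≤ c) :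
    l2 u ≤ 2 * c := by
  have h1 : l2 u ≤ l2 fun _ => c :=
    l2_mono (L2.of_continuousOn continuousOn_const) fun x hx => (h x hx).trans (le_abs_self c)
  refine h1.trans (abs_le_of_sq_le_sq' ?_ (by positivity)).2
  rw [sq_l2, setIntegral_const, volume_dom, smul_eq_mul]
  nlinarith

theorem integral_abs_le_l2 {u : ℝ → ℝ} (hu : L2 u) : ∫ x in dom, |u x| ≤ 2 * l2 u := by
  have h := integral_mul_le_l2 hu.abs (L2.of_continuousOn (continuousOn_const (c := (1 : ℝ))))
  have h1 : l2 (fun x => |u x|) = l2 u := by simp [l2]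
  have h2 : l2 (fun _ => (1 : ℝ)) ≤ 2 := by
    simpa using l2_le_of_bound (u := fun _ => 1) zero_le_one (fun _ _ => by simp)
  rw [show l2 |u| = l2 u from h1] at h
  simp only [Pi.abs_apply, mul_one] at h
  exact (le_abs_self _).trans (h.trans (by nlinarith [l2_nonneg u]))

/-! ### Primitives and integration by parts -/

/-- `F` is a primitive on `Ω` of the integrable function `f`: `F` is absolutely continuous with
almost everywhere derivative `f`. -/
structure IsPrim (F f : ℝ → ℝ) : Prop where
  integrableOn : IntegrableOn f dom
  eq : ∀ x ∈ dom, F x = F (-1) + ∫ t in (-1 : ℝ)..x, f t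

theorem neg_one_mem_dom : (-1 : ℝ) ∈ dom := by simp [dom]
theorem one_mem_dom : (1 : ℝ) ∈ dom := by simp [dom]

theorem ae_mem_Ioo_of_dom : ∀ᵐ x ∂(volume.restrict dom), x ∈ Set.Ioo (-1 : ℝ) 1 := by
  rw [dom, ← Measure.restrict_congr_set Ioo_ae_eq_Icc]
  exact ae_restrict_mem measurableSet_Ioo

theorem IsPrim.continuousOn {F f : ℝ → ℝ} (h : IsPrim F f) : ContinuousOn F dom := by
  refine ContinuousOn.congr ?_ h.eq
  refine continuousOn_const.add ?_
  have := intervalIntegral.continuousOn_primitive_interval (a := (-1 : ℝ)) (b := 1) (f := f)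
    (μ := volume) (by rw [uIcc_eq_dom]; exact h.integrableOn)
  rwa [uIcc_eq_dom] at this

theorem IsPrim.memL2 {F f : ℝ → ℝ} (h : IsPrim F f) : L2 F := L2.of_continuousOn h.continuousOn

theorem IsPrim.congr {F f G : ℝ → ℝ} (h : IsPrim F f) (hG : Set.EqOn G F dom) : IsPrim G f :=
  ⟨h.integrableOn, fun x hx => by rw [hG hx, hG neg_one_mem_dom, h.eq x hx]⟩

theorem IsPrim.congr_right {F f g : ℝ → ℝ} (h : IsPrim F f)
    (hg : f =ᵐ[volume.restrict dom] g) : IsPrim F g := by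
  refine ⟨h.integrableOn.congr hg, fun x hx => ?_⟩
  rw [h.eq x hx]
  congr 1
  refine intervalIntegral.integral_congr_ae ?_
  rw [EventuallyEq, ae_restrict_iff' measurableSet_dom] at hg
  filter_upwards [hg] with t ht hmem
  rw [Set.uIoc_of_le hx.1] at hmem
  exact ht ⟨hmem.1.le, hmem.2.trans hx.2⟩

theorem IsPrim.sub_mem {F f : ℝ → ℝ} (h : IsPrim F f) {x y : ℝ} (hx : x ∈ dom) (hy : y ∈ dom) :
    F y - F x = ∫ t in x..y, f t := by
  have hi := integrableOn_dom_iff.1 h.integrableOn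
  have hs : ∀ z ∈ dom, IntervalIntegrable f volume (-1) z := fun z hz =>
    hi.mono_set (by rw [uIcc_eq_dom, Set.uIcc_of_le hz.1]; exact Set.Icc_subset_Icc_right hz.2)
  rw [h.eq x hx, h.eq y hy, ← intervalIntegral.integral_interval_sub_left (hs y hy) (hs x hx)]
  ring

theorem IsPrim.of_hasDerivWithinAt {F f : ℝ → ℝ} (hf : ContinuousOn f dom)
    (h : ∀ x ∈ dom, HasDerivWithinAt F (f x) dom x) : IsPrim F f := by
  refine ⟨hf.integrableOn_compact isCompact_Icc, fun x hx => ?_⟩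
  have hsub : Set.Icc (-1) x ⊆ dom := Set.Icc_subset_Icc_right hx.2
  rw [intervalIntegral.integral_eq_sub_of_hasDerivAt_of_le hx.1
    (ContinuousOn.mono (fun y hy => (h y hy).continuousWithinAt) hsub)
    (fun y hy => (h y (hsub ⟨hy.1.le, hy.2.le⟩)).hasDerivAt
      (Icc_mem_nhds hy.1 (hy.2.trans_le hx.2)))]
  · ring
  · exact (hf.mono (by rw [Set.uIcc_of_le hx.1]; exact hsub)).intervalIntegrable

theorem IsPrim.hasDerivWithinAt {F f : ℝ → ℝ} (h : IsPrim F f) (hf : ContinuousOn f dom) {x : ℝ}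
    (hx : x ∈ dom) : HasDerivWithinAt F (f x) dom x := by
  have hlt : (-1 : ℝ) < 1 := by norm_num
  have : Fact (x ∈ Set.Icc (-1 : ℝ) 1) := ⟨hx⟩
  have := intervalIntegral.integral_hasDerivWithinAt_right (a := (-1 : ℝ)) (b := x) (f := f)
    (s := Set.Icc (-1 : ℝ) 1) (t := Set.Icc (-1 : ℝ) 1)
    (hf.mono (by rw [Set.uIcc_of_le hx.1]; exact
      Set.Icc_subset_Icc_right hx.2)).intervalIntegrable
    (hf.stronglyMeasurableAtFilter_nhdsWithin measurableSet_dom x) (hf x hx)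
  exact (this.const_add (F (-1))).congr (fun y hy => h.eq y hy) (h.eq x hx)

theorem IsPrim.poly (p : ℝ[X]) : IsPrim (fun x => p.eval x) (fun x => p.derivative.eval x) :=
  .of_hasDerivWithinAt p.derivative.continuous.continuousOn
    fun x _ => (p.hasDerivAt x).hasDerivWithinAt

theorem IsPrim.sub {F f G g : ℝ → ℝ} (hF : IsPrim F f) (hG : IsPrim G g) :
    IsPrim (fun x => F x - G x) (fun x => f x - g x) := by
  refine ⟨hF.integrableOn.sub hG.integrableOn, fun x hx => ?_⟩
  have hs : ∀ {h : ℝ → ℝ}, IntegrableOn h dom → IntervalIntegrable h volume (-1) x := fun hh =>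
    (integrableOn_dom_iff.1 hh).mono_set
      (by rw [uIcc_eq_dom, Set.uIcc_of_le hx.1]; exact Set.Icc_subset_Icc_right hx.2)
  rw [intervalIntegral.integral_sub (hs hF.integrableOn) (hs hG.integrableOn), hF.eq x hx,
    hG.eq x hx]
  ring

/-- A primitive is absolutely continuous in the sense of Mathlib. It is replaced by its integral
representation, since `F` is arbitrary outside `Ω`. -/
theorem IsPrim.absolutelyContinuousOnInterval {F f : ℝ → ℝ} (h : IsPrim F f) :
    AbsolutelyContinuousOnInterval (fun x => F (-1) + ∫ t in (-1 : ℝ)..x, f t) (-1) 1 ∧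
      ∀ᵐ x, x ∈ Set.uIcc (-1 : ℝ) 1 →
        HasDerivAt (fun x => F (-1) + ∫ t in (-1 : ℝ)..x, f t) (f x) x := by
  have hi := integrableOn_dom_iff.1 h.integrableOn
  constructor
  · have hc : AbsolutelyContinuousOnInterval (fun _ : ℝ => F (-1)) (-1) 1 :=
      (LipschitzWith.const (F (-1))).lipschitzOnWith.absolutelyContinuousOnInterval
    exact hc.fun_add (hi.absolutelyContinuousOnInterval_intervalIntegral (by simp))
  · filter_upwards [hi.ae_hasDerivAt_integral] with x hx hmem
    exact (hx hmem (-1) (by simp)).const_add _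

/-- Integration by parts for absolutely continuous functions on `Ω`. -/
theorem IsPrim.integral_mul {F f G g : ℝ → ℝ} (hF : IsPrim F f) (hG : IsPrim G g) :
    ∫ x in dom, F x * g x = F 1 * G 1 - F (-1) * G (-1) - ∫ x in dom, f x * G x := by
  obtain ⟨aF, dF⟩ := hF.absolutelyContinuousOnInterval
  obtain ⟨aG, dG⟩ := hG.absolutelyContinuousOnInterval
  have key := aF.integral_mul_deriv_eq_deriv_mul aG
  rw [← hF.eq 1 one_mem_dom, ← hG.eq 1 one_mem_dom, ← hF.eq (-1) neg_one_mem_dom,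
    ← hG.eq (-1) neg_one_mem_dom] at key
  rw [integral_dom, integral_dom]
  convert key using 1
  · refine intervalIntegral.integral_congr_ae ?_
    filter_upwards [dG] with x hx hm
    have hm' := Set.uIoc_subset_uIcc hm
    rw [(hx hm').deriv, ← hF.eq x (uIcc_eq_dom ▸ hm')]
  · congr 1
    refine intervalIntegral.integral_congr_ae ?_
    filter_upwards [dF] with x hx hm
    have hm' := Set.uIoc_subset_uIcc hm
    rw [(hx hm').deriv, ← hG.eq x (uIcc_eq_dom ▸ hm')]

theorem IsPrim.abs_sub_le {F f : ℝ → ℝ} (h : IsPrim F f) {x y : ℝ} (hx : x ∈ dom) (hy : y ∈ dom) :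
    |F y - F x| ≤ ∫ t in dom, |f t| := by
  rw [h.sub_mem hx hy, intervalIntegral.abs_intervalIntegral_eq]
  refine (abs_integral_le_integral_abs).trans ?_
  refine setIntegral_mono_set h.integrableOn.abs (ae_of_all _ fun _ => abs_nonneg _) ?_
  exact (Set.uIoc_subset_uIcc.trans (Set.uIcc_subset_Icc hx hy)).eventuallyLE

/-- The Sobolev embedding of `H¹(Ω)` into the continuous functions. -/
theorem IsPrim.abs_le {F f : ℝ → ℝ} (h : IsPrim F f) (hf : L2 f) {x : ℝ} (hx : x ∈ dom) :
    |F x| ≤ l2 F + 2 * l2 f := by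
  have hF := h.memL2
  have h1 : ∫ y in dom, |F x| ≤ ∫ y in dom, (|F y| + ∫ t in dom, |f t|) := by
    refine setIntegral_mono_on (by simp [dom]) ?_ measurableSet_dom fun y hy => ?_
    · exact hF.integrableOn.abs.add (by simp [dom])
    · have := abs_sub_abs_le_abs_sub (F x) (F y)
      linarith [h.abs_sub_le hy hx]
  rw [integral_add hF.integrableOn.abs (by simp [dom]), setIntegral_const, setIntegral_const,
    volume_dom,
    smul_eq_mul, smul_eq_mul] at h1
  linarith [integral_abs_le_l2 hF, integral_abs_le_l2 hf]

/-! ### Weak derivatives and Sobolev spaces -/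

/-- `φ` is a test function on `(-1, 1)`. -/
structure IsTest (φ : ℝ → ℝ) : Prop where
  contDiff : ContDiff ℝ ∞ φ
  hasCompactSupport : HasCompactSupport φ
  tsupport_subset : tsupport φ ⊆ Set.Ioo (-1) 1

theorem IsTest.deriv {φ : ℝ → ℝ} (h : IsTest φ) : IsTest (deriv φ) :=
  ⟨(contDiff_infty_iff_deriv.1 h.contDiff).2, h.hasCompactSupport.deriv,
    (tsupport_deriv_subset (f := φ)).trans h.tsupport_subset⟩

theorem IsTest.eq_zero {φ : ℝ → ℝ} (h : IsTest φ) {x : ℝ} (hx : x ∉ Set.Ioo (-1 : ℝ) 1) :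
    φ x = 0 := image_eq_zero_of_notMem_tsupport fun hm => hx (h.tsupport_subset hm)

theorem IsTest.isPrim {φ : ℝ → ℝ} (h : IsTest φ) : IsPrim φ (_root_.deriv φ) :=
  .of_hasDerivWithinAt h.deriv.contDiff.continuous.continuousOn fun x _ =>
    ((h.contDiff.differentiable (by simp)) x).hasDerivAt.hasDerivWithinAt

theorem integral_Ioo_eq_dom (h : ℝ → ℝ) : ∫ x in Set.Ioo (-1 : ℝ) 1, h x = ∫ x in dom, h x := by
  rw [dom, integral_Icc_eq_integral_Ioo]

theorem IsTest.integrable_mul {φ w : ℝ → ℝ} (h : IsTest φ)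
    (hw : LocallyIntegrableOn w (Set.Ioo (-1) 1)) :
    IntegrableOn (fun x => w x * φ x) (Set.Ioo (-1) 1) := by
  have h1 : IntegrableOn w (tsupport φ) :=
    hw.integrableOn_compact_subset h.tsupport_subset h.hasCompactSupport.isCompact
  have h2 : IntegrableOn (fun x => w x * φ x) (tsupport φ) :=
    h1.mul_continuousOn h.contDiff.continuous.continuousOn h.hasCompactSupport.isCompact
  refine h2.of_forall_sdiff_eq_zero measurableSet_Ioo fun x hx => ?_
  rw [image_eq_zero_of_notMem_tsupport hx.2, mul_zero]

theorem IntegrableOn.locallyIntegrableOn_Ioo {u : ℝ → ℝ} (h : IntegrableOn u dom) :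
    LocallyIntegrableOn u (Set.Ioo (-1) 1) :=
  (IntegrableOn.mono_set h Set.Ioo_subset_Icc_self).locallyIntegrableOn

theorem ae_dom_iff_Ioo {p : ℝ → Prop} :
    (∀ᵐ x ∂(volume.restrict dom), p x) ↔ ∀ᵐ x, x ∈ Set.Ioo (-1 : ℝ) 1 → p x := by
  rw [dom, ← Measure.restrict_congr_set Ioo_ae_eq_Icc, ae_restrict_iff' measurableSet_Ioo]

/-- The fundamental lemma of the calculus of variations. -/
theorem ae_eq_of_integral_test_eq {u w : ℝ → ℝ} (hu : LocallyIntegrableOn u (Set.Ioo (-1) 1))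
    (hw : LocallyIntegrableOn w (Set.Ioo (-1) 1))
    (h : ∀ φ, IsTest φ → ∫ x in Set.Ioo (-1) 1, u x * φ x = ∫ x in Set.Ioo (-1) 1, w x * φ x) :
    u =ᵐ[volume.restrict dom] w := by
  rw [EventuallyEq, ae_dom_iff_Ioo]
  have := isOpen_Ioo.ae_eq_zero_of_integral_contDiff_smul_eq_zero (hu.sub hw)
    (fun g hg1 hg2 hg3 => by
      have hg : IsTest g := ⟨hg1, hg2, hg3⟩
      rw [← setIntegral_eq_integral_of_forall_compl_eq_zero (s := Set.Ioo (-1) 1)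
        (fun x hx => by rw [hg.eq_zero hx, zero_smul])]
      rw [← sub_eq_zero.2 (h g hg), ← integral_sub (hg.integrable_mul hu) (hg.integrable_mul hw)]
      exact integral_congr_ae (ae_of_all _ fun x => by simp [mul_comm, mul_sub]))
  filter_upwards [this] with x hx hm
  simpa [sub_eq_zero] using hx hm

theorem exists_isTest_integral_eq_one :
    ∃ ψ : ℝ → ℝ, IsTest ψ ∧ ∫ x in Set.Ioo (-1 : ℝ) 1, ψ x = 1 := by
  let b : ContDiffBump (0 : ℝ) := ⟨1 / 4, 1 / 2, by norm_num, by norm_num⟩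
  have hsub : Metric.closedBall (0 : ℝ) (1 / 2) ⊆ Set.Ioo (-1) 1 := fun x hx => by
    rw [Real.closedBall_eq_Icc] at hx
    constructor <;> linarith [hx.1, hx.2]
  have ht : IsTest (b.normed volume) := ⟨b.contDiff_normed, b.hasCompactSupport_normed, by
    rw [b.tsupport_normed_eq]; exact hsub⟩
  refine ⟨_, ht, ?_⟩
  rw [setIntegral_eq_integral_of_forall_compl_eq_zero (fun x hx => ht.eq_zero hx)]
  exact b.integral_normed

/-- A test function of mean zero is the derivative of a test function. -/
theorem IsTest.exists_deriv_eq {η : ℝ → ℝ} (h : IsTest η)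
    (h0 : ∫ x in Set.Ioo (-1 : ℝ) 1, η x = 0) : ∃ Θ, IsTest Θ ∧ _root_.deriv Θ = η := by
  have hc := h.contDiff.continuous
  let Θ : ℝ → ℝ := fun x => ∫ t in (-1 : ℝ)..x, η t
  have hd : ∀ x, HasDerivAt Θ (η x) x := fun x => hc.integral_hasStrictDerivAt (-1) x |>.hasDerivAt
  have hderiv : _root_.deriv Θ = η := funext fun x => (hd x).deriv
  obtain ⟨a, b, ha, hb, hab⟩ : ∃ a b : ℝ, -1 < a ∧ b < 1 ∧ tsupport η ⊆ Set.Icc a b := by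
    rcases (tsupport η).eq_empty_or_nonempty with he | hne
    · exact ⟨0, 0, by norm_num, by norm_num, by simp [he]⟩
    · have hK := h.hasCompactSupport.isCompact
      obtain ⟨a, ha, ha'⟩ := hK.exists_isLeast hne
      obtain ⟨b, hb, hb'⟩ := hK.exists_isGreatest hne
      exact ⟨a, b, (h.tsupport_subset ha).1, (h.tsupport_subset hb).2,
        fun x hx => ⟨ha' hx, hb' hx⟩⟩
  have hz : ∀ x, x ∉ Set.Icc a b → η x = 0 := fun x hx =>
    image_eq_zero_of_notMem_tsupport fun hm => hx (hab hm)
  have htot : ∫ t in (-1 : ℝ)..1, η t = 0 := by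
    rw [← integral_dom, ← integral_Ioo_eq_dom, h0]
  have hsupp : ∀ x, x ∉ Set.Icc a b → Θ x = 0 := by
    intro x hx
    rcases lt_or_ge x a with hxa | hxa
    · refine (intervalIntegral.integral_congr (g := fun _ => 0) fun t ht => hz t fun hm => ?_).trans
        (by simp)
      have := ht.2
      rcases le_total (-1) x with h1 | h1
      · rw [sup_eq_right.2 h1] at this; linarith [hm.1]
      · rw [sup_eq_left.2 h1] at this; linarith [hm.1]
    · have hxb : b < x := lt_of_not_ge fun hh => hx ⟨hxa, hh⟩
      have : Θ x = (∫ t in (-1 : ℝ)..1, η t) + ∫ t in (1 : ℝ)..x, η t :=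
        (intervalIntegral.integral_add_adjacent_intervals (hc.intervalIntegrable _ _)
          (hc.intervalIntegrable _ _)).symm
      rw [this, htot, zero_add]
      refine (intervalIntegral.integral_congr (g := fun _ => 0) fun t ht => hz t fun hm => ?_).trans
        (by simp)
      have := ht.1
      rcases le_total 1 x with h1 | h1
      · rw [inf_eq_left.2 h1] at this; linarith [hm.2]
      · rw [inf_eq_right.2 h1] at this; linarith [hm.2]
  have hts : tsupport Θ ⊆ Set.Icc a b :=
    closure_minimal (fun x hx => by_contra fun hn => hx (hsupp x hn)) isClosed_Icc
  refine ⟨Θ, ⟨?_, ?_, ?_⟩, hderiv⟩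
  · exact contDiff_infty_iff_deriv.2 ⟨fun x => (hd x).differentiableAt, hderiv ▸ h.contDiff⟩
  · exact HasCompactSupport.intro isCompact_Icc hsupp
  · exact hts.trans fun x hx => ⟨ha.trans_le hx.1, hx.2.trans_lt hb⟩

theorem IsTest.sub_const_mul {φ ψ : ℝ → ℝ} (hφ : IsTest φ) (hψ : IsTest ψ) (m : ℝ) :
    IsTest (fun x => φ x - m * ψ x) := by
  refine ⟨hφ.contDiff.sub (contDiff_const.mul hψ.contDiff), ?_, ?_⟩
  · exact hφ.hasCompactSupport.sub (hψ.hasCompactSupport.mul_left (f := fun _ => m))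
  · refine (closure_minimal (t := tsupport φ ∪ tsupport ψ) (fun x hx => ?_)
      ((isClosed_tsupport _).union (isClosed_tsupport _))).trans
      (Set.union_subset hφ.tsupport_subset hψ.tsupport_subset)
    by_contra hn
    rw [Set.mem_union, not_or] at hn
    exact hx (by simp [image_eq_zero_of_notMem_tsupport hn.1,
      image_eq_zero_of_notMem_tsupport hn.2])

/-- A function whose weak derivative vanishes is constant: a test function differs from a
multiple of a fixed one, of integral one, by the derivative of a test function. -/
theorem exists_ae_eq_const {u : ℝ → ℝ} (hu : IntegrableOn u dom)
    (h : ∀ φ, IsTest φ → ∫ x in Set.Ioo (-1 : ℝ) 1, u x * deriv φ x = 0) :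
    ∃ c : ℝ, u =ᵐ[volume.restrict dom] fun _ => c := by
  obtain ⟨ψ, hψ, hψ1⟩ := exists_isTest_integral_eq_one
  have hul := IntegrableOn.locallyIntegrableOn_Ioo hu
  refine ⟨∫ x in Set.Ioo (-1 : ℝ) 1, u x * ψ x, ae_eq_of_integral_test_eq hul
    (IntegrableOn.locallyIntegrableOn_Ioo (by simp [dom])) fun φ hφ => ?_⟩
  set m := ∫ x in Set.Ioo (-1 : ℝ) 1, φ x with hm
  have hi : ∀ {φ : ℝ → ℝ}, IsTest φ → IntegrableOn φ (Set.Ioo (-1) 1) := fun hφ =>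
    (hφ.contDiff.continuous.integrable_of_hasCompactSupport hφ.hasCompactSupport).integrableOn
  obtain ⟨Θ, hΘ, hd⟩ := (hφ.sub_const_mul hψ m).exists_deriv_eq (by
    rw [integral_sub (hi hφ) ((hi hψ).const_mul m), integral_const_mul, hψ1, mul_one, sub_self])
  have key := h Θ hΘ
  rw [hd] at key
  have h2 := (hψ.integrable_mul hul).const_mul m
  have : ∫ x in Set.Ioo (-1 : ℝ) 1, u x * (φ x - m * ψ x) =
      (∫ x in Set.Ioo (-1 : ℝ) 1, u x * φ x) - m * ∫ x in Set.Ioo (-1 : ℝ) 1, u x * ψ x := by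
    rw [← integral_const_mul, ← integral_sub (hφ.integrable_mul hul) h2]
    exact integral_congr_ae (ae_of_all _ fun x => by ring)
  rw [integral_const_mul, ← hm, mul_comm]
  linarith

theorem IsPrim.integral_mul_deriv_test {F f φ : ℝ → ℝ} (hF : IsPrim F f) (hφ : IsTest φ) :
    ∫ x in Set.Ioo (-1 : ℝ) 1, F x * deriv φ x = - ∫ x in Set.Ioo (-1 : ℝ) 1, f x * φ x := by
  rw [integral_Ioo_eq_dom, integral_Ioo_eq_dom, hF.integral_mul hφ.isPrim,
    hφ.eq_zero (x := 1) (by simp), hφ.eq_zero (x := -1) (by simp)]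
  ring

/-- A chain of successive derivatives `F 0, F 1, …, F s` on `Ω`, all of them square integrable and
all but the last absolutely continuous. It represents an element of `H^s(Ω)`. -/
structure IsChain (s : ℕ) (F : ℕ → ℝ → ℝ) : Prop where
  isPrim : ∀ j < s, IsPrim (F j) (F (j + 1))
  memL2 : ∀ j ≤ s, L2 (F j)

theorem IsChain.isWeakDeriv {s : ℕ} {F : ℕ → ℝ → ℝ} (h : IsChain s F) {u : ℝ → ℝ}
    (hu : u =ᵐ[volume.restrict dom] F 0) {j : ℕ} (hj : j ≤ s) : IsWeakDeriv j u (F j) := by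
  refine ⟨IntegrableOn.locallyIntegrableOn_Ioo
      ((h.memL2 0 (Nat.zero_le _)).integrableOn.congr hu.symm),
    IntegrableOn.locallyIntegrableOn_Ioo (h.memL2 j hj).integrableOn, ?_⟩
  have key : ∀ φ, IsTest φ → ∫ x in Set.Ioo (-1) 1, F 0 x * iteratedDeriv j φ x =
      (-1) ^ j * ∫ x in Set.Ioo (-1) 1, F j x * φ x := by
    induction j with
    | zero => intro φ _; simp
    | succ j ih =>
      intro φ hφ
      rw [iteratedDeriv_succ', ih (by omega) _ hφ.deriv,
        (h.isPrim j (by omega)).integral_mul_deriv_test hφ]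
      ring
  intro φ h1 h2 h3
  rw [← key φ ⟨h1, h2, h3⟩, integral_Ioo_eq_dom, integral_Ioo_eq_dom]
  exact integral_congr_ae (hu.mono fun x hx => by simp only [hx])

theorem IsWeakDeriv.unique {j : ℕ} {u w w' : ℝ → ℝ} (h : IsWeakDeriv j u w)
    (h' : IsWeakDeriv j u w') : w =ᵐ[volume.restrict dom] w' := by
  refine ae_eq_of_integral_test_eq h.2.1 h'.2.1 fun φ hφ => ?_
  have := (h.2.2 φ hφ.1 hφ.2 hφ.3).symm.trans (h'.2.2 φ hφ.1 hφ.2 hφ.3)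
  exact mul_left_cancel₀ (pow_ne_zero _ (by norm_num)) this

theorem IsWeakDeriv.weakDeriv_ae_eq {j : ℕ} {u w : ℝ → ℝ} (h : IsWeakDeriv j u w) :
    weakDeriv j u =ᵐ[volume.restrict dom] w := by
  have hex : ∃ w, IsWeakDeriv j u w := ⟨w, h⟩
  rw [weakDeriv, dif_pos hex]
  exact hex.choose_spec.unique h

theorem IsChain.toReal_eLpNorm_weakDeriv {s : ℕ} {F : ℕ → ℝ → ℝ} (h : IsChain s F) {u : ℝ → ℝ}
    (hu : u =ᵐ[volume.restrict dom] F 0) {j : ℕ} (hj : j ≤ s) :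
    (eLpNorm (weakDeriv j u) 2 (volume.restrict dom)).toReal = l2 (F j) := by
  rw [eLpNorm_congr_ae (h.isWeakDeriv hu hj).weakDeriv_ae_eq, toReal_eLpNorm_eq_l2 (h.memL2 j hj)]

theorem IsChain.hNorm_eq {s : ℕ} {F : ℕ → ℝ → ℝ} (h : IsChain s F) {u : ℝ → ℝ}
    (hu : u =ᵐ[volume.restrict dom] F 0) :
    hNorm s u = √(∑ j ∈ Finset.range (s + 1), l2 (F j) ^ 2) := by
  unfold hNorm
  congr 1
  exact Finset.sum_congr rfl fun j hj => by
    rw [h.toReal_eLpNorm_weakDeriv hu (Finset.mem_range_succ_iff.1 hj)]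

theorem IsChain.l2_le_hNorm {s : ℕ} {F : ℕ → ℝ → ℝ} (h : IsChain s F) {u : ℝ → ℝ}
    (hu : u =ᵐ[volume.restrict dom] F 0) {j : ℕ} (hj : j ≤ s) : l2 (F j) ≤ hNorm s u := by
  rw [h.hNorm_eq hu]
  refine Real.le_sqrt_of_sq_le ?_
  exact Finset.single_le_sum (f := fun j => l2 (F j) ^ 2) (fun _ _ => sq_nonneg _)
    (Finset.mem_range_succ_iff.2 hj)

theorem isPrim_primitive {f : ℝ → ℝ} (hf : IntegrableOn f dom) (c : ℝ) :
    IsPrim (fun x => c + ∫ t in (-1 : ℝ)..x, f t) f := ⟨hf, fun x _ => by simp⟩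

theorem eqOn_dom_of_ae_eq {u v : ℝ → ℝ} (hu : ContinuousOn u dom) (hv : ContinuousOn v dom)
    (h : u =ᵐ[volume.restrict dom] v) : Set.EqOn u v dom :=
  Measure.eqOn_Icc_of_ae_eq volume (by norm_num) h hu hv

/-- A continuous element of `H^s(Ω)`, `s ≥ 1`, has absolutely continuous derivatives of order
less than `s`: each weak derivative is, up to a constant, the primitive of the next one. -/
theorem MemH.exists_isChain {s : ℕ} {f : ℝ → ℝ} (h : MemH s f) (hf : ContinuousOn f dom)
    (hs : 1 ≤ s) : ∃ F, IsChain s F ∧ Set.EqOn f (F 0) dom := by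
  choose! w hw hw' using h
  have hw2 : ∀ j ≤ s, L2 (w j) := hw'
  have step : ∀ j < s, ∃ c : ℝ, w j =ᵐ[volume.restrict dom]
      fun x => c + ∫ t in (-1 : ℝ)..x, w (j + 1) t := by
    intro j hj
    have hp := isPrim_primitive (hw2 (j + 1) hj).integrableOn 0
    have hj1 := (hw2 j hj.le).integrableOn
    obtain ⟨c, hc⟩ := exists_ae_eq_const (u := fun x => w j x -
        (0 + ∫ t in (-1 : ℝ)..x, w (j + 1) t)) (hj1.sub hp.memL2.integrableOn) fun φ hφ => by
      have e1 := (hw j hj.le).2.2 _ hφ.deriv.1 hφ.deriv.2 hφ.deriv.3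
      have e2 := (hw (j + 1) hj).2.2 φ hφ.1 hφ.2 hφ.3
      rw [iteratedDeriv_succ', e1, pow_succ, mul_assoc] at e2
      have e3 := mul_left_cancel₀ (pow_ne_zero _ (by norm_num)) e2
      have e4 := hp.integral_mul_deriv_test hφ
      have : ∫ x in Set.Ioo (-1 : ℝ) 1, (w j x - (0 + ∫ t in (-1 : ℝ)..x, w (j + 1) t)) *
          deriv φ x = (∫ x in Set.Ioo (-1 : ℝ) 1, w j x * deriv φ x) -
          ∫ x in Set.Ioo (-1 : ℝ) 1, (0 + ∫ t in (-1 : ℝ)..x, w (j + 1) t) * deriv φ x := by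
        rw [← integral_sub
          (hφ.deriv.integrable_mul (IntegrableOn.locallyIntegrableOn_Ioo hj1))
          (hφ.deriv.integrable_mul (IntegrableOn.locallyIntegrableOn_Ioo hp.memL2.integrableOn))]
        exact integral_congr_ae (ae_of_all _ fun x => by ring)
      rw [this, e3, e4]
      ring
    exact ⟨c, hc.mono fun x hx => by
      simp only [zero_add] at hx ⊢
      linarith⟩
  choose! c hc using step
  let F : ℕ → ℝ → ℝ := fun j => if j < s then fun x => c j + ∫ t in (-1 : ℝ)..x, w (j + 1) t
    else w j
  have hF : ∀ j ≤ s, w j =ᵐ[volume.restrict dom] F j := fun j hj => by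
    by_cases hjs : j < s
    · simpa only [F, if_pos hjs] using hc j hjs
    · simp only [F, if_neg hjs]; rfl
  have hprim : ∀ j < s, IsPrim (F j) (F (j + 1)) := fun j hj => by
    refine IsPrim.congr_right ?_ (hF (j + 1) hj)
    simp only [F, if_pos hj]
    exact isPrim_primitive (hw2 (j + 1) hj).integrableOn _
  have hchain : IsChain s F := ⟨hprim, fun j hj => (memLp_congr_ae (hF j hj)).1 (hw2 j hj)⟩
  refine ⟨F, hchain, ?_⟩
  refine eqOn_dom_of_ae_eq hf (hprim 0 hs).continuousOn
    (EventuallyEq.trans ?_ (hF 0 (Nat.zero_le _)))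
  refine ae_eq_of_integral_test_eq (hw 0 (Nat.zero_le _)).1 (hw 0 (Nat.zero_le _)).2.1
    fun φ hφ => ?_
  simpa using (hw 0 (Nat.zero_le _)).2.2 φ hφ.1 hφ.2 hφ.3

/-- The integral over `Ω`, as a linear form on polynomials. -/
noncomputable def polyInt : ℝ[X] →ₗ[ℝ] ℝ where
  toFun p := ∫ x in dom, p.eval x
  map_add' p q := by
    simp only [eval_add]
    exact integral_add (p.continuous.continuousOn.integrableOn_compact isCompact_Icc)
      (q.continuous.continuousOn.integrableOn_compact isCompact_Icc)
  map_smul' c p := by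
    simp only [eval_smul, smul_eq_mul, RingHom.id_apply]
    exact integral_const_mul _ _

theorem polyInt_apply (p : ℝ[X]) : polyInt p = ∫ x in dom, p.eval x := rfl

theorem polyInt_C_mul (c : ℝ) (p : ℝ[X]) : polyInt (C c * p) = c * polyInt p := by
  rw [← smul_eq_C_mul, map_smul, smul_eq_mul]

theorem polyInt_derivative (p : ℝ[X]) : polyInt (derivative p) = p.eval 1 - p.eval (-1) := by
  have := (IsPrim.poly p).eq 1 one_mem_dom
  rw [polyInt_apply, integral_dom]
  linarith

theorem L2.poly (p : ℝ[X]) : L2 (fun x => p.eval x) := .of_continuousOn p.continuous.continuousOn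

theorem sq_l2_poly (p : ℝ[X]) : l2 (fun x => p.eval x) ^ 2 = polyInt (p ^ 2) := by
  rw [sq_l2, polyInt_apply]; simp

/-! ### The Legendre polynomials -/

theorem derivative_base (n : ℕ) :
    (X ^ 2 - 1 : ℝ[X]) * derivative ((X ^ 2 - 1) ^ n) = C (2 * (n : ℝ)) * X * (X ^ 2 - 1) ^ n := by
  cases n with
  | zero => simp
  | succ n =>
    rw [derivative_pow]
    simp only [derivative_sub, derivative_X_pow, derivative_one, Nat.add_sub_cancel]
    simp only [map_mul, map_add, Nat.cast_succ, map_one, map_natCast, map_ofNat]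
    ring

/-- The derivatives of the differential equation satisfied by `(X² - 1)ⁿ`. -/
theorem iterate_derivative_base (n k : ℕ) :
    (X ^ 2 - 1 : ℝ[X]) * derivative^[k + 2] ((X ^ 2 - 1) ^ n) =
      C (2 * (n : ℝ) - 2 * (k + 1)) * X * derivative^[k + 1] ((X ^ 2 - 1) ^ n) +
      C ((k + 1) * (2 * (n : ℝ) - k)) * derivative^[k] ((X ^ 2 - 1) ^ n) := by
  induction k with
  | zero =>
    have h := congrArg derivative (derivative_base n)
    simp only [derivative_mul, derivative_sub, derivative_X_pow, derivative_one, derivative_C,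
      derivative_X] at h
    simp only [Function.iterate_succ_apply', Function.iterate_zero_apply]
    simp only [map_mul, map_sub, map_add, map_one, map_ofNat, map_natCast, Nat.cast_zero,
      Nat.cast_ofNat, pow_one, Nat.reduceSub, map_zero] at h ⊢
    linear_combination h
  | succ k ih =>
    have h := congrArg derivative ih
    simp only [derivative_mul, derivative_sub, derivative_X_pow, derivative_one, derivative_C,
      derivative_X, derivative_add] at h
    simp only [Function.iterate_succ_apply'] at h ⊢
    simp only [map_mul, map_sub, map_add, map_one, map_ofNat, map_natCast, Nat.cast_succ,
      pow_one, Nat.reduceSub] at h ⊢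
    linear_combination h

/-- Legendre's differential equation. -/
theorem legendre_ode (n : ℕ) :
    derivative ((X ^ 2 - 1) * derivative (legendre n)) = C ((n : ℝ) * (n + 1)) * legendre n := by
  have h := iterate_derivative_base n n
  rw [legendre, derivative_C_mul]
  simp only [derivative_mul, derivative_C, derivative_sub, derivative_X_pow, derivative_one]
  simp only [Function.iterate_succ_apply'] at h
  simp only [map_mul, map_sub, map_add, map_one, map_ofNat, map_natCast, Nat.cast_ofNat, pow_one,
    Nat.reduceSub] at h ⊢
  linear_combination C (1 / (2 ^ n * (n.factorial : ℝ))) * h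

theorem legendre_ode_eval (n : ℕ) (x : ℝ) :
    (1 - x ^ 2) * (derivative (derivative (legendre n))).eval x =
      2 * x * (derivative (legendre n)).eval x - n * (n + 1) * (legendre n).eval x := by
  have h := congrArg (eval x) (legendre_ode n)
  simp only [derivative_mul, derivative_sub, derivative_X_pow, derivative_one, eval_add, eval_mul,
    eval_sub, eval_pow, eval_X, eval_one, eval_C, eval_zero,
    Nat.cast_ofNat, Nat.reduceSub, pow_one] at h
  linarith

theorem base_natDegree (n : ℕ) : ((X ^ 2 - 1 : ℝ[X]) ^ n).natDegree = 2 * n := by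
  have : (X ^ 2 - 1 : ℝ[X]) = X ^ 2 - C 1 := by simp
  rw [natDegree_pow, this, natDegree_X_pow_sub_C, mul_comm]

theorem base_coeff (n : ℕ) : ((X ^ 2 - 1 : ℝ[X]) ^ n).coeff (n + n) = 1 := by
  have : (X ^ 2 - 1 : ℝ[X]) = X ^ 2 - C 1 := by simp
  have hm : ((X ^ 2 - 1 : ℝ[X]) ^ n).Monic := by
    rw [this]; exact (monic_X_pow_sub_C 1 (by norm_num)).pow n
  have := hm.coeff_natDegree
  rwa [base_natDegree, two_mul] at this

theorem legendre_coeff_pos (n : ℕ) : 0 < (legendre n).coeff n := by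
  rw [legendre, coeff_C_mul, coeff_iterate_derivative, base_coeff, nsmul_eq_mul, mul_one]
  have : 0 < (n + n).descFactorial n := Nat.descFactorial_pos.2 (by omega)
  positivity

theorem legendre_natDegree_le (n : ℕ) : (legendre n).natDegree ≤ n := by
  rw [natDegree_le_iff_coeff_eq_zero]
  intro m hm
  rw [legendre, coeff_C_mul, coeff_iterate_derivative, coeff_eq_zero_of_natDegree_lt
    (by rw [base_natDegree]; omega)]
  simp

theorem legendre_natDegree (n : ℕ) : (legendre n).natDegree = n :=
  le_antisymm (legendre_natDegree_le n) (le_natDegree_of_ne_zero (legendre_coeff_pos n).ne')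

theorem legendre_ne_zero (n : ℕ) : legendre n ≠ 0 := fun h => by
  have := legendre_coeff_pos n
  simp [h] at this

theorem legendre_eval_one (n : ℕ) : (legendre n).eval 1 = 1 := by
  have h := aeval_iterate_derivative_self (A := ℝ) ((X ^ 2 - 1 : ℝ[X]) ^ n) n (1 : ℝ)
    (p' := (X + 1) ^ n) (by
      rw [← mul_pow]
      simp
      ring)
  rw [legendre, eval_mul, eval_C, ← coe_aeval_eq_eval, h]
  simp
  have : (n.factorial : ℝ) ≠ 0 := by positivity
  field_simp
  norm_num

theorem iterate_derivative_comp_neg (k : ℕ) (p : ℝ[X]) :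
    derivative^[k] (p.comp (-X)) = C ((-1) ^ k) * (derivative^[k] p).comp (-X) := by
  induction k with
  | zero => simp
  | succ k ih =>
    rw [Function.iterate_succ_apply', ih, Function.iterate_succ_apply', derivative_C_mul,
      derivative_comp]
    simp [pow_succ]

theorem legendre_comp_neg (n : ℕ) : (legendre n).comp (-X) = C ((-1) ^ n) * legendre n := by
  have h := iterate_derivative_comp_neg n ((X ^ 2 - 1) ^ n)
  have h1 : ((X ^ 2 - 1 : ℝ[X]) ^ n).comp (-X) = (X ^ 2 - 1) ^ n := by simp
  rw [h1] at h
  have h2 : (C ((-1) ^ n) * C ((-1) ^ n) : ℝ[X]) = 1 := by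
    rw [← C_mul, ← mul_pow]; simp
  have h3 : (derivative^[n] ((X ^ 2 - 1 : ℝ[X]) ^ n)).comp (-X) =
      C ((-1) ^ n) * derivative^[n] ((X ^ 2 - 1) ^ n) := by
    linear_combination -C ((-1) ^ n) * h - (derivative^[n] ((X ^ 2 - 1 : ℝ[X]) ^ n)).comp (-X) * h2
  rw [legendre, mul_comp, C_comp, h3]
  ring

theorem legendre_eval_neg (n : ℕ) (x : ℝ) :
    (legendre n).eval (-x) = (-1) ^ n * (legendre n).eval x := by
  have := congrArg (eval x) (legendre_comp_neg n)
  simpa using this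

theorem legendre_derivative_eval_neg (n : ℕ) (x : ℝ) :
    (derivative (legendre n)).eval (-x) = -((-1) ^ n * (derivative (legendre n)).eval x) := by
  have := congrArg (eval x) (congrArg derivative (legendre_comp_neg n))
  rw [derivative_comp, derivative_C_mul] at this
  simp at this
  linarith

theorem neg_one_pow_mul_self (n : ℕ) : ((-1 : ℝ) ^ n) * (-1) ^ n = 1 := by
  rw [← mul_pow]; simp

theorem legendre_eval_neg_one (n : ℕ) : (legendre n).eval (-1) = (-1) ^ n := by
  rw [legendre_eval_neg, legendre_eval_one, mul_one]

theorem legendre_derivative_eval_one (n : ℕ) :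
    (derivative (legendre n)).eval 1 = n * (n + 1) / 2 := by
  have := legendre_ode_eval n 1
  rw [legendre_eval_one] at this
  linarith

/-- The Legendre operator is symmetric and maps `X ^ d` to `d (d + 1) X ^ d` up to a lower power,
so the integral is a multiple, different from `1`, of itself. -/
theorem polyInt_legendre_mul_X_pow {n : ℕ} : ∀ d < n, polyInt (legendre n * X ^ d) = 0 := by
  intro d
  induction d using Nat.strong_induction_on with
  | _ d ih =>
    intro hd
    set P := legendre n
    have h1 : derivative ((X ^ 2 - 1) * derivative P * X ^ d - (X ^ 2 - 1) * P * derivative (X ^ d))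
        = derivative ((X ^ 2 - 1) * derivative P) * X ^ d -
          P * derivative ((X ^ 2 - 1) * derivative (X ^ d)) := by
      simp only [derivative_mul, derivative_sub]; ring
    have h2 : derivative ((X ^ 2 - 1) * derivative (X ^ d)) =
        C ((d : ℝ) * (d + 1)) * X ^ d - C ((d : ℝ) * (d - 1)) * X ^ (d - 2) := by
      rcases d with _ | _ | d
      · simp
      · simp
      · rw [show d + 1 + 1 - 2 = d by omega]
        simp only [derivative_X_pow, derivative_mul, derivative_one,
          Nat.add_sub_cancel, Nat.cast_add, Nat.cast_one, map_add, map_mul, map_natCast, map_one,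
          map_sub, map_ofNat, derivative_natCast, Nat.cast_ofNat]
        ring
    have h3 : (d : ℝ) * (d - 1) * polyInt (P * X ^ (d - 2)) = 0 := by
      rcases lt_or_ge d 2 with h | h
      · interval_cases d <;> simp
      · rw [ih (d - 2) (by omega) (by omega), mul_zero]
    have h4 := polyInt_derivative
      ((X ^ 2 - 1) * derivative P * X ^ d - (X ^ 2 - 1) * P * derivative (X ^ d))
    rw [h1, legendre_ode, h2] at h4
    have h5 : C ((n : ℝ) * (n + 1)) * P * X ^ d - P * (C ((d : ℝ) * (d + 1)) * X ^ d -
        C ((d : ℝ) * (d - 1)) * X ^ (d - 2)) =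
        C ((n : ℝ) * (n + 1) - d * (d + 1)) * (P * X ^ d) +
          C ((d : ℝ) * (d - 1)) * (P * X ^ (d - 2)) := by
      rw [map_sub]; ring
    rw [h5, map_add, polyInt_C_mul, polyInt_C_mul, h3] at h4
    simp only [eval_sub, eval_mul, eval_pow, eval_X, eval_one] at h4
    norm_num at h4
    refine h4.resolve_left ?_
    have : (d : ℝ) + 1 ≤ n := by exact_mod_cast hd
    nlinarith [(Nat.cast_nonneg d : (0 : ℝ) ≤ d)]

/-- `P_n` is orthogonal to the polynomials of degree less than `n`. -/
theorem polyInt_legendre_mul_of_degree_lt {n : ℕ} {q : ℝ[X]} (hq : q.degree < n) :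
    polyInt (legendre n * q) = 0 := by
  rcases eq_or_ne q 0 with rfl | h0
  · simp
  rw [q.as_sum_range_C_mul_X_pow, Finset.mul_sum, map_sum]
  refine Finset.sum_eq_zero fun d hd => ?_
  have hd' : d < n := by
    have := (natDegree_lt_iff_degree_lt h0).2 hq
    have := Finset.mem_range.1 hd
    omega
  rw [mul_left_comm, polyInt_C_mul, polyInt_legendre_mul_X_pow d hd', mul_zero]

theorem degree_lt_of_coeff_eq_zero {q : ℝ[X]} {n : ℕ} (hq : q.natDegree ≤ n)
    (h : q.coeff n = 0) : q.degree < n := by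
  rw [degree_lt_iff_coeff_zero]
  intro m hm
  rcases hm.eq_or_lt with rfl | h'
  · exact h
  · exact coeff_eq_zero_of_natDegree_lt (hq.trans_lt h')

theorem polyInt_legendre_mul {n : ℕ} {q : ℝ[X]} (hq : q.natDegree ≤ n) :
    polyInt (legendre n * q) =
      q.coeff n / (legendre n).coeff n * polyInt (legendre n ^ 2) := by
  have h := (legendre_coeff_pos n).ne'
  have h1 : (q - C (q.coeff n / (legendre n).coeff n) * legendre n).degree < n := by
    refine degree_lt_of_coeff_eq_zero ?_ ?_
    · exact (natDegree_sub_le _ _).trans (max_le hq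
        ((natDegree_C_mul_le _ _).trans (legendre_natDegree_le n)))
    · rw [coeff_sub, coeff_C_mul]; field_simp; ring
  have h2 := polyInt_legendre_mul_of_degree_lt h1
  rw [mul_sub, map_sub, mul_left_comm, polyInt_C_mul, ← pow_two] at h2
  linarith

theorem natDegree_X_mul_derivative_le {p : ℝ[X]} {n : ℕ} (hp : p.natDegree ≤ n) :
    (X * derivative p).natDegree ≤ n := by
  rw [natDegree_le_iff_coeff_eq_zero]
  rintro (_ | m) hm
  · omega
  · rw [coeff_X_mul, coeff_derivative, coeff_eq_zero_of_natDegree_lt (hp.trans_lt hm), zero_mul]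

theorem polyInt_legendre_sq (n : ℕ) : polyInt (legendre n ^ 2) = 2 / (2 * n + 1) := by
  have h1 := polyInt_derivative (X * legendre n ^ 2)
  have h2 : derivative (X * legendre n ^ 2) =
      legendre n ^ 2 + C 2 * (legendre n * (X * derivative (legendre n))) := by
    simp only [derivative_mul, derivative_X, derivative_pow, map_ofNat]
    norm_num [C_ofNat]
    ring
  have h3 := polyInt_legendre_mul (natDegree_X_mul_derivative_le (legendre_natDegree_le n))
  have h4 : (X * derivative (legendre n)).coeff n / (legendre n).coeff n = n := by
    rw [div_eq_iff (legendre_coeff_pos n).ne']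
    cases n with
    | zero => simp
    | succ n => rw [coeff_X_mul, coeff_derivative]; push_cast; ring
  rw [h4] at h3
  rw [h2, map_add, polyInt_C_mul, h3] at h1
  simp only [eval_mul, eval_X, eval_pow, legendre_eval_one, legendre_eval_neg_one] at h1
  have := neg_one_pow_mul_self n
  rw [eq_div_iff (by positivity)]
  linear_combination h1 + this

theorem polyInt_derivative_legendre_sq (n : ℕ) :
    polyInt (derivative (legendre n) ^ 2) = n * (n + 1) := by
  have h1 := polyInt_derivative (legendre n * derivative (legendre n))
  have h2 : (derivative (derivative (legendre n))).degree < n := by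
    rw [degree_lt_iff_coeff_zero]
    intro m hm
    rw [coeff_derivative, coeff_derivative, coeff_eq_zero_of_natDegree_lt
      (by rw [legendre_natDegree]; omega)]
    simp
  rw [derivative_mul, map_add, polyInt_legendre_mul_of_degree_lt h2, ← pow_two] at h1
  have h3 := legendre_derivative_eval_neg n 1
  simp only [eval_mul, legendre_eval_one, legendre_eval_neg_one, h3,
    legendre_derivative_eval_one] at h1
  linear_combination h1 + ((n : ℝ) * (n + 1) / 2) * neg_one_pow_mul_self n

/-- The ratio of consecutive leading coefficients, from integrating `(P_{n+1} P_n)'`. -/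
theorem legendre_coeff_succ (n : ℕ) :
    (legendre n).coeff n / (legendre (n + 1)).coeff (n + 1) = (n + 1) / (2 * n + 1) := by
  have h1 := polyInt_derivative (legendre (n + 1) * legendre n)
  have h2 : (derivative (legendre n)).degree < (n + 1 : ℕ) := by
    rw [degree_lt_iff_coeff_zero]
    intro m hm
    rw [coeff_derivative, coeff_eq_zero_of_natDegree_lt (by rw [legendre_natDegree]; omega),
      zero_mul]
  have h3 : (derivative (legendre (n + 1))).natDegree ≤ n := by
    rw [natDegree_le_iff_coeff_eq_zero]
    intro m hm
    rw [coeff_derivative, coeff_eq_zero_of_natDegree_lt (by rw [legendre_natDegree]; omega),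
      zero_mul]
  rw [derivative_mul, map_add, polyInt_legendre_mul_of_degree_lt h2, mul_comm,
    polyInt_legendre_mul h3, polyInt_legendre_sq, coeff_derivative] at h1
  simp only [eval_mul, legendre_eval_one, legendre_eval_neg_one] at h1
  have := neg_one_pow_mul_self n
  rw [pow_succ] at h1
  have ha := (legendre_coeff_pos n).ne'
  have hb := (legendre_coeff_pos (n + 1)).ne'
  have hn : (0 : ℝ) < 2 * n + 1 := by positivity
  rw [div_eq_div_iff hb hn.ne']
  have h5 : (legendre (n + 1)).coeff (n + 1) * (n + 1) / (legendre n).coeff n * (2 / (2 * n + 1)) =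
      2 := by linear_combination h1 + this
  field_simp at h5
  linarith

theorem polyInt_legendre_succ_mul_X_mul (n : ℕ) :
    polyInt (legendre (n + 1) * (X * legendre n)) = (n + 1) / (2 * n + 1) * (2 / (2 * n + 3)) := by
  rw [polyInt_legendre_mul, polyInt_legendre_sq, coeff_X_mul, legendre_coeff_succ]
  · push_cast; ring_nf
  · exact natDegree_mul_le.trans (by rw [natDegree_X, legendre_natDegree]; omega)

theorem polyInt_legendreNormalized_sq (n : ℕ) : polyInt (legendreNormalized n ^ 2) = 1 := by
  rw [legendreNormalized, mul_pow, ← C_pow, polyInt_C_mul, polyInt_legendre_sq,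
    Real.sq_sqrt (by positivity)]
  field_simp

theorem polyInt_legendreNormalized_mul {i j : ℕ} (h : i ≠ j) :
    polyInt (legendreNormalized i * legendreNormalized j) = 0 := by
  wlog hij : j < i generalizing i j
  · rw [mul_comm]; exact this h.symm (lt_of_le_of_ne (not_lt.1 hij) h)
  rw [legendreNormalized, mul_assoc, polyInt_C_mul, polyInt_legendre_mul_of_degree_lt, mul_zero]
  refine degree_lt_of_coeff_eq_zero ?_ ?_
  · exact (natDegree_C_mul_le _ _).trans ((legendre_natDegree_le j).trans hij.le)
  · rw [legendreNormalized, coeff_C_mul,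
      coeff_eq_zero_of_natDegree_lt (by rw [legendre_natDegree]; exact hij), mul_zero]

theorem legendreNormalized_natDegree_le (n : ℕ) : (legendreNormalized n).natDegree ≤ n :=
  (natDegree_C_mul_le _ _).trans (legendre_natDegree_le n)

theorem legendreNormalized_ode (n : ℕ) :
    derivative ((X ^ 2 - 1) * derivative (legendreNormalized n)) =
      C ((n : ℝ) * (n + 1)) * legendreNormalized n := by
  rw [legendreNormalized, derivative_C_mul, mul_left_comm, derivative_C_mul, legendre_ode]
  ring

/-! ### The Legendre projection -/

theorem galerkin_natDegree_le (u : ℝ → ℝ) (n : ℕ) : (galerkin u n).natDegree ≤ n :=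
  natDegree_sum_le_of_forall_le _ _ fun j hj => (natDegree_C_mul_le _ _).trans
    ((legendreNormalized_natDegree_le j).trans (Finset.mem_range_succ_iff.1 hj))

theorem galerkin_congr {u v : ℝ → ℝ} (h : Set.EqOn u v dom) (n : ℕ) :
    galerkin u n = galerkin v n := by
  unfold galerkin
  refine Finset.sum_congr rfl fun j _ => ?_
  rw [setIntegral_congr_fun (g := fun x => (legendreNormalized j).eval x * v x) measurableSet_dom
    fun x hx => by simp only [h hx]]

theorem polyInt_legendreNormalized_mul_sum (n i : ℕ) (hi : i ≤ n) (c : ℕ → ℝ) :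
    polyInt (legendreNormalized i * ∑ j ∈ Finset.range (n + 1), C (c j) * legendreNormalized j) =
      c i := by
  rw [Finset.mul_sum, map_sum, Finset.sum_eq_single i]
  · rw [mul_left_comm, polyInt_C_mul, ← pow_two, polyInt_legendreNormalized_sq, mul_one]
  · intro j _ hj
    rw [mul_left_comm, polyInt_C_mul, polyInt_legendreNormalized_mul hj.symm, mul_zero]
  · intro h
    exact absurd (Finset.mem_range_succ_iff.2 hi) h

/-- The Legendre expansion of a polynomial. -/
theorem sum_polyInt_legendreNormalized_mul {p : ℝ[X]} {n : ℕ} (hp : p.natDegree ≤ n) :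
    ∑ j ∈ Finset.range (n + 1), C (polyInt (legendreNormalized j * p)) * legendreNormalized j
      = p := by
  set q := ∑ j ∈ Finset.range (n + 1), C (polyInt (legendreNormalized j * p)) *
    legendreNormalized j with hq
  by_contra hne
  have hd : q - p ≠ 0 := sub_ne_zero.2 hne
  set m := (q - p).natDegree with hm
  have hmn : m ≤ n := (natDegree_sub_le _ _).trans (max_le (natDegree_sum_le_of_forall_le _ _
    fun j hj => (natDegree_C_mul_le _ _).trans
      ((legendreNormalized_natDegree_le j).trans (Finset.mem_range_succ_iff.1 hj))) hp)
  have h0 : polyInt (legendreNormalized m * (q - p)) = 0 := by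
    rw [mul_sub, map_sub, hq, polyInt_legendreNormalized_mul_sum n m hmn, sub_self]
  rw [legendreNormalized, mul_assoc, polyInt_C_mul, polyInt_legendre_mul hm.symm.le,
    polyInt_legendre_sq] at h0
  have h1 : (q - p).coeff m ≠ 0 := by rw [hm, coeff_natDegree, leadingCoeff_ne_zero]; exact hd
  have h2 := (legendre_coeff_pos m).ne'
  have h3 : √((2 * (m : ℝ) + 1) / 2) ≠ 0 := (Real.sqrt_pos.2 (by positivity)).ne'
  have h4 : (2 : ℝ) / (2 * m + 1) ≠ 0 := by positivity
  exact mul_ne_zero h3 (mul_ne_zero (div_ne_zero h1 h2) h4) h0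

theorem galerkin_mul_integral {u : ℝ → ℝ} (hu : L2 u) {n : ℕ} {q : ℝ[X]} (hq : q.natDegree ≤ n) :
    ∫ x in dom, q.eval x * (u x - (galerkin u n).eval x) = 0 := by
  have h1 : ∀ j ≤ n, ∫ x in dom, (legendreNormalized j).eval x * (u x - (galerkin u n).eval x)
      = 0 := fun j hj => by
    have h := polyInt_legendreNormalized_mul_sum n j hj
      fun j => ∫ x in dom, (legendreNormalized j).eval x * u x
    simp only [polyInt_apply, eval_mul] at h
    simp only [mul_sub]
    rw [integral_sub ((L2.poly _).mul hu) ((L2.poly _).mul (L2.poly _)), sub_eq_zero]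
    exact h.symm
  have hd : L2 fun x => u x - (galerkin u n).eval x := hu.sub (L2.poly _)
  rw [← sum_polyInt_legendreNormalized_mul hq]
  simp only [eval_finsetSum, eval_mul, eval_C, Finset.sum_mul]
  rw [integral_finsetSum _ fun j _ => by
    simp only [mul_assoc]
    exact ((L2.poly _).mul hd).const_mul _]
  refine Finset.sum_eq_zero fun j hj => ?_
  simp only [mul_assoc]
  rw [integral_const_mul, h1 j (Finset.mem_range_succ_iff.1 hj), mul_zero]

/-- The Legendre projection is the best approximation in `L²`. -/
theorem l2_sub_galerkin_le {u : ℝ → ℝ} (hu : L2 u) {n : ℕ} {q : ℝ[X]} (hq : q.natDegree ≤ n) :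
    l2 (fun x => u x - (galerkin u n).eval x) ≤ l2 (fun x => u x - q.eval x) := by
  have hd : L2 fun x => u x - (galerkin u n).eval x := hu.sub (L2.poly _)
  have h1 := integral_add_mul_sq hd (L2.poly (galerkin u n - q)) 1
  have h2 := galerkin_mul_integral hu (q := galerkin u n - q)
    ((natDegree_sub_le _ _).trans (max_le (galerkin_natDegree_le u n) hq))
  simp only [mul_comm] at h2
  rw [h2] at h1
  have h3 : ∀ x, u x - (galerkin u n).eval x + 1 * (galerkin u n - q).eval x = u x - q.eval x :=
    fun x => by rw [eval_sub]; ring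
  simp only [h3] at h1
  refine (abs_le_of_sq_le_sq' ?_ (l2_nonneg _)).2
  rw [sq_l2, sq_l2, h1]
  have : 0 ≤ ∫ x in dom, (galerkin u n - q).eval x ^ 2 := integral_nonneg fun _ => sq_nonneg _
  linarith

theorem polyInt_weighted (p q : ℝ[X]) : polyInt ((1 - X ^ 2) * derivative p * derivative q) =
    polyInt (derivative ((X ^ 2 - 1) * derivative p) * q) := by
  have h := polyInt_derivative ((1 - X ^ 2) * derivative p * q)
  have h2 : derivative ((1 - X ^ 2) * derivative p * q) =
      (1 - X ^ 2) * derivative p * derivative q - derivative ((X ^ 2 - 1) * derivative p) * q := by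
    simp only [derivative_mul, derivative_sub, derivative_one, derivative_X_pow]
    ring
  have h3 : ((1 - X ^ 2) * derivative p * q).eval 1 -
      ((1 - X ^ 2) * derivative p * q).eval (-1) = 0 := by
    simp
  rw [h2, map_sub, h3] at h
  linarith

theorem derivative_weighted_sum (n : ℕ) (c : ℕ → ℝ) :
    derivative ((X ^ 2 - 1) * derivative
      (∑ j ∈ Finset.range (n + 1), C (c j) * legendreNormalized j)) =
      ∑ j ∈ Finset.range (n + 1), C ((j : ℝ) * (j + 1) * c j) * legendreNormalized j := by
  rw [derivative_sum, Finset.mul_sum, derivative_sum]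
  refine Finset.sum_congr rfl fun j _ => ?_
  rw [derivative_C_mul, mul_left_comm, derivative_C_mul, legendreNormalized_ode,
    C_mul (a := (j : ℝ) * (j + 1))]
  ring

theorem polyInt_sum_mul_sum (n : ℕ) (b c : ℕ → ℝ) :
    polyInt ((∑ j ∈ Finset.range (n + 1), C (b j) * legendreNormalized j) *
      ∑ j ∈ Finset.range (n + 1), C (c j) * legendreNormalized j) =
      ∑ j ∈ Finset.range (n + 1), b j * c j := by
  rw [Finset.sum_mul, map_sum]
  refine Finset.sum_congr rfl fun j hj => ?_
  rw [mul_assoc, polyInt_C_mul, polyInt_legendreNormalized_mul_sum n j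
    (Finset.mem_range_succ_iff.1 hj)]

theorem polyInt_weighted_sum (n : ℕ) (c : ℕ → ℝ) :
    polyInt ((1 - X ^ 2) *
      derivative (∑ j ∈ Finset.range (n + 1), C (c j) * legendreNormalized j) ^ 2) =
      ∑ j ∈ Finset.range (n + 1), (j : ℝ) * (j + 1) * c j ^ 2 := by
  rw [pow_two (derivative _), ← mul_assoc, polyInt_weighted, derivative_weighted_sum,
    polyInt_sum_mul_sum]
  exact Finset.sum_congr rfl fun j _ => by ring

/-- Bernstein's inequality in `L²`, with the weight `1 - x²`. -/
theorem polyInt_weighted_le {p : ℝ[X]} {n : ℕ} (hp : p.natDegree ≤ n) :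
    polyInt ((1 - X ^ 2) * derivative p ^ 2) ≤ n * (n + 1) * polyInt (p ^ 2) := by
  have h := sum_polyInt_legendreNormalized_mul hp
  rw [← h, polyInt_weighted_sum, pow_two (Finset.sum _ _), polyInt_sum_mul_sum, Finset.mul_sum]
  refine Finset.sum_le_sum fun j hj => ?_
  have hj' : (j : ℝ) ≤ n := by exact_mod_cast Finset.mem_range_succ_iff.1 hj
  rw [← pow_two]
  refine mul_le_mul_of_nonneg_right ?_ (sq_nonneg _)
  gcongr

theorem one_sub_sq_nonneg {x : ℝ} (hx : x ∈ dom) : 0 ≤ 1 - x ^ 2 := by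
  nlinarith [hx.1, hx.2]

theorem continuous_weight : Continuous fun x : ℝ => √(1 - x ^ 2) := by fun_prop

theorem sq_l2_weighted (g : ℝ → ℝ) :
    l2 (fun x => √(1 - x ^ 2) * g x) ^ 2 = ∫ x in dom, (1 - x ^ 2) * g x ^ 2 := by
  rw [sq_l2]
  refine setIntegral_congr_fun measurableSet_dom fun x hx => ?_
  simp only [mul_pow, Real.sq_sqrt (one_sub_sq_nonneg hx)]

/-- Bessel's inequality for the derivatives of the Legendre polynomials, which are orthogonal with
respect to the weight `1 - x²`. -/
theorem bessel_weighted {G g : ℝ → ℝ} (hG : IsPrim G g) (hg : L2 g) (N : ℕ) :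
    ∑ j ∈ Finset.range (N + 1), (j : ℝ) * (j + 1) *
      (∫ x in dom, (legendreNormalized j).eval x * G x) ^ 2 ≤
      l2 (fun x => √(1 - x ^ 2) * g x) ^ 2 := by
  set c : ℕ → ℝ := fun j => ∫ x in dom, (legendreNormalized j).eval x * G x with hc
  set T := ∑ j ∈ Finset.range (N + 1), C (c j) * legendreNormalized j with hT
  have h1 : polyInt ((1 - X ^ 2) * derivative T ^ 2) =
    ∑ j ∈ Finset.range (N + 1), (j : ℝ) * (j + 1) * c j ^ 2 := polyInt_weighted_sum N c
  have h2 : ∫ x in dom, ((1 - X ^ 2) * derivative T).eval x * g x =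
      ∑ j ∈ Finset.range (N + 1), (j : ℝ) * (j + 1) * c j ^ 2 := by
    rw [(IsPrim.poly ((1 - X ^ 2) * derivative T)).integral_mul hG]
    have e1 : derivative ((1 - X ^ 2) * derivative T) =
        - ∑ j ∈ Finset.range (N + 1), C ((j : ℝ) * (j + 1) * c j) * legendreNormalized j := by
      rw [← derivative_weighted_sum, ← derivative_neg]
      congr 1; ring
    simp only [e1, eval_neg, eval_finsetSum, eval_mul, eval_C, Finset.sum_mul, neg_mul]
    rw [integral_neg, integral_finsetSum _ fun j _ => by
      simp only [mul_assoc]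
      exact ((((L2.poly _).mul hG.memL2).const_mul _).const_mul _).const_mul _]
    simp only [eval_sub, eval_one, eval_pow, eval_X]
    norm_num
    refine Finset.sum_congr rfl fun j _ => ?_
    have : ∀ x, (j : ℝ) * (j + 1) * c j * (legendreNormalized j).eval x * G x =
        (j : ℝ) * (j + 1) * c j * ((legendreNormalized j).eval x * G x) := fun x => by ring
    simp only [this]
    rw [integral_const_mul]
    change _ * c j = _
    ring
  have hw : L2 fun x => √(1 - x ^ 2) * g x := L2.continuousOn_mul continuous_weight.continuousOn hg
  have hwT : L2 fun x => √(1 - x ^ 2) * (derivative T).eval x :=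
    L2.continuousOn_mul continuous_weight.continuousOn (L2.poly _)
  have h3 := integral_add_mul_sq hw hwT (-1)
  have h4 : ∫ x in dom, (√(1 - x ^ 2) * (derivative T).eval x) ^ 2 =
      polyInt ((1 - X ^ 2) * derivative T ^ 2) := by
    rw [← sq_l2, sq_l2_weighted, polyInt_apply]
    simp
  have h5 : ∫ x in dom, (√(1 - x ^ 2) * g x) * (√(1 - x ^ 2) * (derivative T).eval x) =
      ∫ x in dom, ((1 - X ^ 2) * derivative T).eval x * g x := by
    refine setIntegral_congr_fun measurableSet_dom fun x hx => ?_
    have := Real.mul_self_sqrt (one_sub_sq_nonneg hx)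
    simp only [eval_mul, eval_sub, eval_one, eval_pow, eval_X]
    linear_combination (g x * (derivative T).eval x) * this
  rw [h4, h5, h1, h2, ← sq_l2 fun x => √(1 - x ^ 2) * g x] at h3
  have h6 : 0 ≤ ∫ x in dom,
      (√(1 - x ^ 2) * g x + -1 * (√(1 - x ^ 2) * (derivative T).eval x)) ^ 2 :=
    integral_nonneg fun _ => sq_nonneg _
  linarith

/-- The first order estimate for the Legendre projection, with the weight `1 - x²`: the Legendre
coefficients of index larger than `m` gain the factor `(m + 1)⁻²` against those of the derivative.
Completeness of the Legendre polynomials enters through the Weierstrass theorem. -/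
theorem l2_sub_galerkin_le_weighted {G g : ℝ → ℝ} (hG : IsPrim G g) (hg : L2 g) (m : ℕ) :
    l2 (fun x => G x - (galerkin G m).eval x) ≤
      1 / (m + 1) * l2 (fun x => √(1 - x ^ 2) * g x) := by
  set B := l2 (fun x => √(1 - x ^ 2) * g x)
  set c : ℕ → ℝ := fun j => ∫ x in dom, (legendreNormalized j).eval x * G x with hc
  have key : ∀ N, m ≤ N → l2 (fun x => (galerkin G N).eval x - (galerkin G m).eval x) ≤
      1 / (m + 1) * B := fun N hN => by
    have e1 : galerkin G N - galerkin G m = ∑ j ∈ Finset.range (N + 1),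
        C (if j ≤ m then 0 else c j) * legendreNormalized j := by
      have : galerkin G m = ∑ j ∈ Finset.range (N + 1),
          C (if j ≤ m then c j else 0) * legendreNormalized j := by
        rw [galerkin]
        refine Finset.sum_subset_zero_on_sdiff (Finset.range_mono (by omega)) (fun j hj => ?_)
          fun j hj => ?_
        · have : ¬ j ≤ m := by
            have := (Finset.mem_sdiff.1 hj).2
            rwa [Finset.mem_range_succ_iff] at this
          rw [if_neg this]; simp
        · rw [if_pos (Finset.mem_range_succ_iff.1 hj)]
      rw [this, galerkin, ← Finset.sum_sub_distrib]
      refine Finset.sum_congr rfl fun j _ => ?_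
      split_ifs <;> simp [hc]
    have e2 : l2 (fun x => (galerkin G N).eval x - (galerkin G m).eval x) ^ 2 =
        ∑ j ∈ Finset.range (N + 1), (if j ≤ m then 0 else c j) ^ 2 := by
      have := sq_l2_poly (galerkin G N - galerkin G m)
      simp only [eval_sub] at this
      rw [this, e1, pow_two, polyInt_sum_mul_sum]
      exact Finset.sum_congr rfl fun j _ => by ring
    refine (abs_le_of_sq_le_sq' ?_ (mul_nonneg (by positivity) (l2_nonneg _))).2
    rw [e2, mul_pow]
    refine le_trans ?_ (mul_le_mul_of_nonneg_left (bessel_weighted hG hg N) (by positivity))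
    rw [Finset.mul_sum]
    refine Finset.sum_le_sum fun j _ => ?_
    split_ifs with h
    · rw [zero_pow two_ne_zero]
      exact mul_nonneg (by positivity) (mul_nonneg (by positivity) (sq_nonneg _))
    · have hj : (m : ℝ) + 1 ≤ j := by exact_mod_cast not_le.1 h
      rw [← mul_assoc]
      refine le_mul_of_one_le_left (sq_nonneg _) ?_
      rw [one_div, inv_pow, inv_mul_eq_div, one_le_div (by positivity)]
      nlinarith
  refine le_of_forall_pos_le_add fun ε hε => ?_
  obtain ⟨q, hq⟩ := exists_polynomial_near_of_continuousOn (-1) 1 G hG.continuousOn (ε / 2)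
    (by positivity)
  set N := max m q.natDegree
  have h1 : l2 (fun x => G x - (galerkin G N).eval x) ≤ ε :=
    (l2_sub_galerkin_le hG.memL2 (le_max_right m q.natDegree)).trans
      ((l2_le_of_bound (c := ε / 2) (by positivity)
        fun x hx => by rw [abs_sub_comm]; exact (hq x hx).le).trans (by linarith))
  have h2 := l2_add_le (u := fun x => G x - (galerkin G N).eval x)
    (v := fun x => (galerkin G N).eval x - (galerkin G m).eval x)
    (hG.memL2.sub (L2.poly _)) ((L2.poly _).sub (L2.poly _))
  simp only [sub_add_sub_cancel] at h2
  linarith [key N (le_max_left _ _)]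

theorem exists_antiderivative {p : ℝ[X]} {m : ℕ} (hp : p.natDegree ≤ m) :
    ∃ Q : ℝ[X], Q.natDegree ≤ m + 1 ∧ derivative Q = p ∧ Q.eval (-1) = 0 := by
  let R : ℝ[X] := ∑ i ∈ Finset.range (m + 1), C (p.coeff i / (i + 1)) * X ^ (i + 1)
  have hR : derivative R = p := by
    conv_rhs => rw [p.as_sum_range' (m + 1) (by omega)]
    simp only [R, derivative_sum]
    refine Finset.sum_congr rfl fun i _ => ?_
    rw [derivative_C_mul_X_pow, ← C_mul_X_pow_eq_monomial]
    congr 2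
    push_cast
    have : (i : ℝ) + 1 ≠ 0 := by positivity
    field_simp
  have hd : R.natDegree ≤ m + 1 := natDegree_sum_le_of_forall_le _ _ fun i hi =>
    (natDegree_C_mul_X_pow_le _ _).trans (by have := Finset.mem_range.1 hi; omega)
  refine ⟨R - C (R.eval (-1)), ?_, ?_, ?_⟩
  · exact (natDegree_sub_le _ _).trans (max_le hd (by simp))
  · rw [derivative_sub, derivative_C, sub_zero, hR]
  · simp

theorem l2_weighted_le {g : ℝ → ℝ} (hg : L2 g) : l2 (fun x => √(1 - x ^ 2) * g x) ≤ l2 g := by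
  refine l2_mono hg fun x _ => ?_
  rw [abs_mul, abs_of_nonneg (Real.sqrt_nonneg _)]
  refine mul_le_of_le_one_left (abs_nonneg _) ?_
  exact Real.sqrt_le_one.2 (by nlinarith [sq_nonneg x])

theorem IsChain.tail {s : ℕ} {F : ℕ → ℝ → ℝ} (h : IsChain (s + 1) F) :
    IsChain s (fun j => F (j + 1)) :=
  ⟨fun j hj => h.isPrim (j + 1) (by omega), fun j hj => h.memL2 (j + 1) (by omega)⟩

/-- The Legendre projection of an element of `H^s` converges in `L²` at the rate `n^{-s}`. By
induction on `s`: subtracting a primitive of the projection of `F 1` does not change the error,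
and the first order estimate applies to what remains. -/
theorem exists_l2_sub_galerkin_le (s : ℕ) : ∃ K : ℝ, 0 < K ∧ ∀ F : ℕ → ℝ → ℝ, IsChain s F →
    ∀ H : ℝ, (∀ j ≤ s, l2 (F j) ≤ H) → ∀ m : ℕ,
    l2 (fun x => F 0 x - (galerkin (F 0) m).eval x) ≤ K * H / ((m : ℝ) + 1) ^ s := by
  have triv : ∀ (u : ℝ → ℝ) (m : ℕ), L2 u → l2 (fun x => u x - (galerkin u m).eval x) ≤ l2 u :=
    fun u m hu => by simpa using l2_sub_galerkin_le hu (n := m) (q := 0) (by simp)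
  induction s with
  | zero =>
    refine ⟨1, one_pos, fun F hF H hH m => ?_⟩
    simpa using (triv _ m (hF.memL2 0 le_rfl)).trans (hH 0 le_rfl)
  | succ s ih =>
    obtain ⟨K, hK, ih⟩ := ih
    refine ⟨max 1 (K * 2 ^ s), by positivity, fun F hF H hH m => ?_⟩
    have hH0 : 0 ≤ H := (l2_nonneg _).trans (hH 0 (Nat.zero_le _))
    rcases m with _ | m
    · have := (triv _ 0 (hF.memL2 0 (Nat.zero_le _))).trans (hH 0 (Nat.zero_le _))
      simp only [Nat.cast_zero, zero_add, one_pow, div_one]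
      exact this.trans (le_mul_of_one_le_left hH0 (le_max_left _ _))
    · have h1 := ih _ hF.tail H (fun j hj => hH (j + 1) (by omega)) m
      simp only [zero_add] at h1
      obtain ⟨Q, hQd, hQ, -⟩ := exists_antiderivative (galerkin_natDegree_le (F 1) m)
      have hP : IsPrim (fun x => F 0 x - Q.eval x)
          (fun x => F 1 x - (galerkin (F 1) m).eval x) := by
        have := (hF.isPrim 0 (by omega)).sub (IsPrim.poly Q)
        rwa [hQ] at this
      have hL : L2 (fun x => F 1 x - (galerkin (F 1) m).eval x) :=
        (hF.memL2 1 (by omega)).sub (L2.poly _)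
      have h2 := l2_sub_galerkin_le_weighted hP hL (m + 1)
      have h3 := l2_sub_galerkin_le (hF.memL2 0 (Nat.zero_le _)) (n := m + 1)
        (q := Q + galerkin (fun x => F 0 x - Q.eval x) (m + 1))
        ((natDegree_add_le _ _).trans (max_le hQd (galerkin_natDegree_le _ _)))
      simp only [eval_add, ← sub_sub] at h3
      refine h3.trans (h2.trans ?_)
      have h4 := (l2_weighted_le hL).trans h1
      have h5 : (1 : ℝ) / ((m + 1 : ℕ) + 1) * l2 (fun x => √(1 - x ^ 2) *
          (F 1 x - (galerkin (F 1) m).eval x)) ≤ 1 / ((m + 1 : ℕ) + 1) *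
          (K * H / ((m : ℝ) + 1) ^ s) := by gcongr
      refine h5.trans ?_
      push_cast
      have h6 : ((m : ℝ) + 1 + 1) ^ s ≤ 2 ^ s * (m + 1) ^ s := by
        rw [← mul_pow]
        gcongr
        linarith [(Nat.cast_nonneg m : (0 : ℝ) ≤ m)]
      rw [div_mul_div_comm, one_mul, div_le_div_iff₀ (by positivity) (by positivity)]
      calc K * H * ((m : ℝ) + 1 + 1) ^ (s + 1)
          = K * H * (m + 1 + 1) * (m + 1 + 1) ^ s := by ring
        _ ≤ K * H * (m + 1 + 1) * (2 ^ s * (m + 1) ^ s) := by gcongr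
        _ = (K * 2 ^ s) * H * ((m + 1 + 1) * (m + 1) ^ s) := by ring
        _ ≤ max 1 (K * 2 ^ s) * H * ((m + 1 + 1) * (m + 1) ^ s) := by
          gcongr
          exact le_max_right _ _

/-! ### Integrated Legendre projections -/

theorem IsPrim.abs_le_of_bound {v w : ℝ → ℝ} (h : IsPrim v w) {B : ℝ} (hB : ∀ x ∈ dom, |w x| ≤ B)
    {x y : ℝ} (hx : x ∈ dom) (hy : y ∈ dom) : |v y - v x| ≤ B * |y - x| := by
  rw [h.sub_mem hx hy, ← Real.norm_eq_abs]
  exact intervalIntegral.norm_integral_le_of_norm_le_const fun t ht =>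
    hB t (Set.uIcc_subset_Icc hx hy (Set.uIoc_subset_uIcc ht))

theorem abs_div_one_sub_sq_le {v w : ℝ → ℝ} (h : IsPrim v w) {B : ℝ} (hB : ∀ x ∈ dom, |w x| ≤ B)
    (h1 : v 1 = 0) (h2 : v (-1) = 0) {x : ℝ} (hx : x ∈ dom) : |v x / (1 - x ^ 2)| ≤ B := by
  have hB0 : 0 ≤ B := (abs_nonneg _).trans (hB 1 one_mem_dom)
  have e1 := h.abs_le_of_bound hB one_mem_dom hx
  have e2 := h.abs_le_of_bound hB neg_one_mem_dom hx
  rw [h1, sub_zero, abs_of_nonpos (show x - 1 ≤ 0 by linarith [hx.2])] at e1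
  rw [h2, sub_zero, abs_of_nonneg (show 0 ≤ x - -1 by linarith [hx.1])] at e2
  rw [abs_div, abs_of_nonneg (one_sub_sq_nonneg hx)]
  refine div_le_of_le_mul₀ (one_sub_sq_nonneg hx) hB0 ?_
  rcases le_total 0 x with h0 | h0
  · nlinarith [mul_nonneg hB0 (mul_nonneg h0 (sub_nonneg.2 hx.2))]
  · nlinarith [mul_nonneg hB0 (mul_nonneg (neg_nonneg.2 h0) (neg_le_iff_add_nonneg.1 hx.1))]

theorem L2.div_one_sub_sq {v w : ℝ → ℝ} (h : IsPrim v w) {B : ℝ} (hB : ∀ x ∈ dom, |w x| ≤ B)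
    (h1 : v 1 = 0) (h2 : v (-1) = 0) : L2 (fun x => v x / (1 - x ^ 2)) := by
  have hm : AEMeasurable (fun x : ℝ => 1 - x ^ 2) (volume.restrict dom) := by fun_prop
  exact MemLp.of_bound ((h.continuousOn.aemeasurable measurableSet_dom).div hm).aestronglyMeasurable
    B ((ae_restrict_iff' measurableSet_dom).2 (ae_of_all _ fun x hx =>
      abs_div_one_sub_sq_le h hB h1 h2 hx))

/-- If the derivative `w` of `v` is orthogonal to the polynomials of degree at most `m`, and `v`
vanishes at `±1`, then a power of `m` is gained in passing from `w` to `v`, even in the norm with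
weight `1 / (1 - x²)`. The proof is by duality. -/
theorem l2_div_weight_le {v w : ℝ → ℝ} (h : IsPrim v w) {B : ℝ} (hB : ∀ x ∈ dom, |w x| ≤ B)
    (hw : L2 w) (h1 : v 1 = 0) (h2 : v (-1) = 0) {m : ℕ}
    (horth : ∀ q : ℝ[X], q.natDegree ≤ m → ∫ x in dom, q.eval x * w x = 0) :
    l2 (fun x => √(1 - x ^ 2) * (v x / (1 - x ^ 2))) ≤ 1 / (m + 1) * l2 w := by
  set g : ℝ → ℝ := fun x => v x / (1 - x ^ 2) with hg
  set A := l2 (fun x => √(1 - x ^ 2) * g x) with hA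
  have hgL : L2 g := .div_one_sub_sq h hB h1 h2
  set G : ℝ → ℝ := fun x => 0 + ∫ t in (-1 : ℝ)..x, g t
  have hG : IsPrim G g := isPrim_primitive hgL.integrableOn 0
  have e1 : A ^ 2 = ∫ x in dom, v x * g x := by
    rw [hA, sq_l2_weighted]
    refine integral_congr_ae (ae_mem_Ioo_of_dom.mono fun x hx => ?_)
    have : 1 - x ^ 2 ≠ 0 := by nlinarith [hx.1, hx.2]
    simp only [hg]
    field_simp
  have e2 := horth _ (galerkin_natDegree_le G m)
  have e3 : A ^ 2 = - ∫ x in dom, w x * (G x - (galerkin G m).eval x) := by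
    rw [e1, h.integral_mul hG, h1, h2]
    simp only [mul_sub]
    rw [integral_sub (hw.mul hG.memL2) (hw.mul (L2.poly _))]
    simp only [mul_comm] at e2 ⊢
    rw [e2]
    ring
  have e4 := integral_mul_le_l2 hw (hG.memL2.sub (L2.poly (galerkin G m)))
  have e5 := l2_sub_galerkin_le_weighted hG hgL m
  have e6 : A ^ 2 ≤ l2 w * (1 / (m + 1) * A) := by
    rw [e3]
    refine (neg_le_abs _).trans (e4.trans ?_)
    exact mul_le_mul_of_nonneg_left e5 (l2_nonneg _)
  have hA0 : 0 ≤ A := l2_nonneg _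
  rcases hA0.eq_or_lt with h0 | h0
  · rw [← h0]; exact mul_nonneg (by positivity) (l2_nonneg _)
  · have : A * A ≤ A * (1 / (m + 1) * l2 w) := by rw [← pow_two]; linarith
    exact le_of_mul_le_mul_left this h0

/-- The polynomial `q` that agrees with `u` at `±1` and whose derivative is the Legendre projection
of `u'`. -/
theorem exists_integrated_projection {u u' : ℝ → ℝ} (h : IsPrim u u') (hu' : L2 u') (m : ℕ) :
    ∃ q : ℝ[X], q.natDegree ≤ m + 1 ∧ derivative q = galerkin u' m ∧
      u 1 - q.eval 1 = 0 ∧ u (-1) - q.eval (-1) = 0 := by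
  obtain ⟨Q, hQd, hQ, hQ1⟩ := exists_antiderivative (galerkin_natDegree_le u' m)
  have hder : derivative (C (u (-1)) + Q) = galerkin u' m := by simp [hQ]
  refine ⟨C (u (-1)) + Q, (natDegree_add_le _ _).trans (max_le (by simp) hQd), hder, ?_, ?_⟩
  · have hp := h.sub (IsPrim.poly (C (u (-1)) + Q))
    rw [hder] at hp
    have e1 := hp.eq 1 one_mem_dom
    have e2 := galerkin_mul_integral hu' (n := m) (q := 1) (by simp)
    simp only [eval_one, one_mul] at e2
    rw [← integral_dom, e2] at e1
    simpa [hQ1] using e1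
  · simp [hQ1]

/-- The properties of `v = u - q`, where `q` is the integrated Legendre projection, of
derivative `w`. -/
structure IsResidual (m : ℕ) (v w : ℝ → ℝ) : Prop where
  isPrim : IsPrim v w
  memL2 : L2 w
  one : v 1 = 0
  neg_one : v (-1) = 0
  orth : ∀ q : ℝ[X], q.natDegree ≤ m → ∫ x in dom, q.eval x * w x = 0
  weighted_le : l2 (fun x => √(1 - x ^ 2) * (v x / (1 - x ^ 2))) ≤ 1 / (m + 1) * l2 w
  le : l2 v ≤ 1 / (m + 1) * l2 w

theorem exists_isResidual {s : ℕ} {F : ℕ → ℝ → ℝ} (hF : IsChain (s + 2) F) (m : ℕ) :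
    ∃ q : ℝ[X], q.natDegree ≤ m + 1 ∧ derivative q = galerkin (F 1) m ∧
      IsResidual m (fun x => F 0 x - q.eval x) (fun x => F 1 x - (galerkin (F 1) m).eval x) := by
  have hL := hF.memL2 1 (by omega)
  obtain ⟨q, hqd, hq, h1, h2⟩ := exists_integrated_projection (hF.isPrim 0 (by omega)) hL m
  have hp := (hF.isPrim 0 (by omega)).sub (IsPrim.poly q)
  rw [hq] at hp
  have horth := fun (p : ℝ[X]) (hp : p.natDegree ≤ m) => galerkin_mul_integral hL hp
  have hcont : ContinuousOn (fun x => F 1 x - (galerkin (F 1) m).eval x) dom :=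
    (hF.isPrim 1 (by omega)).continuousOn.sub (galerkin (F 1) m).continuous.continuousOn
  obtain ⟨B, hB⟩ := isCompact_Icc.exists_bound_of_continuousOn hcont
  have hwt := l2_div_weight_le hp (B := B) hB (hL.sub (L2.poly _)) h1 h2 horth
  refine ⟨q, hqd, hq, hp, hL.sub (L2.poly _), h1, h2, horth, hwt, le_trans ?_ hwt⟩
  refine (abs_le_of_sq_le_sq' ?_ (l2_nonneg _)).2
  rw [sq_l2, sq_l2]
  have hgL : L2 (fun x => (F 0 x - q.eval x) / (1 - x ^ 2)) := .div_one_sub_sq hp (B := B) hB h1 h2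
  refine integral_mono_ae hp.memL2.sq
    (L2.continuousOn_mul continuous_weight.continuousOn hgL).sq ?_
  filter_upwards [ae_mem_Ioo_of_dom] with x hx
  have hpos : 0 < 1 - x ^ 2 := by nlinarith [hx.1, hx.2]
  rw [mul_pow, Real.sq_sqrt hpos.le, div_pow, pow_two (1 - x ^ 2), ← mul_div_assoc,
    mul_div_mul_left _ _ hpos.ne', le_div_iff₀ hpos]
  nlinarith [mul_nonneg (sq_nonneg (F 0 x - q.eval x)) (sq_nonneg x)]

theorem l2_legendreNormalized (n : ℕ) : l2 (fun x => (legendreNormalized n).eval x) = 1 := by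
  have := sq_l2_poly (legendreNormalized n)
  rw [polyInt_legendreNormalized_sq] at this
  exact (pow_eq_one_iff_of_nonneg (l2_nonneg _) two_ne_zero).1 this

theorem l2_derivative_legendreNormalized_le {j n : ℕ} (hn : 1 ≤ n) (hj : j ≤ n) :
    l2 (fun x => (derivative (legendreNormalized j)).eval x) ≤ 2 * (√n * n) := by
  refine (abs_le_of_sq_le_sq' ?_ (by positivity)).2
  rw [sq_l2_poly, legendreNormalized, derivative_C_mul, mul_pow, ← C_pow, polyInt_C_mul,
    polyInt_derivative_legendre_sq, Real.sq_sqrt (by positivity), mul_pow, mul_pow,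
    Real.sq_sqrt (by positivity)]
  have h1 : (1 : ℝ) ≤ n := by exact_mod_cast hn
  have h2 : (j : ℝ) ≤ n := by exact_mod_cast hj
  have h3 : (0 : ℝ) ≤ j := by positivity
  calc (2 * (j : ℝ) + 1) / 2 * (j * (j + 1)) ≤ (2 * n + n) / 2 * (n * (n + n)) := by gcongr
    _ ≤ 2 ^ 2 * (n * n ^ 2) := by nlinarith [pow_pos (lt_of_lt_of_le one_pos h1) 3]

theorem galerkin_sub_poly {u : ℝ → ℝ} (hu : L2 u) {q : ℝ[X]} {n : ℕ} (hq : q.natDegree ≤ n) :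
    galerkin (fun x => u x - q.eval x) n = galerkin u n - q := by
  conv_rhs => rw [← sum_polyInt_legendreNormalized_mul hq]
  rw [galerkin, galerkin, ← Finset.sum_sub_distrib]
  refine Finset.sum_congr rfl fun j _ => ?_
  rw [← sub_mul, ← C_sub]
  congr 2
  rw [polyInt_apply]
  simp only [mul_sub, eval_mul]
  exact integral_sub ((L2.poly _).mul hu) ((L2.poly _).mul (L2.poly _))

/-- A residual is orthogonal to the polynomials of degree less than `m`, so that only the two top
coefficients of its projection of degree `m + 1` survive. -/
theorem IsResidual.integral_legendreNormalized_eq_zero {m : ℕ} {v w : ℝ → ℝ}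
    (h : IsResidual m v w) {j : ℕ} (hj : j + 1 ≤ m) :
    ∫ x in dom, (legendreNormalized j).eval x * v x = 0 := by
  obtain ⟨Q, hQd, hQ, -⟩ := exists_antiderivative (legendreNormalized_natDegree_le j)
  have h1 := (IsPrim.poly Q).integral_mul h.isPrim
  rw [hQ, h.one, h.neg_one, h.orth Q (hQd.trans hj)] at h1
  linarith

/-- The error of the Legendre projection in `H¹`. The factor `√n` is the loss in the norm of the
derivatives of the two Legendre polynomials that survive in the projection of the residual. -/
theorem exists_galerkin_error (s : ℕ) : ∃ K : ℝ, 0 < K ∧ ∀ F : ℕ → ℝ → ℝ, IsChain (s + 2) F →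
    ∀ H : ℝ, (∀ j ≤ s + 2, l2 (F j) ≤ H) → ∀ n : ℕ, 1 ≤ n →
    l2 (fun x => F 0 x - (galerkin (F 0) n).eval x) ≤ K * H * (√n / (n : ℝ) ^ (s + 1)) ∧
    l2 (fun x => F 1 x - (derivative (galerkin (F 0) n)).eval x) ≤
      K * H * (√n / (n : ℝ) ^ (s + 1)) := by
  obtain ⟨K, hK, hbound⟩ := exists_l2_sub_galerkin_le (s + 1)
  refine ⟨5 * K, by positivity, fun F hF H hH n hn => ?_⟩
  obtain ⟨m, rfl⟩ : ∃ m, n = m + 1 := ⟨n - 1, by omega⟩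
  have hH0 : 0 ≤ H := (l2_nonneg _).trans (hH 0 (Nat.zero_le _))
  obtain ⟨q, hqd, hq, hres⟩ := exists_isResidual hF m
  set v := fun x => F 0 x - q.eval x with hv
  set w := fun x => F 1 x - (galerkin (F 1) m).eval x with hw
  have hwle : l2 w ≤ K * H / ((m : ℝ) + 1) ^ (s + 1) :=
    hbound _ hF.tail H (fun j hj => hH (j + 1) (by omega)) m
  have hL0 := hF.memL2 0 (Nat.zero_le _)
  set P := galerkin v (m + 1) with hP
  have hPeq : galerkin (F 0) (m + 1) = P + q := by
    rw [hP, hv, galerkin_sub_poly hL0 hqd]; ring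
  set a := ∫ x in dom, (legendreNormalized m).eval x * v x with ha
  set b := ∫ x in dom, (legendreNormalized (m + 1)).eval x * v x with hb
  have hP2 : P = C a * legendreNormalized m + C b * legendreNormalized (m + 1) := by
    rw [hP, galerkin, Finset.sum_range_succ, Finset.sum_range_succ, Finset.sum_eq_zero, zero_add]
    intro j hj
    rw [hres.integral_legendreNormalized_eq_zero (by have := Finset.mem_range.1 hj; omega)]
    simp
  have hcoef : ∀ j, |∫ x in dom, (legendreNormalized j).eval x * v x| ≤ l2 v := fun j => by
    simpa [l2_legendreNormalized] using integral_mul_le_l2 (L2.poly (legendreNormalized j))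
      hres.isPrim.memL2
  have hn1 : (1 : ℝ) ≤ ((m + 1 : ℕ) : ℝ) := by exact_mod_cast hn
  have hcast : ((m + 1 : ℕ) : ℝ) = m + 1 := by push_cast; ring
  have hsq : 1 ≤ √((m + 1 : ℕ) : ℝ) := Real.one_le_sqrt.2 hn1
  have hvle : l2 v * ((m + 1 : ℕ) : ℝ) ≤ l2 w := by
    have := hres.le
    rw [one_div, inv_mul_eq_div, le_div_iff₀ (by positivity)] at this
    rwa [hcast]
  have hv0 := l2_nonneg v
  have hw0 := l2_nonneg w
  have hfin : 5 * l2 w * √((m + 1 : ℕ) : ℝ) ≤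
      5 * K * H * (√((m + 1 : ℕ) : ℝ) / ((m + 1 : ℕ) : ℝ) ^ (s + 1)) := by
    rw [hcast]
    calc 5 * l2 w * √((m : ℝ) + 1) ≤ 5 * (K * H / ((m : ℝ) + 1) ^ (s + 1)) * √((m : ℝ) + 1) := by
          gcongr
      _ = _ := by ring
  constructor
  · refine le_trans ?_ hfin
    refine (l2_sub_galerkin_le hL0 hqd).trans ?_
    change l2 v ≤ _
    nlinarith
  · refine le_trans ?_ hfin
    have e : (fun x => F 1 x - (derivative (galerkin (F 0) (m + 1))).eval x) =
        fun x => w x - (a * (derivative (legendreNormalized m)).eval x +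
          b * (derivative (legendreNormalized (m + 1))).eval x) := by
      funext x
      rw [hPeq, derivative_add, hq, hP2]
      simp only [derivative_add, derivative_mul, derivative_C, eval_add, eval_mul, eval_C, hw,
        zero_mul, zero_add]
      ring
    rw [e]
    have t1 := l2_sub_le (u := w) hres.memL2
      (((L2.poly (derivative (legendreNormalized m))).const_mul a).add
        ((L2.poly (derivative (legendreNormalized (m + 1)))).const_mul b))
    have t2 := l2_add_le ((L2.poly (derivative (legendreNormalized m))).const_mul a)
        ((L2.poly (derivative (legendreNormalized (m + 1)))).const_mul b)
    rw [l2_const_mul, l2_const_mul] at t2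
    have d1 := l2_derivative_legendreNormalized_le hn (Nat.le_succ m)
    have d2 := l2_derivative_legendreNormalized_le hn le_rfl
    have t3 := mul_le_mul (hcoef m) d1 (l2_nonneg _) hv0
    have t4 := mul_le_mul (hcoef (m + 1)) d2 (l2_nonneg _) hv0
    have t5 : l2 v * (2 * (√((m + 1 : ℕ) : ℝ) * ((m + 1 : ℕ) : ℝ))) ≤
        2 * (l2 w * √((m + 1 : ℕ) : ℝ)) := by
      have := mul_le_mul_of_nonneg_right hvle (Real.sqrt_nonneg ((m + 1 : ℕ) : ℝ))
      linarith
    refine t1.trans ?_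
    have t6 : l2 w ≤ l2 w * √((m + 1 : ℕ) : ℝ) := le_mul_of_one_le_right hw0 hsq
    refine (add_le_add t6 (t2.trans (add_le_add (t3.trans t5) (t4.trans t5)))).trans ?_
    linarith

/-! ### The zeros of the Legendre polynomials -/

/-- By Rolle's theorem, each derivative loses at most one root. -/
theorem card_roots_legendre (n : ℕ) : n ≤ (legendre n).roots.card := by
  have hX : (X ^ 2 - 1 : ℝ[X]) = (X - C 1) * (X - C (-1)) := by
    simp only [map_neg, map_one]; ring
  have h0 : ((X ^ 2 - 1 : ℝ[X]) ^ n).roots.card = 2 * n := by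
    rw [roots_pow, hX, roots_mul (mul_ne_zero (X_sub_C_ne_zero _) (X_sub_C_ne_zero _)),
      roots_X_sub_C, roots_X_sub_C]
    simp [mul_comm]
  have h1 : ∀ k, 2 * n ≤ (derivative^[k] ((X ^ 2 - 1 : ℝ[X]) ^ n)).roots.card + k := by
    intro k
    induction k with
    | zero => exact h0.ge
    | succ k ih =>
      rw [Function.iterate_succ_apply']
      have := card_roots_le_derivative (derivative^[k] ((X ^ 2 - 1 : ℝ[X]) ^ n))
      omega
  have h2 := h1 n
  rw [legendre, roots_C_mul _ (by positivity)]
  omega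

theorem legendre_derivative_ne_zero {n : ℕ} (hn : 1 ≤ n) : derivative (legendre n) ≠ 0 := by
  intro h
  have := derivative_eq_zero.1 h
  rw [legendre_natDegree] at this
  omega

theorem hasDerivAt_mul_ode (n : ℕ) (x : ℝ) :
    HasDerivAt (fun x => (x ^ 2 - 1) * (derivative (legendre n)).eval x * (legendre n).eval x)
      (n * (n + 1) * (legendre n).eval x ^ 2 +
        (x ^ 2 - 1) * (derivative (legendre n)).eval x ^ 2) x := by
  have h := ((X ^ 2 - 1) * derivative (legendre n) * legendre n).hasDerivAt x
  rw [derivative_mul, legendre_ode] at h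
  simp only [eval_add, eval_mul, eval_sub, eval_pow, eval_X, eval_one, eval_C] at h
  exact h.congr_deriv (by ring)

/-- On `[1, ∞)` the function `(x² - 1) Pₙ' Pₙ` is monotone and vanishes at `1`. -/
theorem legendre_eval_ne_zero_of_one_le (n : ℕ) {x : ℝ} (hx : 1 ≤ x) :
    (legendre n).eval x ≠ 0 := by
  intro h0
  rcases hx.eq_or_lt with rfl | hlt
  · rw [legendre_eval_one] at h0; exact one_ne_zero h0
  rcases Nat.eq_zero_or_pos n with rfl | hn
  · simp [legendre] at h0
  set h : ℝ → ℝ := fun x => (x ^ 2 - 1) * (derivative (legendre n)).eval x * (legendre n).eval x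
    with hh
  have hmono : MonotoneOn h (Set.Icc 1 x) := monotoneOn_of_deriv_nonneg (convex_Icc 1 x)
    (fun y _ => (hasDerivAt_mul_ode n y).continuousAt.continuousWithinAt)
    (fun y _ => (hasDerivAt_mul_ode n y).differentiableAt.differentiableWithinAt) fun y hy => by
      rw [interior_Icc] at hy
      rw [(hasDerivAt_mul_ode n y).deriv]
      have : 0 ≤ y ^ 2 - 1 := by nlinarith [hy.1]
      positivity
  have hzero : ∀ y ∈ Set.Icc 1 x, h y = 0 := fun y hy => by
    have e1 := hmono (Set.left_mem_Icc.2 hx) hy hy.1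
    have e2 := hmono hy (Set.right_mem_Icc.2 hx) hy.2
    simp only [hh, h0, mul_zero, one_pow, sub_self, zero_mul] at e1 e2 ⊢
    exact le_antisymm e2 e1
  have hp : (X ^ 2 - 1) * derivative (legendre n) * legendre n = 0 := by
    refine eq_zero_of_infinite_isRoot _ ((Set.Icc_infinite hlt).mono fun y hy => ?_)
    have := hzero y hy
    simpa [hh, IsRoot.def] using this
  have hX : (X ^ 2 - 1 : ℝ[X]) ≠ 0 := by
    have : (X ^ 2 - 1 : ℝ[X]) = X ^ 2 - C 1 := by simp
    rw [this]; exact X_pow_sub_C_ne_zero (by norm_num) 1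
  exact mul_ne_zero (mul_ne_zero hX (legendre_derivative_ne_zero hn)) (legendre_ne_zero n) hp

theorem legendre_root_mem {n : ℕ} {a : ℝ} (ha : (legendre n).eval a = 0) :
    a ∈ Set.Ioo (-1 : ℝ) 1 := by
  refine ⟨?_, ?_⟩ <;> by_contra hcon
  · refine legendre_eval_ne_zero_of_one_le n (x := -a) (by linarith) ?_
    rw [legendre_eval_neg, ha, mul_zero]
  · exact legendre_eval_ne_zero_of_one_le n (not_lt.1 hcon) ha

/-- The energy `(1 - x²) P'² + n (n + 1) P²`. -/
noncomputable def energy (n : ℕ) : ℝ[X] :=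
  (1 - X ^ 2) * derivative (legendre n) ^ 2 + C ((n : ℝ) * (n + 1)) * legendre n ^ 2

theorem energy_eval (n : ℕ) (x : ℝ) : (energy n).eval x =
    (1 - x ^ 2) * (derivative (legendre n)).eval x ^ 2 + n * (n + 1) * (legendre n).eval x ^ 2 := by
  simp [energy]

theorem energy_eval_neg (n : ℕ) (x : ℝ) : (energy n).eval (-x) = (energy n).eval x := by
  rw [energy_eval, energy_eval, legendre_eval_neg, legendre_derivative_eval_neg]
  have := neg_one_pow_mul_self n
  linear_combination ((1 - x ^ 2) * (derivative (legendre n)).eval x ^ 2 +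
    n * (n + 1) * (legendre n).eval x ^ 2) * this

theorem derivative_energy (n : ℕ) :
    derivative (energy n) = 2 * X * derivative (legendre n) ^ 2 := by
  have h := legendre_ode n
  simp only [derivative_mul, derivative_sub, derivative_X_pow, derivative_one, Nat.cast_ofNat,
    Nat.reduceSub, pow_one, C_ofNat, sub_zero] at h
  rw [energy, derivative_add, derivative_C_mul]
  simp only [derivative_mul, derivative_sub, derivative_one, Nat.cast_ofNat, derivative_X,
    Nat.reduceSub, pow_one, C_ofNat, derivative_pow, zero_sub]
  linear_combination (-2 * derivative (legendre n)) * h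

theorem monotoneOn_of_derivative_nonneg {p : ℝ[X]} {a b : ℝ}
    (h : ∀ x ∈ Set.Ioo a b, 0 ≤ (derivative p).eval x) :
    MonotoneOn (fun x => p.eval x) (Set.Icc a b) :=
  monotoneOn_of_deriv_nonneg (convex_Icc a b) p.continuous.continuousOn
    p.differentiable.differentiableOn fun x hx => by
      rw [interior_Icc] at hx
      rw [Polynomial.deriv]
      exact h x hx

theorem energy_le {n : ℕ} {x : ℝ} (hx : x ∈ dom) : (energy n).eval x ≤ n * (n + 1) := by
  wlog h0 : 0 ≤ x generalizing x
  · rw [← energy_eval_neg]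
    exact this ⟨by linarith [hx.2], by linarith [hx.1]⟩ (by linarith)
  have hm := monotoneOn_of_derivative_nonneg (p := energy n) (a := 0) (b := 1) fun y hy => by
    rw [derivative_energy]
    simp only [eval_mul, eval_ofNat, eval_X, eval_pow]
    have := hy.1.le
    positivity
  have := hm ⟨h0, hx.2⟩ ⟨zero_le_one, le_rfl⟩ hx.2
  simp only at this
  rw [energy_eval n 1, legendre_eval_one] at this
  linarith

/-- The product of `1 - x²` and the energy decreases away from the origin, as opposed to the energy
itself. -/
theorem weighted_energy_le {n : ℕ} {x : ℝ} (hx : x ∈ dom) :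
    (1 - x ^ 2) * (energy n).eval x ≤ (energy n).eval 0 := by
  wlog h0 : 0 ≤ x generalizing x
  · have := this (x := -x) ⟨by linarith [hx.2], by linarith [hx.1]⟩ (by linarith)
    rwa [energy_eval_neg, neg_sq] at this
  have hm := monotoneOn_of_derivative_nonneg (p := (X ^ 2 - 1) * energy n) (a := 0) (b := 1)
    fun y hy => by
      rw [derivative_mul, derivative_energy]
      simp only [derivative_sub, derivative_X_pow, derivative_one, eval_add, eval_mul, eval_sub,
        eval_pow, eval_X, eval_one, eval_ofNat, energy_eval, Nat.cast_ofNat, Nat.reduceSub,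
        pow_one, C_ofNat, sub_zero]
      have := hy.1.le
      have e : 2 * y * ((1 - y ^ 2) * (derivative (legendre n)).eval y ^ 2 +
          n * (n + 1) * (legendre n).eval y ^ 2) +
          (y ^ 2 - 1) * (2 * y * (derivative (legendre n)).eval y ^ 2) =
          2 * y * (n * (n + 1) * (legendre n).eval y ^ 2) := by ring
      rw [e]
      positivity
  have := hm ⟨le_rfl, zero_le_one⟩ ⟨h0, hx.2⟩ h0
  simp only [eval_mul, eval_sub, eval_pow, eval_X, eval_one] at this
  linarith

theorem polyInt_mono {p q : ℝ[X]} (h : ∀ x ∈ dom, p.eval x ≤ q.eval x) : polyInt p ≤ polyInt q :=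
  setIntegral_mono_on (L2.poly p).integrableOn (L2.poly q).integrableOn measurableSet_dom h

theorem polyInt_C (c : ℝ) : polyInt (C c) = 2 * c := by
  rw [polyInt_apply]
  simp [volume_dom]

/-- The energy is at least `n / 3` at the origin, because its weighted mean is controlled by
`∫ Pₙ²`. -/
theorem energy_zero_ge (n : ℕ) : (n : ℝ) / 3 ≤ (energy n).eval 0 := by
  set W := (1 - X ^ 2) * energy n with hW
  have h1 : polyInt W ≤ 2 * (energy n).eval 0 := by
    rw [← polyInt_C]
    exact polyInt_mono fun x hx => by simpa [hW] using weighted_energy_le hx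
  have hd : derivative W = - (C (2 * ((n : ℝ) * (n + 1))) * (X * legendre n ^ 2)) := by
    rw [hW, derivative_mul, derivative_energy, energy, C_mul (a := 2), C_ofNat]
    simp only [derivative_sub, derivative_X_pow, derivative_one, Nat.cast_ofNat, Nat.reduceSub,
      pow_one, C_ofNat, zero_sub]
    ring
  have h2 : polyInt W = 2 * ((n : ℝ) * (n + 1)) * polyInt (X ^ 2 * legendre n ^ 2) := by
    have e := polyInt_derivative (X * W)
    have e2 : derivative (X * W) =
        W - C (2 * ((n : ℝ) * (n + 1))) * (X ^ 2 * legendre n ^ 2) := by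
      rw [derivative_mul, derivative_X, hd]; ring
    rw [e2, map_sub, polyInt_C_mul] at e
    simp [hW] at e
    linarith
  have h3 : n * (n + 1) * (polyInt (legendre n ^ 2) - polyInt (X ^ 2 * legendre n ^ 2)) ≤
      polyInt W := by
    rw [← map_sub, ← polyInt_C_mul]
    refine polyInt_mono fun x hx => ?_
    simp only [hW, eval_mul, eval_C, eval_sub, eval_pow, eval_X, eval_one, energy_eval]
    have := one_sub_sq_nonneg hx
    have e : (1 - x ^ 2) * ((1 - x ^ 2) * (derivative (legendre n)).eval x ^ 2 +
        n * (n + 1) * (legendre n).eval x ^ 2) - n * (n + 1) * ((legendre n).eval x ^ 2 -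
        x ^ 2 * (legendre n).eval x ^ 2) = (1 - x ^ 2) ^ 2 *
        (derivative (legendre n)).eval x ^ 2 := by ring
    have : 0 ≤ (1 - x ^ 2) ^ 2 * (derivative (legendre n)).eval x ^ 2 := by positivity
    linarith
  rw [polyInt_legendre_sq] at h3
  have h4 : (n : ℝ) * (n + 1) * (2 / (2 * n + 1)) / 3 ≤ (energy n).eval 0 := by
    nlinarith
  refine le_trans ?_ h4
  have : (n : ℝ) ≤ n * (n + 1) * (2 / (2 * n + 1)) := by
    rw [← mul_div_assoc, le_div_iff₀ (by positivity)]
    nlinarith [(Nat.cast_nonneg n : (0 : ℝ) ≤ n)]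
  linarith

/-- Sonin's function for the Legendre polynomial, in Liouville normal form. -/
noncomputable def sonin (n : ℕ) (x : ℝ) : ℝ :=
  √(1 - x ^ 2) * ((1 - x ^ 2) * (derivative (legendre n)).eval x ^ 2 -
    x * (legendre n).eval x * (derivative (legendre n)).eval x +
    (n * (n + 1) + (2 * (1 - x ^ 2))⁻¹) * (legendre n).eval x ^ 2)

theorem hasDerivAt_sonin (n : ℕ) {x : ℝ} (hx : x ∈ Set.Ioo (-1 : ℝ) 1) :
    HasDerivAt (sonin n) (x * (legendre n).eval x ^ 2 / (2 * (1 - x ^ 2) * √(1 - x ^ 2))) x := by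
  have ht : 0 < 1 - x ^ 2 := by nlinarith [hx.1, hx.2]
  have hs : 0 < √(1 - x ^ 2) := Real.sqrt_pos.2 ht
  have h1 : HasDerivAt (fun x : ℝ => 1 - x ^ 2) (-(2 * x)) x := by
    simpa using (hasDerivAt_pow 2 x).const_sub 1
  have hy := (legendre n).hasDerivAt x
  have hz := (derivative (legendre n)).hasDerivAt x
  have hx' := hasDerivAt_id x
  have hode := legendre_ode_eval n x
  set y := (legendre n).eval x
  set z := (derivative (legendre n)).eval x
  have hz2 : (derivative (derivative (legendre n))).eval x =
      (2 * x * z - n * (n + 1) * y) / (1 - x ^ 2) := by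
    rw [eq_div_iff ht.ne']; linarith
  rw [hz2] at hz
  have hsq : √(1 - x ^ 2) ^ 2 = 1 - x ^ 2 := Real.sq_sqrt ht.le
  have h2 := (h1.sqrt ht.ne').mul (((h1.mul (hz.pow 2)).sub ((hx'.mul hy).mul hz)).add
    ((((h1.const_mul 2).inv (by positivity)).const_add ((n : ℝ) * (n + 1))).mul (hy.pow 2)))
  refine HasDerivAt.congr_deriv (f := sonin n) h2 ?_
  simp only [id, Pi.mul_apply, Pi.pow_apply, Pi.add_apply, Pi.sub_apply, Pi.inv_apply]
  simp only [show (legendre n).eval x = y from rfl,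
    show (derivative (legendre n)).eval x = z from rfl]
  set s := √(1 - x ^ 2)
  have : x ^ 2 = 1 - s ^ 2 := by linarith
  rw [← hsq]
  field_simp
  push_cast
  linear_combination (-2 * s ^ 2 * z * y) * this

/-- Sonin's function is monotone on `[0, 1)`, and at the origin it dominates the energy. This bounds
the derivative of `Pₙ` at a root from below. -/
theorem sonin_root_ge {n : ℕ} {a : ℝ} (ha : (legendre n).eval a = 0) :
    (n : ℝ) / 3 ≤ √(1 - a ^ 2) * ((1 - a ^ 2) * (derivative (legendre n)).eval a ^ 2) := by
  wlog h0 : 0 ≤ a generalizing a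
  · have := this (a := -a) (by rw [legendre_eval_neg, ha, mul_zero]) (by linarith)
    rw [legendre_derivative_eval_neg, neg_sq, neg_sq, mul_pow, pow_two ((-1 : ℝ) ^ n),
      neg_one_pow_mul_self, one_mul] at this
    exact this
  have hmem := legendre_root_mem ha
  have hm : MonotoneOn (sonin n) (Set.Icc 0 a) := by
    have hsub : ∀ y ∈ Set.Icc 0 a, y ∈ Set.Ioo (-1 : ℝ) 1 := fun y hy =>
      ⟨by linarith [hy.1], hy.2.trans_lt hmem.2⟩
    refine monotoneOn_of_deriv_nonneg (convex_Icc 0 a)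
      (fun y hy => (hasDerivAt_sonin n (hsub y hy)).continuousAt.continuousWithinAt)
      (fun y hy => (hasDerivAt_sonin n
        (hsub y (interior_subset hy))).differentiableAt.differentiableWithinAt)
      fun y hy => ?_
    rw [(hasDerivAt_sonin n (hsub y (interior_subset hy))).deriv]
    have h1 := (interior_subset hy).1
    have h2 := hsub y (interior_subset hy)
    have h3 : 0 ≤ 1 - y ^ 2 := by nlinarith [h2.1, h2.2]
    positivity
  have h1 := hm ⟨le_rfl, h0⟩ ⟨h0, le_rfl⟩ h0
  have h2 := energy_zero_ge n
  rw [energy_eval] at h2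
  simp only [sonin, ha] at h1
  norm_num at h1 h2
  nlinarith [sq_nonneg ((legendre n).eval 0)]

theorem legendre_derivative_root_ne_zero {n : ℕ} (hn : 1 ≤ n) {a : ℝ}
    (ha : (legendre n).eval a = 0) : (derivative (legendre n)).eval a ≠ 0 := by
  intro h
  have := sonin_root_ge ha
  rw [h] at this
  have hn' : (1 : ℝ) ≤ n := by exact_mod_cast hn
  norm_num at this
  linarith

/-- The Gauss-Legendre points: the zeros of `Pₙ`. -/
noncomputable def nodes (n : ℕ) : Finset ℝ := (legendre n).roots.toFinset

theorem mem_nodes {n : ℕ} {a : ℝ} : a ∈ nodes n ↔ (legendre n).eval a = 0 := by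
  rw [nodes, Multiset.mem_toFinset, mem_roots (legendre_ne_zero n), IsRoot.def]

theorem card_nodes (n : ℕ) : (nodes n).card = n := by
  rcases Nat.eq_zero_or_pos n with rfl | hn
  · simp [nodes, legendre]
  have hnd : (legendre n).roots.Nodup := by
    rw [Multiset.nodup_iff_count_le_one]
    intro a
    rw [count_roots]
    by_contra hcon
    have := (one_lt_rootMultiplicity_iff_isRoot (legendre_ne_zero n)).1 (not_le.1 hcon)
    exact legendre_derivative_root_ne_zero hn this.1 this.2
  rw [nodes, Multiset.toFinset_card_of_nodup hnd]
  refine le_antisymm ?_ (card_roots_legendre n)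
  exact (card_roots' _).trans (legendre_natDegree_le n)

theorem neg_mem_nodes {n : ℕ} {a : ℝ} (ha : a ∈ nodes n) : -a ∈ nodes n := by
  rw [mem_nodes] at ha ⊢
  rw [legendre_eval_neg, ha, mul_zero]

/-! ### Gauss-Legendre quadrature -/

/-- The weights of the Gauss-Legendre quadrature. -/
noncomputable def weight (n : ℕ) (a : ℝ) : ℝ := polyInt (Lagrange.basis (nodes n) id a)

theorem polyInt_interpolate (n : ℕ) (u : ℝ → ℝ) :
    polyInt (Lagrange.interpolate (nodes n) id u) = ∑ a ∈ nodes n, weight n a * u a := by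
  rw [Lagrange.interpolate_apply, map_sum]
  exact Finset.sum_congr rfl fun a _ => by rw [polyInt_C_mul, weight, mul_comm]

/-- Gauss-Legendre quadrature is exact up to degree `2n - 1`. -/
theorem polyInt_eq_sum_weight {n : ℕ} {p : ℝ[X]} (hp : p.degree < (2 * n : ℕ)) :
    polyInt p = ∑ a ∈ nodes n, weight n a * p.eval a := by
  have h0 := legendre_ne_zero n
  have hdeg : (legendre n).degree = n := by
    rw [degree_eq_natDegree h0, legendre_natDegree]
  have hdiv := EuclideanDomain.div_add_mod p (legendre n)
  have hmod : (p % legendre n).degree < n := hdeg ▸ EuclideanDomain.mod_lt p h0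
  have hquot : (p / legendre n).degree < n := by
    rcases lt_or_ge p.degree (legendre n).degree with h | h
    · rw [(Polynomial.div_eq_zero_iff h0).2 h, degree_zero]
      exact WithBot.bot_lt_coe _
    · have h2 := degree_add_div h0 h
      by_contra hcon
      have h3 : ((2 * n : ℕ) : WithBot ℕ) ≤ p.degree := by
        rw [← h2, hdeg, two_mul, Nat.cast_add]
        exact add_le_add le_rfl (not_lt.1 hcon)
      exact absurd hp (not_lt.2 h3)
  have heval : ∀ a ∈ nodes n, (p % legendre n).eval a = p.eval a := fun a ha => by
    conv_rhs => rw [← hdiv]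
    rw [eval_add, eval_mul, mem_nodes.1 ha, zero_mul, zero_add]
  have hint : p % legendre n = Lagrange.interpolate (nodes n) id fun a => p.eval a :=
    Lagrange.eq_interpolate_of_eval_eq _ Function.injective_id.injOn (by rwa [card_nodes]) heval
  conv_lhs => rw [← hdiv]
  rw [map_add, polyInt_legendre_mul_of_degree_lt hquot, zero_add, hint, polyInt_interpolate]

theorem degree_derivative_legendre_lt (n : ℕ) :
    (derivative (legendre n)).degree < n := by
  have := degree_derivative_lt (legendre_ne_zero n)
  rwa [degree_eq_natDegree (legendre_ne_zero n), legendre_natDegree] at this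

theorem degree_mul_lt_two_mul {p q : ℝ[X]} {n : ℕ} (hp : p.degree < n) (hq : q.degree < n) :
    (p * q).degree < (2 * n : ℕ) := by
  rcases eq_or_ne p 0 with rfl | h1
  · rw [zero_mul, degree_zero]; exact WithBot.bot_lt_coe _
  rcases eq_or_ne q 0 with rfl | h2
  · rw [mul_zero, degree_zero]; exact WithBot.bot_lt_coe _
  rw [← natDegree_lt_iff_degree_lt (mul_ne_zero h1 h2), natDegree_mul h1 h2]
  have := (natDegree_lt_iff_degree_lt h1).2 hp
  have := (natDegree_lt_iff_degree_lt h2).2 hq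
  omega

/-- The classical formula for the Gauss-Legendre weights, obtained by applying the quadrature to
`Pₙ' Pₙ / (X - a)`. -/
theorem weight_mul {n : ℕ} {a : ℝ} (ha : a ∈ nodes n) :
    weight n a * (derivative (legendre n)).eval a ^ 2 = 2 / (1 - a ^ 2) := by
  have ha0 := mem_nodes.1 ha
  have hmem := legendre_root_mem ha0
  obtain ⟨R, hR⟩ := dvd_iff_isRoot.2 (IsRoot.def.2 ha0)
  have hev : ∀ x, (legendre n).eval x = (x - a) * R.eval x := fun x => by
    conv_lhs => rw [hR]
    simp
  have hRa : R.eval a = (derivative (legendre n)).eval a := by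
    rw [hR]; simp
  have hR0 : R ≠ 0 := fun h => legendre_ne_zero n (by rw [hR, h, mul_zero])
  have hRdeg : R.degree < n := by
    rw [← natDegree_lt_iff_degree_lt hR0]
    have := legendre_natDegree n
    rw [hR, natDegree_mul (X_sub_C_ne_zero a) hR0, natDegree_X_sub_C] at this
    omega
  have h1 := polyInt_eq_sum_weight (degree_mul_lt_two_mul hRdeg (degree_derivative_legendre_lt n))
  rw [Finset.sum_eq_single a (fun b hb hba => by
    have := hev b
    rw [mem_nodes.1 hb] at this
    have h2 : R.eval b = 0 := (mul_eq_zero.1 this.symm).resolve_left (sub_ne_zero.2 hba)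
    rw [eval_mul, h2]; ring) (fun h => absurd ha h), eval_mul, hRa, ← pow_two] at h1
  have h3 := polyInt_derivative (R * legendre n)
  have h4 : (derivative R).degree < n := (degree_derivative_le).trans_lt hRdeg
  rw [derivative_mul, map_add, mul_comm (derivative R), polyInt_legendre_mul_of_degree_lt h4,
    zero_add, h1] at h3
  rw [h3, eval_mul, eval_mul, legendre_eval_one, legendre_eval_neg_one]
  have e1 := hev 1
  have e2 := hev (-1)
  rw [legendre_eval_one] at e1
  rw [legendre_eval_neg_one] at e2
  have p1 : 1 - a ≠ 0 := by linarith [hmem.2]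
  have p2 : -1 - a ≠ 0 := by linarith [hmem.1]
  have p3 : 1 - a ^ 2 ≠ 0 := by nlinarith [hmem.1, hmem.2]
  have f1 : R.eval 1 = 1 / (1 - a) := by rw [eq_div_iff p1]; linarith
  have f2 : R.eval (-1) = (-1) ^ n / (-1 - a) := by rw [eq_div_iff p2]; linarith
  rw [f1, f2, div_mul_eq_mul_div ((-1 : ℝ) ^ n), neg_one_pow_mul_self, mul_one]
  rw [div_sub_div _ _ p1 p2, div_eq_div_iff (mul_ne_zero p1 p2) p3]
  ring

theorem weight_nonneg {n : ℕ} (hn : 1 ≤ n) {a : ℝ} (ha : a ∈ nodes n) : 0 ≤ weight n a := by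
  have h := weight_mul ha
  have hmem := legendre_root_mem (mem_nodes.1 ha)
  have hpos : 0 < 1 - a ^ 2 := by nlinarith [hmem.1, hmem.2]
  have h2 : 0 < (derivative (legendre n)).eval a ^ 2 :=
    pow_two_pos_of_ne_zero (legendre_derivative_root_ne_zero hn (mem_nodes.1 ha))
  exact (pos_of_mul_pos_left (h ▸ div_pos two_pos hpos) h2.le).le

/-- The weights are bounded by the local spacing of the nodes. -/
theorem weight_le {n : ℕ} (hn : 1 ≤ n) {a : ℝ} (ha : a ∈ nodes n) :
    weight n a ≤ 6 * √(1 - a ^ 2) / n := by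
  have h := weight_mul ha
  have h1 := sonin_root_ge (mem_nodes.1 ha)
  have hmem := legendre_root_mem (mem_nodes.1 ha)
  have hpos : 0 < 1 - a ^ 2 := by nlinarith [hmem.1, hmem.2]
  rw [eq_div_iff hpos.ne'] at h
  have hn' : (0 : ℝ) < n := by exact_mod_cast hn
  rw [le_div_iff₀ hn']
  have h2 := mul_le_mul_of_nonneg_left h1 (weight_nonneg hn ha)
  nlinarith [Real.sqrt_nonneg (1 - a ^ 2)]

theorem weight_neg {n : ℕ} (hn : 1 ≤ n) {a : ℝ} (ha : a ∈ nodes n) :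
    weight n (-a) = weight n a := by
  have h1 := weight_mul ha
  have h2 := weight_mul (neg_mem_nodes ha)
  have h3 : (derivative (legendre n)).eval a ^ 2 ≠ 0 :=
    pow_ne_zero 2 (legendre_derivative_root_ne_zero hn (mem_nodes.1 ha))
  rw [legendre_derivative_eval_neg, neg_sq, neg_sq, mul_pow, pow_two ((-1 : ℝ) ^ n),
    neg_one_pow_mul_self, one_mul, ← h1] at h2
  exact mul_right_cancel₀ h3 h2

/-! ### The spacing of the Gauss-Legendre points -/

theorem sq_integral_le {u : ℝ → ℝ} {a b : ℝ} (hab : a ≤ b) (hu : IntervalIntegrable u volume a b)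
    (hu2 : IntervalIntegrable (fun x => u x ^ 2) volume a b) :
    (∫ x in a..b, u x) ^ 2 ≤ (b - a) * ∫ x in a..b, u x ^ 2 := by
  rcases hab.eq_or_lt with rfl | hlt
  · simp
  have hd : 0 < b - a := sub_pos.2 hlt
  set I := ∫ x in a..b, u x with hI
  have h0 : 0 ≤ ∫ x in a..b, (u x - I / (b - a)) ^ 2 :=
    intervalIntegral.integral_nonneg hab fun _ _ => sq_nonneg _
  have h1 : ∫ x in a..b, (u x - I / (b - a)) ^ 2 =
      (∫ x in a..b, u x ^ 2) - 2 * (I / (b - a)) * I + (b - a) * (I / (b - a)) ^ 2 := by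
    have e : ∀ x, (u x - I / (b - a)) ^ 2 =
        u x ^ 2 - 2 * (I / (b - a)) * u x + (I / (b - a)) ^ 2 := fun x => by ring
    simp only [e]
    rw [intervalIntegral.integral_add (hu2.sub (hu.const_mul _)) (by simp),
      intervalIntegral.integral_sub hu2 (hu.const_mul _), intervalIntegral.integral_const_mul,
      intervalIntegral.integral_const, smul_eq_mul]
  have h2 : (∫ x in a..b, u x ^ 2) - 2 * (I / (b - a)) * I + (b - a) * (I / (b - a)) ^ 2 =
      (∫ x in a..b, u x ^ 2) - I ^ 2 / (b - a) := by field_simp; ring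
  rw [h1, h2, sub_nonneg, div_le_iff₀ hd] at h0
  linarith

/-- Two zeros of `Pₙ` are separated, by Poincaré's inequality between them. -/
theorem le_mul_sq_sub_of_legendre_zeros {n : ℕ} {a b m : ℝ} (hab : a < b)
    (ha : (legendre n).eval a = 0) (hb : (legendre n).eval b = 0) (hm : 0 < m)
    (hle : ∀ x ∈ Set.Icc a b, m ≤ 1 - x ^ 2) :
    m ≤ n * (n + 1) * (b - a) ^ 2 := by
  set P := legendre n
  have hci : ∀ (p : ℝ[X]) (c d : ℝ), IntervalIntegrable (fun x => p.eval x) volume c d :=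
    fun p c d => p.continuous.intervalIntegrable c d
  set D := ∫ x in a..b, (derivative P ^ 2).eval x with hD
  set S := ∫ x in a..b, (P ^ 2).eval x with hS
  have h1 : m * D ≤ n * (n + 1) * S := by
    have e1 : ∫ x in a..b, (C ((n : ℝ) * (n + 1)) * P ^ 2 - (1 - X ^ 2) * derivative P ^ 2).eval x
        = 0 := by
      have := intervalIntegral.integral_eq_sub_of_hasDerivAt
        (fun x _ => ((X ^ 2 - 1) * derivative P * P).hasDerivAt x) (hci _ a b)
      rw [derivative_mul, legendre_ode] at this
      rw [show C ((n : ℝ) * (n + 1)) * P ^ 2 - (1 - X ^ 2) * derivative P ^ 2 =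
        C ((n : ℝ) * (n + 1)) * legendre n * P + (X ^ 2 - 1) * derivative P * derivative P by
          change _ = C ((n : ℝ) * (n + 1)) * P * P + _; ring, this]
      simp [ha, hb, P]
    have e2 : m * D ≤ ∫ x in a..b, ((1 - X ^ 2) * derivative P ^ 2).eval x := by
      rw [hD, ← intervalIntegral.integral_const_mul]
      refine intervalIntegral.integral_mono_on hab.le ((hci _ a b).const_mul m) (hci _ a b)
        fun x hx => ?_
      simp only [eval_mul, eval_sub, eval_one, eval_pow, eval_X]
      exact mul_le_mul_of_nonneg_right (hle x hx) (sq_nonneg _)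
    have e3 : ∫ x in a..b, (C ((n : ℝ) * (n + 1)) * P ^ 2 - (1 - X ^ 2) * derivative P ^ 2).eval x
        = n * (n + 1) * S - ∫ x in a..b, ((1 - X ^ 2) * derivative P ^ 2).eval x := by
      rw [hS, ← intervalIntegral.integral_const_mul, ← intervalIntegral.integral_sub
        ((hci _ a b).const_mul _) (hci _ a b)]
      exact intervalIntegral.integral_congr fun x _ => by simp
    linarith
  have h2 : S ≤ (b - a) ^ 2 * D := by
    have e1 : ∀ x ∈ Set.Icc a b, (P ^ 2).eval x ≤ (b - a) * D := fun x hx => by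
      have e2 := intervalIntegral.integral_eq_sub_of_hasDerivAt
        (fun y _ => P.hasDerivAt y) (hci (derivative P) a x)
      rw [ha, sub_zero] at e2
      have e3 := sq_integral_le hx.1 (hci (derivative P) a x)
        (((derivative P).continuous.pow 2).intervalIntegrable a x)
      rw [e2] at e3
      have e4 : ∫ y in a..x, (derivative P).eval y ^ 2 ≤ D := by
        have := intervalIntegral.integral_mono_interval (μ := volume) le_rfl hx.1 hx.2
          (ae_of_all _ fun y => by
            change 0 ≤ (derivative P ^ 2).eval y
            rw [eval_pow]; positivity) (hci (derivative P ^ 2) a b)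
        rw [hD]
        simpa only [eval_pow] using this
      have e5 : 0 ≤ ∫ y in a..x, (derivative P).eval y ^ 2 :=
        intervalIntegral.integral_nonneg hx.1 fun _ _ => sq_nonneg _
      rw [eval_pow]
      exact e3.trans (mul_le_mul (by linarith [hx.2]) e4 e5 (by linarith))
    have e6 := intervalIntegral.integral_mono_on hab.le (hci (P ^ 2) a b) (by simp) e1
    rw [intervalIntegral.integral_const, smul_eq_mul] at e6
    calc S ≤ _ := e6
      _ = _ := by ring
  have hSpos : 0 < S := by
    rw [hS, intervalIntegral.integral_pos_iff_support_of_nonneg_ae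
      (ae_of_all _ fun x => by change 0 ≤ (P ^ 2).eval x; rw [eval_pow]; positivity) (hci _ a b)]
    refine ⟨hab, ?_⟩
    have hfin : volume {x | (P ^ 2).eval x = 0} = 0 := by
      have : {x | (P ^ 2).eval x = 0} = ↑(P ^ 2).roots.toFinset := by
        ext x
        rw [Finset.mem_coe, Multiset.mem_toFinset, mem_roots (pow_ne_zero 2 (legendre_ne_zero n))]
        rfl
      rw [this]
      exact (Finset.finite_toSet _).measure_zero _
    have h3 : Function.support (fun x => (P ^ 2).eval x) = {x | (P ^ 2).eval x = 0}ᶜ := rfl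
    rw [h3, Set.inter_comm, ← Set.sdiff_eq, measure_sdiff_null hfin, Real.volume_Ioc]
    simpa using hab
  have h4 : m * S ≤ n * (n + 1) * (b - a) ^ 2 * S := by
    calc m * S ≤ m * ((b - a) ^ 2 * D) := by gcongr
      _ = (b - a) ^ 2 * (m * D) := by ring
      _ ≤ (b - a) ^ 2 * (n * (n + 1) * S) := by gcongr
      _ = _ := by ring
  exact le_of_mul_le_mul_right h4 hSpos

/-- Consecutive nodes in `[0, 1)` are at distance at least `√(1 - b²) / (n + 1)`. -/
theorem sqrt_le_mul_sub_of_mem_nodes {n : ℕ} {a b : ℝ} (h0 : 0 ≤ a) (hab : a < b)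
    (ha : a ∈ nodes n) (hb : b ∈ nodes n) :
    √(1 - b ^ 2) ≤ (n + 1) * (b - a) := by
  have hbm := legendre_root_mem (mem_nodes.1 hb)
  have h := le_mul_sq_sub_of_legendre_zeros hab (mem_nodes.1 ha) (mem_nodes.1 hb) (m := 1 - b ^ 2)
    (by nlinarith [hbm.1, hbm.2]) fun x hx => by nlinarith [hx.1, hx.2]
  refine Real.sqrt_le_iff.2 ⟨mul_nonneg (by positivity) (by linarith), h.trans ?_⟩
  rw [mul_pow]
  refine mul_le_mul_of_nonneg_right ?_ (sq_nonneg _)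
  nlinarith [(Nat.cast_nonneg n : (0 : ℝ) ≤ n)]

/-- The zeros of `Pₙ` keep a distance of order `n⁻²` from the end points: by the bound on the
energy, `|Pₙ'| ≤ (n + 1) / √(1 - x)`, and `Pₙ` has to rise from `0` to `1`. -/
theorem one_le_of_node {n : ℕ} {a : ℝ} (ha : a ∈ nodes n) :
    1 ≤ 4 * ((n : ℝ) + 1) ^ 2 * (1 - a ^ 2) := by
  wlog h0 : 0 ≤ a generalizing a
  · simpa using this (neg_mem_nodes ha) (by linarith)
  have hmem := legendre_root_mem (mem_nodes.1 ha)
  set M : ℝ := n + 1 with hM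
  have hM0 : 0 < M := by positivity
  set φ : ℝ → ℝ := fun x => (legendre n).eval x + 2 * M * √(1 - x) with hφ
  have hanti : AntitoneOn φ (Set.Icc a 1) := by
    refine antitoneOn_of_hasDerivWithinAt_nonpos (convex_Icc a 1) ?_
      (f' := fun x => (derivative (legendre n)).eval x + 2 * M * (-1 / (2 * √(1 - x)))) ?_ ?_
    · exact ((legendre n).continuous.add (by fun_prop)).continuousOn
    · intro x hx
      rw [interior_Icc] at hx
      have h1 : HasDerivAt (fun x : ℝ => 1 - x) (-1) x := by
        simpa using (hasDerivAt_id x).const_sub 1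
      exact (((legendre n).hasDerivAt x).add ((h1.sqrt (by linarith [hx.2])).const_mul
        (2 * M))).hasDerivWithinAt
    · intro x hx
      rw [interior_Icc] at hx
      have hs : 0 < √(1 - x) := Real.sqrt_pos.2 (by linarith [hx.2])
      have hss : √(1 - x) ^ 2 = 1 - x := Real.sq_sqrt (by linarith [hx.2])
      have he := energy_le (n := n) (x := x) ⟨by linarith [hx.1], hx.2.le⟩
      rw [energy_eval] at he
      have h1 : ((derivative (legendre n)).eval x * √(1 - x)) ^ 2 ≤ M ^ 2 := by
        rw [mul_pow, hss]
        have h2 : 0 ≤ (n : ℝ) * (n + 1) * (legendre n).eval x ^ 2 := by positivity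
        have h3 : 0 ≤ x * ((1 - x) * (derivative (legendre n)).eval x ^ 2) :=
          mul_nonneg (by linarith [hx.1]) (mul_nonneg (by linarith [hx.2]) (sq_nonneg _))
        nlinarith [(Nat.cast_nonneg n : (0 : ℝ) ≤ n)]
      have h2 := (abs_le_of_sq_le_sq' h1 hM0.le).2
      have e : 2 * M * (-1 / (2 * √(1 - x))) = - (M / √(1 - x)) := by field_simp
      rw [e]
      have := (le_div_iff₀ hs).2 h2
      linarith
  have h1 := hanti ⟨le_rfl, hmem.2.le⟩ ⟨hmem.2.le, le_rfl⟩ hmem.2.le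
  simp only [hφ, legendre_eval_one, mem_nodes.1 ha, sub_self, Real.sqrt_zero, mul_zero, add_zero,
    zero_add] at h1
  have h2 : 1 ≤ (2 * M * √(1 - a)) ^ 2 := by nlinarith
  rw [mul_pow, mul_pow, Real.sq_sqrt (by linarith [hmem.2])] at h2
  have h3 : 1 - a ≤ 1 - a ^ 2 := by nlinarith [hmem.2]
  nlinarith [mul_le_mul_of_nonneg_left h3 (by positivity : 0 ≤ 4 * M ^ 2)]

/-! ### Sampling at the Gauss-Legendre points -/

/-- At a single node, the weighted square of the sample is controlled by integrals over an interval
adjacent to the node, of length a quarter of the spacing. The `L²` norm of `v` with weight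
`1 / (1 - x²)` is written as that of `√(1 - x²) (v / (1 - x²))`. -/
theorem node_sample_le {n : ℕ} (hn : 1 ≤ n) {a : ℝ} (ha : a ∈ nodes n) (h0 : 0 ≤ a) {v w : ℝ → ℝ}
    (hv : IsPrim v w) (hw : L2 w)
    (hwt : L2 (fun x => √(1 - x ^ 2) * (v x / (1 - x ^ 2)))) :
    weight n a * (v a ^ 2 / (1 - a ^ 2)) ≤
      ∫ x in Set.Ioc (a - √(1 - a ^ 2) / (4 * (n + 1))) a,
        (192 * (√(1 - x ^ 2) * (v x / (1 - x ^ 2))) ^ 2 + 6 / ((n : ℝ) + 1) ^ 2 * w x ^ 2) := by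
  have hmem := legendre_root_mem (mem_nodes.1 ha)
  have hn' : (1 : ℝ) ≤ n := by exact_mod_cast hn
  set ρ := 1 - a ^ 2 with hρ
  have hρ0 : 0 < ρ := by nlinarith [hmem.1, hmem.2]
  have hρ1 : ρ ≤ 1 := by nlinarith [sq_nonneg a]
  have hs0 : 0 < √ρ := Real.sqrt_pos.2 hρ0
  have hss : √ρ ^ 2 = ρ := Real.sq_sqrt hρ0.le
  have hs1 : √ρ ≤ 1 := Real.sqrt_le_one.2 hρ1
  set δ := √ρ / (4 * ((n : ℝ) + 1)) with hδ
  have hδ0 : 0 < δ := by positivity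
  have hδn : δ * (4 * ((n : ℝ) + 1)) = √ρ := by rw [hδ]; field_simp
  have hδ8 : δ ≤ 1 / 8 := by nlinarith
  -- the nodes are at distance at least of order `n⁻²` from the end points
  have hδρ : 2 * δ ≤ ρ := by
    have h1 := one_le_of_node ha
    have h2 : 1 ≤ 2 * ((n : ℝ) + 1) * √ρ := by
      have : 1 ^ 2 ≤ (2 * ((n : ℝ) + 1) * √ρ) ^ 2 := by rw [mul_pow, hss]; linarith
      exact (abs_le_of_sq_le_sq' this (by positivity)).2
    have h3 := mul_le_mul_of_nonneg_left h2 hs0.le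
    nlinarith
  have hsub : Set.Icc (a - δ) a ⊆ dom := fun x hx =>
    ⟨by linarith [hx.1], by linarith [hx.2, hmem.2]⟩
  have hsub' : Set.Ioc (a - δ) a ⊆ dom := Set.Ioc_subset_Icc_self.trans hsub
  have hadom : a ∈ dom := ⟨hmem.1.le, hmem.2.le⟩
  set E := ∫ x in Set.Ioc (a - δ) a, w x ^ 2 with hE
  have hwi : IntegrableOn (fun x => w x ^ 2) (Set.Ioc (a - δ) a) := hw.sq.mono_set hsub'
  have hvi : IntegrableOn (fun x => (√(1 - x ^ 2) * (v x / (1 - x ^ 2))) ^ 2)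
      (Set.Ioc (a - δ) a) := hwt.sq.mono_set hsub'
  have hE0 : 0 ≤ E := setIntegral_nonneg measurableSet_Ioc fun _ _ => sq_nonneg _
  have hpt : ∀ x ∈ Set.Ioc (a - δ) a, v a ^ 2 / ρ ≤
      4 * (√(1 - x ^ 2) * (v x / (1 - x ^ 2))) ^ 2 + 2 * δ / ρ * E := fun x hx => by
    have hxd := hsub' hx
    have e1 : v a - v x = ∫ t in x..a, w t := hv.sub_mem hxd hadom
    have e2 : (v a - v x) ^ 2 ≤ δ * E := by
      have hss' : Set.Icc x a ⊆ dom := (Set.Icc_subset_Icc_left hx.1.le).trans hsub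
      have i1 : IntervalIntegrable w volume x a :=
        (intervalIntegrable_iff_integrableOn_Icc_of_le hx.2).2 (hw.integrableOn.mono_set hss')
      have i2 : IntervalIntegrable (fun t => w t ^ 2) volume x a :=
        (intervalIntegrable_iff_integrableOn_Icc_of_le hx.2).2 (hw.sq.mono_set hss')
      rw [e1]
      refine (sq_integral_le hx.2 i1 i2).trans ?_
      rw [intervalIntegral.integral_of_le hx.2]
      refine mul_le_mul (by linarith [hx.1]) ?_ (setIntegral_nonneg measurableSet_Ioc
        fun _ _ => sq_nonneg _) hδ0.le
      exact setIntegral_mono_set hwi (ae_of_all _ fun _ => sq_nonneg _)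
        (Set.Ioc_subset_Ioc_left hx.1.le).eventuallyLE
    have hx2 : 0 < 1 - x ^ 2 := by nlinarith [hx.1, hx.2, hmem.2]
    have hx3 : 1 - x ^ 2 ≤ 2 * ρ := by
      have : (a - x) * (a + x) ≤ δ * 2 := by
        have : a + x ≤ 2 := by linarith [hx.2, hmem.2]
        nlinarith [hx.1, hx.2, mul_nonneg (sub_nonneg.2 hx.2) (sub_nonneg.2 this)]
      nlinarith
    have e3 : v a ^ 2 ≤ 2 * v x ^ 2 + 2 * (δ * E) := by nlinarith [sq_nonneg (v a - 2 * v x)]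
    have e4 : (√(1 - x ^ 2) * (v x / (1 - x ^ 2))) ^ 2 = v x ^ 2 / (1 - x ^ 2) := by
      rw [mul_pow, Real.sq_sqrt hx2.le]; field_simp
    rw [e4]
    have e5 : v x ^ 2 / ρ ≤ 2 * (v x ^ 2 / (1 - x ^ 2)) := by
      rw [← mul_div_assoc, div_le_div_iff₀ hρ0 hx2]
      nlinarith [mul_le_mul_of_nonneg_left hx3 (sq_nonneg (v x))]
    calc v a ^ 2 / ρ ≤ (2 * v x ^ 2 + 2 * (δ * E)) / ρ := by gcongr
      _ = 2 * (v x ^ 2 / ρ) + 2 * δ / ρ * E := by ring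
      _ ≤ _ := by linarith
  have hvol : volume.real (Set.Ioc (a - δ) a) = δ := by
    rw [Real.volume_real_Ioc_of_le (by linarith)]; ring
  have hfin : volume (Set.Ioc (a - δ) a) < ⊤ := measure_Ioc_lt_top
  have hint := setIntegral_mono_on (f := fun _ => v a ^ 2 / ρ)
    (integrableOn_const (by simp)) ((hvi.const_mul 4).add (integrableOn_const (by simp)))
    measurableSet_Ioc hpt
  have hr : ∫ x in Set.Ioc (a - δ) a, (4 * (√(1 - x ^ 2) * (v x / (1 - x ^ 2))) ^ 2 +
      2 * δ / ρ * E) = 4 * (∫ x in Set.Ioc (a - δ) a, (√(1 - x ^ 2) * (v x / (1 - x ^ 2))) ^ 2) +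
      δ * (2 * δ / ρ * E) := by
    rw [integral_add (hvi.const_mul 4) (integrableOn_const (by simp)), integral_const_mul,
      setIntegral_const, hvol, smul_eq_mul]
  simp only [Pi.add_apply] at hint
  rw [hr, setIntegral_const, hvol, smul_eq_mul] at hint
  rw [integral_add (hvi.const_mul 192) (hwi.const_mul _), integral_const_mul, integral_const_mul,
    ← hE]
  set V := ∫ x in Set.Ioc (a - δ) a, (√(1 - x ^ 2) * (v x / (1 - x ^ 2))) ^ 2 with hV
  have hV0 : 0 ≤ V := setIntegral_nonneg measurableSet_Ioc fun _ _ => sq_nonneg _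
  have hwδ : weight n a ≤ 48 * δ := by
    refine (weight_le hn ha).trans ?_
    rw [← hρ, ← hδn, div_le_iff₀ (by linarith)]
    nlinarith
  have hq0 : 0 ≤ v a ^ 2 / ρ := by positivity
  have hδ2 : 2 * δ ^ 2 / ρ = 1 / (8 * ((n : ℝ) + 1) ^ 2) := by
    rw [hδ, div_pow, hss]; field_simp; ring
  calc weight n a * (v a ^ 2 / ρ) ≤ 48 * δ * (v a ^ 2 / ρ) := by gcongr
    _ = 48 * (δ * (v a ^ 2 / ρ)) := by ring
    _ ≤ 48 * (4 * V + δ * (2 * δ / ρ * E)) := by linarith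
    _ = 192 * V + 48 * (2 * δ ^ 2 / ρ) * E := by ring
    _ = 192 * V + 6 / ((n : ℝ) + 1) ^ 2 * E := by rw [hδ2]; field_simp; ring

/-- The intervals adjacent to the nodes in `[0, 1)` are disjoint, so the local bounds add up. -/
theorem sum_nonneg_nodes_le {n : ℕ} (hn : 1 ≤ n) {v w : ℝ → ℝ} (hv : IsPrim v w) (hw : L2 w)
    (hwt : L2 (fun x => √(1 - x ^ 2) * (v x / (1 - x ^ 2)))) :
    ∑ a ∈ nodes n with 0 ≤ a, weight n a * (v a ^ 2 / (1 - a ^ 2)) ≤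
      192 * l2 (fun x => √(1 - x ^ 2) * (v x / (1 - x ^ 2))) ^ 2 +
        6 / ((n : ℝ) + 1) ^ 2 * l2 w ^ 2 := by
  set I : ℝ → Set ℝ := fun a => Set.Ioc (a - √(1 - a ^ 2) / (4 * (n + 1))) a with hI
  set h : ℝ → ℝ := fun x => 192 * (√(1 - x ^ 2) * (v x / (1 - x ^ 2))) ^ 2 +
    6 / ((n : ℝ) + 1) ^ 2 * w x ^ 2 with hh
  have hhi : IntegrableOn h dom := (hwt.sq.const_mul _).add (hw.sq.const_mul _)
  have hsub : ∀ a ∈ nodes n, 0 ≤ a → I a ⊆ dom := fun a ha h0 x hx => by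
    have hmem := legendre_root_mem (mem_nodes.1 ha)
    have h1 : √(1 - a ^ 2) / (4 * ((n : ℝ) + 1)) ≤ 1 := by
      refine div_le_one_of_le₀ ?_ (by positivity)
      have : √(1 - a ^ 2) ≤ 1 := Real.sqrt_le_one.2 (by nlinarith [sq_nonneg a])
      nlinarith [(Nat.cast_nonneg n : (0 : ℝ) ≤ n)]
    exact ⟨by linarith [hx.1], by linarith [hx.2, hmem.2]⟩
  have hdis : (↑{a ∈ nodes n | 0 ≤ a} : Set ℝ).PairwiseDisjoint I := by
    have key : ∀ a ∈ nodes n, ∀ b ∈ nodes n, 0 ≤ a → a < b → Disjoint (I a) (I b) :=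
      fun a ha b hb h0 hab => by
        rw [Set.disjoint_left]
        intro x hxa hxb
        have h1 := sqrt_le_mul_sub_of_mem_nodes h0 hab ha hb
        have h2 : √(1 - b ^ 2) / (4 * ((n : ℝ) + 1)) ≤ b - a := by
          rw [div_le_iff₀ (by positivity)]
          have : 0 ≤ ((n : ℝ) + 1) * (b - a) := mul_nonneg (by positivity) (by linarith)
          nlinarith
        linarith [hxa.2, hxb.1]
    intro a ha b hb hab
    simp only [Finset.coe_filter, Set.mem_ofPred_eq] at ha hb
    rcases lt_or_gt_of_ne hab with hlt | hlt
    · exact key a ha.1 b hb.1 ha.2 hlt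
    · exact (key b hb.1 a ha.1 hb.2 hlt).symm
  have h1 : ∑ a ∈ nodes n with 0 ≤ a, weight n a * (v a ^ 2 / (1 - a ^ 2)) ≤
      ∑ a ∈ nodes n with 0 ≤ a, ∫ x in I a, h x := Finset.sum_le_sum fun a ha => by
    rw [Finset.mem_filter] at ha
    exact node_sample_le hn ha.1 ha.2 hv hw hwt
  refine h1.trans ?_
  rw [← integral_biUnion_finset _ (fun _ _ => measurableSet_Ioc) hdis fun a ha => by
    rw [Finset.mem_filter] at ha
    exact hhi.mono_set (hsub a ha.1 ha.2)]
  have h2 : ∫ x in dom, h x = 192 * l2 (fun x => √(1 - x ^ 2) * (v x / (1 - x ^ 2))) ^ 2 +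
        6 / ((n : ℝ) + 1) ^ 2 * l2 w ^ 2 := by
    rw [hh, integral_add (hwt.sq.const_mul _) (hw.sq.const_mul _), integral_const_mul,
      integral_const_mul, sq_l2, sq_l2]
  rw [← h2]
  refine setIntegral_mono_set hhi (ae_of_all _ fun x => ?_) (LE.le.eventuallyLE ?_)
  · change 0 ≤ 192 * (√(1 - x ^ 2) * (v x / (1 - x ^ 2))) ^ 2 + 6 / ((n : ℝ) + 1) ^ 2 * w x ^ 2
    positivity
  · refine Set.iUnion₂_subset fun a ha => ?_
    rw [Finset.mem_filter] at ha
    exact hsub a ha.1 ha.2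

theorem measurePreserving_neg_dom :
    MeasurePreserving (fun x : ℝ => -x) (volume.restrict dom) (volume.restrict dom) := by
  have h := (Measure.measurePreserving_neg (volume : Measure ℝ)).restrict_preimage
    measurableSet_dom
  have h2 : (Neg.neg ⁻¹' dom : Set ℝ) = dom := by
    ext x; simp only [dom, Set.mem_preimage, Set.mem_Icc]; constructor <;> rintro ⟨h1, h2⟩ <;>
      constructor <;> linarith
  rw [h2] at h
  exact h

theorem integral_dom_neg (h : ℝ → ℝ) : ∫ x in dom, h (-x) = ∫ x in dom, h x :=
  measurePreserving_neg_dom.integral_comp (MeasurableEquiv.neg ℝ).measurableEmbedding h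

theorem l2_neg_comp (u : ℝ → ℝ) : l2 (fun x => u (-x)) = l2 u := by
  unfold l2
  rw [integral_dom_neg fun x => u x ^ 2]

theorem IsPrim.comp_neg {v w : ℝ → ℝ} (h : IsPrim v w) :
    IsPrim (fun x => v (-x)) (fun x => -w (-x)) := by
  refine ⟨?_, fun x hx => ?_⟩
  · exact (measurePreserving_neg_dom.integrable_comp_of_integrable h.integrableOn).neg
  · have hx' : -x ∈ dom := ⟨by linarith [hx.2], by linarith [hx.1]⟩
    have h1 := h.sub_mem hx' one_mem_dom
    simp only [neg_neg]
    rw [intervalIntegral.integral_neg, intervalIntegral.integral_comp_neg fun t => w t, neg_neg]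
    linarith

/-- A Marcinkiewicz-Zygmund inequality: the discrete norm of the samples of `v` is bounded by its
continuous norm, up to a term with its derivative. -/
theorem sum_nodes_le {n : ℕ} (hn : 1 ≤ n) {v w : ℝ → ℝ} (hv : IsPrim v w) (hw : L2 w)
    (hwt : L2 (fun x => √(1 - x ^ 2) * (v x / (1 - x ^ 2)))) :
    ∑ a ∈ nodes n, weight n a * (v a ^ 2 / (1 - a ^ 2)) ≤
      2 * (192 * l2 (fun x => √(1 - x ^ 2) * (v x / (1 - x ^ 2))) ^ 2 +
        6 / ((n : ℝ) + 1) ^ 2 * l2 w ^ 2) := by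
  have hcomp : ∀ {u : ℝ → ℝ}, L2 u → L2 fun x => u (-x) := fun hu =>
    hu.comp_measurePreserving measurePreserving_neg_dom
  have h1 := sum_nonneg_nodes_le hn hv hw hwt
  have h2 := sum_nonneg_nodes_le hn hv.comp_neg (hcomp hw).neg (by simpa using hcomp hwt)
  have e1 : l2 (fun x => √(1 - x ^ 2) * (v (-x) / (1 - x ^ 2))) =
      l2 (fun x => √(1 - x ^ 2) * (v x / (1 - x ^ 2))) := by
    rw [← l2_neg_comp fun x => √(1 - x ^ 2) * (v x / (1 - x ^ 2))]
    simp
  have e2 : l2 (fun x => -w (-x)) = l2 w := by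
    rw [← l2_neg_comp w]; simp [l2]
  rw [e1, e2] at h2
  have e3 : ∑ a ∈ nodes n with ¬ 0 ≤ a, weight n a * (v a ^ 2 / (1 - a ^ 2)) ≤
      ∑ a ∈ nodes n with 0 ≤ a, weight n a * (v (-a) ^ 2 / (1 - a ^ 2)) := by
    have : ∑ a ∈ nodes n with 0 ≤ a, weight n a * (v (-a) ^ 2 / (1 - a ^ 2)) =
        ∑ a ∈ nodes n with 0 ≤ -a, weight n a * (v a ^ 2 / (1 - a ^ 2)) := by
      refine Finset.sum_bij' (fun a _ => -a) (fun a _ => -a) ?_ ?_ ?_ ?_ ?_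
      · intro a ha
        rw [Finset.mem_filter] at ha ⊢
        exact ⟨neg_mem_nodes ha.1, by simpa using ha.2⟩
      · intro a ha
        rw [Finset.mem_filter] at ha ⊢
        exact ⟨neg_mem_nodes ha.1, ha.2⟩
      · simp
      · simp
      · intro a ha
        rw [Finset.mem_filter] at ha
        rw [weight_neg hn ha.1, neg_sq]
    rw [this]
    refine Finset.sum_le_sum_of_subset_of_nonneg (fun a ha => ?_) fun a ha _ => ?_
    · rw [Finset.mem_filter] at ha ⊢
      exact ⟨ha.1, by linarith [ha.2]⟩
    · rw [Finset.mem_filter] at ha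
      have hmem := legendre_root_mem (mem_nodes.1 ha.1)
      exact mul_nonneg (weight_nonneg hn ha.1) (div_nonneg (sq_nonneg _)
        (by nlinarith [hmem.1, hmem.2]))
  rw [← Finset.sum_filter_add_sum_filter_not (nodes n) (fun a => 0 ≤ a)]
  linarith

/-! ### The error of collocation -/

theorem sq_l2_weighted_poly (p : ℝ[X]) :
    l2 (fun x => √(1 - x ^ 2) * p.eval x) ^ 2 = polyInt ((1 - X ^ 2) * p ^ 2) := by
  rw [sq_l2_weighted, polyInt_apply]; simp

theorem abs_polyInt_mul_le (p q : ℝ[X]) :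
    |polyInt (p * q)| ≤ l2 (fun x => p.eval x) * l2 (fun x => q.eval x) := by
  rw [polyInt_apply]
  simp only [eval_mul]
  exact integral_mul_le_l2 (L2.poly p) (L2.poly q)

theorem abs_polyInt_weighted_mul_le (p q : ℝ[X]) : |polyInt ((1 - X ^ 2) * p * q)| ≤
    l2 (fun x => √(1 - x ^ 2) * p.eval x) * l2 (fun x => √(1 - x ^ 2) * q.eval x) := by
  have h := integral_mul_le_l2 (L2.continuousOn_mul continuous_weight.continuousOn (L2.poly p))
    (L2.continuousOn_mul continuous_weight.continuousOn (L2.poly q))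
  have e : polyInt ((1 - X ^ 2) * p * q) =
      ∫ x in dom, √(1 - x ^ 2) * p.eval x * (√(1 - x ^ 2) * q.eval x) := by
    rw [polyInt_apply]
    refine setIntegral_congr_fun measurableSet_dom fun x hx => ?_
    have := Real.mul_self_sqrt (one_sub_sq_nonneg hx)
    simp only [eval_mul, eval_sub, eval_one, eval_pow, eval_X]
    linear_combination (-(p.eval x * q.eval x)) * this
  rwa [e]

/-- The Gauss quadrature overestimates the integral of `(1 - x²) s²`, although the degree may
exceed `2n - 1` by one, since the leading coefficient is negative. -/
theorem polyInt_weighted_sq_le_sum {n : ℕ} {s : ℝ[X]} (hn : 1 ≤ n) (hs : s.natDegree ≤ n - 1) :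
    polyInt ((1 - X ^ 2) * s ^ 2) ≤ ∑ a ∈ nodes n, weight n a * ((1 - a ^ 2) * s.eval a ^ 2) := by
  set P := legendre n
  set κ := s.coeff (n - 1) / P.coeff n with hκ
  have hP0 : P.coeff n ≠ 0 := (legendre_coeff_pos n).ne'
  have hXs : (X * s).natDegree ≤ n :=
    natDegree_mul_le.trans (by rw [natDegree_X]; omega)
  have hCP : (C κ * P).natDegree ≤ n := (natDegree_C_mul_le _ _).trans (legendre_natDegree_le n)
  have h1 : Polynomial.degree (C κ * P - X * s) < (n : WithBot ℕ) := by
    refine degree_lt_of_coeff_eq_zero ((natDegree_sub_le _ _).trans (max_le hCP hXs)) ?_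
    obtain ⟨k, rfl⟩ : ∃ k, n = k + 1 := ⟨n - 1, by omega⟩
    rw [coeff_sub, coeff_C_mul, coeff_X_mul, hκ]
    simp only [Nat.add_sub_cancel]
    field_simp
    ring
  have h2 : (C κ * P + X * s).natDegree ≤ n := (natDegree_add_le _ _).trans (max_le hCP hXs)
  have hsd : s.degree < n := by
    refine (degree_le_natDegree).trans_lt ?_
    exact_mod_cast (by omega : s.natDegree < n)
  have h3 : Polynomial.degree (s ^ 2 + (C κ * P - X * s) * (C κ * P + X * s)) <
      ((2 * n : ℕ) : WithBot ℕ) := by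
    refine (degree_add_le _ _).trans_lt (max_lt ?_ ?_)
    · rw [pow_two]; exact degree_mul_lt_two_mul hsd hsd
    · rcases eq_or_ne (C κ * P - X * s) 0 with h0 | h0
      · rw [h0, zero_mul, degree_zero]; exact WithBot.bot_lt_coe _
      · have h4 := (natDegree_lt_iff_degree_lt h0).2 h1
        refine (degree_le_natDegree).trans_lt ?_
        have : ((C κ * P - X * s) * (C κ * P + X * s)).natDegree < 2 * n :=
          natDegree_mul_le.trans_lt (by omega)
        exact_mod_cast this
  have h4 := polyInt_eq_sum_weight h3
  have h5 : s ^ 2 + (C κ * P - X * s) * (C κ * P + X * s) =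
      (1 - X ^ 2) * s ^ 2 + C (κ ^ 2) * P ^ 2 := by rw [C_pow]; ring
  rw [h5, map_add, polyInt_C_mul] at h4
  have h6 : 0 ≤ κ ^ 2 * polyInt (P ^ 2) := by
    rw [← sq_l2_poly]; positivity
  have h7 : ∑ a ∈ nodes n, weight n a * ((1 - X ^ 2) * s ^ 2 + C (κ ^ 2) * P ^ 2).eval a =
      ∑ a ∈ nodes n, weight n a * ((1 - a ^ 2) * s.eval a ^ 2) :=
    Finset.sum_congr rfl fun a ha => by
      simp [P, mem_nodes.1 ha]
  rw [h7] at h4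
  linarith

/-- Bernstein's inequality for polynomials vanishing at `±1`. -/
theorem l2_derivative_weight_mul_le {n : ℕ} {s : ℝ[X]} (hs : s.natDegree + 1 ≤ n) :
    l2 (fun x => (derivative ((1 - X ^ 2) * s)).eval x) ≤
      (n + 1) * l2 (fun x => √(1 - x ^ 2) * s.eval x) := by
  set E := (1 - X ^ 2) * s with hE
  have hEd : E.natDegree ≤ n + 1 := by
    have h1 : (1 - X ^ 2 : ℝ[X]).natDegree ≤ 2 := by
      refine (natDegree_sub_le _ _).trans (by simp)
    exact natDegree_mul_le.trans (by omega)
  have hE'd : (derivative E).natDegree ≤ n := (natDegree_derivative_le _).trans (by omega)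
  set N := l2 (fun x => (derivative E).eval x) with hN
  have h1 : N ^ 2 = - polyInt ((1 - X ^ 2) * s * derivative (derivative E)) := by
    have h := polyInt_derivative (E * derivative E)
    have h0 : (E * derivative E).eval 1 - (E * derivative E).eval (-1) = 0 := by simp [hE]
    rw [h0, derivative_mul, map_add, ← pow_two] at h
    rw [hN, sq_l2_poly, ← hE]
    linarith
  have h2 := abs_polyInt_weighted_mul_le s (derivative (derivative E))
  have h3 := polyInt_weighted_le hE'd
  rw [← sq_l2_weighted_poly, ← sq_l2_poly] at h3
  have h4 : l2 (fun x => √(1 - x ^ 2) * (derivative (derivative E)).eval x) ≤ (n + 1) * N := by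
    refine (abs_le_of_sq_le_sq' ?_ (mul_nonneg (by positivity) (l2_nonneg _))).2
    rw [mul_pow]
    refine h3.trans (mul_le_mul_of_nonneg_right ?_ (sq_nonneg _))
    nlinarith [(Nat.cast_nonneg n : (0 : ℝ) ≤ n)]
  have h5 : N ^ 2 ≤ l2 (fun x => √(1 - x ^ 2) * s.eval x) * ((n + 1) * N) := by
    rw [h1]
    exact (neg_le_abs _).trans (h2.trans (mul_le_mul_of_nonneg_left h4 (l2_nonneg _)))
  have hN0 : 0 ≤ N := l2_nonneg _
  rcases hN0.eq_or_lt with h0 | h0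
  · rw [← h0]; exact mul_nonneg (by positivity) (l2_nonneg _)
  · refine le_of_mul_le_mul_left ?_ h0
    rw [← pow_two]
    linarith

theorem polyInt_legendre_mul_X_mul_self (n : ℕ) :
    polyInt (legendre n * (X * legendre n)) = 0 := by
  have h := integral_dom_neg fun x => (legendre n * (X * legendre n)).eval x
  rw [← polyInt_apply] at h
  simp only [eval_mul, eval_X, legendre_eval_neg] at h
  have e : ∀ x, (-1 : ℝ) ^ n * (legendre n).eval x * (-x * ((-1) ^ n * (legendre n).eval x)) =
      - ((legendre n).eval x * (x * (legendre n).eval x)) := fun x => by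
    linear_combination (-(x * (legendre n).eval x ^ 2)) * neg_one_pow_mul_self n
  simp only [e] at h
  rw [integral_neg, polyInt_apply] at h
  simp only [eval_mul, eval_X] at h
  rw [polyInt_apply]
  simp only [eval_mul, eval_X]
  linarith

theorem l2_legendre_sq (n : ℕ) : l2 (fun x => (legendre n).eval x) ^ 2 = 2 / (2 * n + 1) := by
  rw [sq_l2_poly, polyInt_legendre_sq]

theorem one_le_sqrt_mul_l2_legendre {n : ℕ} (hn : 1 ≤ n) :
    1 ≤ 2 * √n * l2 (fun x => (legendre n).eval x) := by
  have hn' : (1 : ℝ) ≤ n := by exact_mod_cast hn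
  refine (abs_le_of_sq_le_sq' ?_ (mul_nonneg (by positivity) (l2_nonneg _))).2
  rw [mul_pow, mul_pow, l2_legendre_sq, Real.sq_sqrt (by positivity), one_pow, ← mul_div_assoc,
    le_div_iff₀ (by positivity)]
  linarith

theorem l2_legendre_le_one {n : ℕ} (hn : 1 ≤ n) : l2 (fun x => (legendre n).eval x) ≤ 1 := by
  have hn' : (1 : ℝ) ≤ n := by exact_mod_cast hn
  refine (abs_le_of_sq_le_sq' ?_ zero_le_one).2
  rw [l2_legendre_sq, div_le_iff₀ (by positivity)]
  linarith

theorem l2_derivative_legendre_le {n : ℕ} (hn : 1 ≤ n) :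
    l2 (fun x => (derivative (legendre n)).eval x) ≤ 2 * n := by
  have hn' : (1 : ℝ) ≤ n := by exact_mod_cast hn
  refine (abs_le_of_sq_le_sq' ?_ (by positivity)).2
  rw [sq_l2_poly, polyInt_derivative_legendre_sq]
  nlinarith

theorem l2_X_mul_le (p : ℝ[X]) : l2 (fun x => (X * p).eval x) ≤ l2 (fun x => p.eval x) := by
  refine l2_mono (L2.poly p) fun x hx => ?_
  rw [eval_mul, eval_X, abs_mul]
  exact mul_le_of_le_one_left (abs_nonneg _) (abs_le.2 hx)

/-- If `e` has degree less than `n` and `E = e + (α + β x) Pₙ`, then `α` and `β` are controlled by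
`E`, because `e` is orthogonal to `Pₙ` and `Pₙ₊₁`. -/
theorem correction_le {n : ℕ} (hn : 1 ≤ n) {e E : ℝ[X]} {α β : ℝ} (he : e.degree < n)
    (hE : E = e + (C α + C β * X) * legendre n) :
    |α| * l2 (fun x => (legendre n).eval x) ≤ l2 (fun x => E.eval x) ∧
      |β| * l2 (fun x => (legendre n).eval x) ≤ 4 * l2 (fun x => E.eval x) := by
  set N := l2 (fun x => (legendre n).eval x) with hN
  set N1 := l2 (fun x => (legendre (n + 1)).eval x) with hN1
  have hNsq : N ^ 2 = 2 / (2 * n + 1) := l2_legendre_sq n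
  have hN1sq : N1 ^ 2 = 2 / (2 * n + 3) := by
    rw [hN1, l2_legendre_sq]; push_cast; ring_nf
  have hN0 : 0 < N := lt_of_le_of_ne (l2_nonneg _) fun h => by
    rw [← h] at hNsq
    have : (0 : ℝ) < 2 / (2 * n + 1) := by positivity
    norm_num at hNsq
    linarith
  have hN10 : 0 < N1 := lt_of_le_of_ne (l2_nonneg _) fun h => by
    rw [← h] at hN1sq
    have : (0 : ℝ) < 2 / (2 * n + 3) := by positivity
    norm_num at hN1sq
    linarith
  have ha := abs_polyInt_mul_le (legendre n) E
  have hb := abs_polyInt_mul_le (legendre (n + 1)) E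
  rw [← hN] at ha
  rw [← hN1] at hb
  have e1 : polyInt (legendre n * E) = α * N ^ 2 := by
    rw [hE, show legendre n * (e + (C α + C β * X) * legendre n) = legendre n * e +
      C α * legendre n ^ 2 + C β * (legendre n * (X * legendre n)) by ring, map_add, map_add,
      polyInt_legendre_mul_of_degree_lt he, polyInt_C_mul, polyInt_C_mul,
      polyInt_legendre_mul_X_mul_self, polyInt_legendre_sq, hNsq]
    ring
  have hlt : (legendre n).degree < (n + 1 : ℕ) := by
    refine (degree_le_natDegree).trans_lt ?_
    rw [legendre_natDegree]
    exact_mod_cast Nat.lt_succ_self n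
  have he' : e.degree < (n + 1 : ℕ) := he.trans (by exact_mod_cast Nat.lt_succ_self n)
  have e2 : polyInt (legendre (n + 1) * E) = β * ((n + 1) / (2 * n + 1) * N1 ^ 2) := by
    rw [hE, show legendre (n + 1) * (e + (C α + C β * X) * legendre n) = legendre (n + 1) * e +
      C α * (legendre (n + 1) * legendre n) + C β * (legendre (n + 1) * (X * legendre n)) by ring,
      map_add, map_add, polyInt_legendre_mul_of_degree_lt he', polyInt_C_mul, polyInt_C_mul,
      polyInt_legendre_mul_of_degree_lt hlt, polyInt_legendre_succ_mul_X_mul, hN1sq]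
    ring
  constructor
  · rw [e1, abs_mul, abs_of_nonneg (sq_nonneg N)] at ha
    refine le_of_mul_le_mul_left ?_ hN0
    linarith
  · rw [e2, abs_mul,
      abs_of_nonneg (show (0 : ℝ) ≤ (n + 1) / (2 * n + 1) * N1 ^ 2 by positivity)] at hb
    have hn0 : (0 : ℝ) ≤ n := by positivity
    have h1 : (1 : ℝ) / 2 ≤ (n + 1) / (2 * n + 1) := by
      rw [div_le_div_iff₀ (by norm_num) (by positivity)]; linarith
    have h2 : N ≤ 2 * N1 := by
      refine (abs_le_of_sq_le_sq' ?_ (by positivity)).2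
      rw [mul_pow, hNsq, hN1sq, ← mul_div_assoc, div_le_div_iff₀ (by positivity) (by positivity)]
      linarith
    have h3 : |β| * (1 / 2 * N1 ^ 2) ≤ N1 * l2 (fun x => E.eval x) :=
      le_trans (by gcongr) hb
    have h4 : |β| * N1 ≤ 2 * l2 (fun x => E.eval x) := by
      refine le_of_mul_le_mul_left ?_ hN10
      linarith
    have h5 := mul_le_mul_of_nonneg_left h2 (abs_nonneg β)
    linarith

theorem exists_eq_one_sub_sq_mul {E : ℝ[X]} {n : ℕ} (hE : E.natDegree ≤ n + 1) (h1 : E.eval 1 = 0)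
    (h2 : E.eval (-1) = 0) (hn : 1 ≤ n) :
    ∃ s : ℝ[X], s.natDegree + 1 ≤ n ∧ E = (1 - X ^ 2) * s := by
  obtain ⟨E1, hE1⟩ := dvd_iff_isRoot.2 (IsRoot.def.2 h1)
  have h3 : E1.eval (-1) = 0 := by
    rw [hE1] at h2
    simp at h2
    rcases h2 with h2 | h2
    · norm_num at h2
    · exact h2
  obtain ⟨s, hs⟩ := dvd_iff_isRoot.2 (IsRoot.def.2 h3)
  have hEs : E = (1 - X ^ 2) * (-s) := by
    rw [hE1, hs]; simp only [map_neg, map_one]; ring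
  refine ⟨-s, ?_, hEs⟩
  rcases eq_or_ne s 0 with h0 | h0
  · simp [h0, hn]
  · have : E.natDegree = 1 + (1 + s.natDegree) := by
      rw [hE1, hs, natDegree_mul (X_sub_C_ne_zero _) (mul_ne_zero (X_sub_C_ne_zero _) h0),
        natDegree_mul (X_sub_C_ne_zero _) h0, natDegree_X_sub_C, natDegree_X_sub_C]
    rw [natDegree_neg]
    omega

theorem collocation_congr {u v : ℝ → ℝ} (h : Set.EqOn u v dom) (n : ℕ) :
    collocation u n = collocation v n := by
  change Lagrange.interpolate (nodes n) id u = Lagrange.interpolate (nodes n) id v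
  refine Lagrange.interpolate_eq_of_values_eq_on _ _ fun a ha => h ?_
  exact Set.Ioo_subset_Icc_self (legendre_root_mem (mem_nodes.1 ha))

theorem collocation_sub_poly {u : ℝ → ℝ} {q : ℝ[X]} {n : ℕ} (hq : q.degree < n) :
    collocation (fun x => u x - q.eval x) n = collocation u n - q := by
  have h1 : q = Lagrange.interpolate (nodes n) id fun x => q.eval x :=
    Lagrange.eq_interpolate_of_eval_eq _ Function.injective_id.injOn (by rwa [card_nodes])
      fun _ _ => rfl
  change Lagrange.interpolate (nodes n) id (u - fun x => q.eval x) = _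
  rw [map_sub, ← h1]
  rfl

theorem collocation_degree_lt (u : ℝ → ℝ) (n : ℕ) : (collocation u n).degree < n := by
  have := Lagrange.degree_interpolate_lt (s := nodes n) (v := id) u Function.injective_id.injOn
  rwa [card_nodes] at this

theorem collocation_eval {u : ℝ → ℝ} {n : ℕ} {a : ℝ} (ha : a ∈ nodes n) :
    (collocation u n).eval a = u a :=
  Lagrange.eval_interpolate_at_node u Function.injective_id.injOn ha

/-- Stability of the interpolation of a residual `v` of derivative `w`. The interpolant `e` need not
vanish at `±1`; it does after adding a multiple of `Pₙ` by a linear factor, which leaves the samples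
unchanged. The sum `E` is then divisible by `1 - x²`, its weighted norm is bounded by the discrete
norm of the samples, and Bernstein's inequality costs no power of `n` beyond the gain for `v`.
Removing the correction costs `√n`. -/
theorem collocation_residual_le {m : ℕ} {v w : ℝ → ℝ} (h : IsResidual m v w)
    (hwt : L2 (fun x => √(1 - x ^ 2) * (v x / (1 - x ^ 2)))) :
    l2 (fun x => (collocation v (m + 2)).eval x) ≤ 1200 * (√((m + 2 : ℕ) : ℝ) * l2 w) ∧
    l2 (fun x => (derivative (collocation v (m + 2))).eval x) ≤
      1200 * (√((m + 2 : ℕ) : ℝ) * l2 w) := by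
  set n := m + 2 with hnm
  have hn : 1 ≤ n := by omega
  have hn' : (1 : ℝ) ≤ n := by exact_mod_cast hn
  set e := collocation v n with he
  have hed : e.degree < n := collocation_degree_lt v n
  set σ : ℝ := (-1) ^ n with hσ
  have hσσ : σ * σ = 1 := neg_one_pow_mul_self n
  set α := -(e.eval 1 + σ * e.eval (-1)) / 2 with hα
  set β := -(e.eval 1 - σ * e.eval (-1)) / 2 with hβ
  set P := legendre n with hP
  set E := e + (C α + C β * X) * P with hE
  have hE1 : E.eval 1 = 0 := by
    simp only [hE, eval_add, eval_mul, eval_C, eval_X, hP, legendre_eval_one, hα, hβ]; ring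
  have hE2 : E.eval (-1) = 0 := by
    simp only [hE, eval_add, eval_mul, eval_C, eval_X, hP, legendre_eval_neg_one, hα, hβ, ← hσ]
    linear_combination (-(e.eval (-1))) * hσσ
  have hEd : E.natDegree ≤ n + 1 := by
    refine (natDegree_add_le _ _).trans (max_le ?_ ?_)
    · exact (natDegree_le_of_degree_le hed.le).trans (by omega)
    · refine natDegree_mul_le.trans ?_
      have h1 : (C α + C β * X : ℝ[X]).natDegree ≤ 1 := by
        rw [add_comm]; exact natDegree_linear_le
      rw [hP, legendre_natDegree]
      omega
  obtain ⟨s, hsd, hEs⟩ := exists_eq_one_sub_sq_mul hEd hE1 hE2 hn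
  set B := l2 (fun x => √(1 - x ^ 2) * s.eval x) with hB
  set W := l2 w with hW
  have hW0 : 0 ≤ W := l2_nonneg _
  have hB0 : 0 ≤ B := l2_nonneg _
  -- the discrete norm of the samples bounds the weighted norm of `E`
  have hBn : B * n ≤ 40 * W := by
    have h1 := polyInt_weighted_sq_le_sum hn (s := s) (by omega)
    rw [← sq_l2_weighted_poly, ← hB] at h1
    have h2 : ∑ a ∈ nodes n, weight n a * ((1 - a ^ 2) * s.eval a ^ 2) =
        ∑ a ∈ nodes n, weight n a * (v a ^ 2 / (1 - a ^ 2)) := Finset.sum_congr rfl fun a ha => by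
      have hmem := legendre_root_mem (mem_nodes.1 ha)
      have hpos : 1 - a ^ 2 ≠ 0 := by nlinarith [hmem.1, hmem.2]
      have h3 : (1 - a ^ 2) * s.eval a = v a := by
        have := congrArg (eval a) hEs
        rw [hE, eval_add, eval_mul, hP, mem_nodes.1 ha, mul_zero, add_zero, collocation_eval ha]
          at this
        simpa using this.symm
      rw [← h3]
      field_simp
    have h3 := sum_nodes_le hn h.isPrim h.memL2 hwt
    rw [h2] at h1
    set A := l2 (fun x => √(1 - x ^ 2) * (v x / (1 - x ^ 2)))
    have hA : A * n ≤ 2 * W := by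
      have h4 := h.weighted_le
      rw [one_div, inv_mul_eq_div, le_div_iff₀ (by positivity)] at h4
      have h5 : (n : ℝ) ≤ 2 * (m + 1) := by
        rw [hnm]; push_cast; linarith [(Nat.cast_nonneg m : (0 : ℝ) ≤ m)]
      have h6 : 0 ≤ A := l2_nonneg _
      calc A * n ≤ A * (2 * (m + 1)) := by gcongr
        _ = 2 * (A * (m + 1)) := by ring
        _ ≤ 2 * W := by linarith
    have h6 : 0 ≤ A := l2_nonneg _
    have h7 : 6 / ((n : ℝ) + 1) ^ 2 * W ^ 2 * n ^ 2 ≤ 6 * W ^ 2 := by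
      rw [div_mul_eq_mul_div, div_mul_eq_mul_div, div_le_iff₀ (by positivity)]
      have : (n : ℝ) ^ 2 ≤ (n + 1) ^ 2 := by nlinarith
      have h8 : 0 ≤ 6 * W ^ 2 := by positivity
      exact mul_le_mul_of_nonneg_left this h8
    have h8 : (A * n) ^ 2 ≤ (2 * W) ^ 2 := by gcongr
    refine (abs_le_of_sq_le_sq' ?_ (by positivity)).2
    have h9 := mul_le_mul_of_nonneg_right (h1.trans h3) (sq_nonneg (n : ℝ))
    nlinarith
  set L := l2 (fun x => E.eval x) with hL
  have hL0 : 0 ≤ L := l2_nonneg _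
  have hLB : L ≤ B := by
    refine l2_mono (L2.continuousOn_mul continuous_weight.continuousOn (L2.poly s)) fun x hx => ?_
    have h1 := one_sub_sq_nonneg hx
    have h2 : √(1 - x ^ 2) ≤ 1 := Real.sqrt_le_one.2 (by nlinarith [sq_nonneg x])
    have h3 := Real.mul_self_sqrt h1
    rw [hEs, eval_mul, abs_mul, abs_mul]
    refine mul_le_mul_of_nonneg_right ?_ (abs_nonneg _)
    simp only [eval_sub, eval_one, eval_pow, eval_X]
    rw [abs_of_nonneg h1, abs_of_nonneg (Real.sqrt_nonneg _)]
    nlinarith [Real.sqrt_nonneg (1 - x ^ 2)]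
  have hLn : L * n ≤ 40 * W := (mul_le_mul_of_nonneg_right hLB (by positivity)).trans hBn
  have hE' : l2 (fun x => (derivative E).eval x) ≤ 80 * W := by
    have h1 := l2_derivative_weight_mul_le hsd
    rw [← hEs, ← hB] at h1
    nlinarith
  -- `Pₙ` has norm of order `n⁻¹ᐟ²`, hence the loss of `√n` in the coefficients of the correction
  obtain ⟨hα1, hβ1⟩ := correction_le hn hed hE
  set N := l2 (fun x => P.eval x) with hN
  have hN0 : 0 ≤ N := l2_nonneg _
  have hN1 : N ≤ 1 := l2_legendre_le_one hn
  have hNn : 1 ≤ 2 * √n * N := one_le_sqrt_mul_l2_legendre hn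
  set S := √(n : ℝ) with hS
  have hS1 : 1 ≤ S := Real.one_le_sqrt.2 hn'
  have hα2 : |α| ≤ 2 * S * L := by
    have := mul_le_mul_of_nonneg_left hα1 (by positivity : 0 ≤ 2 * S)
    nlinarith [abs_nonneg α]
  have hβ2 : |β| ≤ 8 * S * L := by
    have := mul_le_mul_of_nonneg_left hβ1 (by positivity : 0 ≤ 2 * S)
    nlinarith [abs_nonneg β]
  have hWS : W ≤ S * W := le_mul_of_one_le_left hW0 hS1
  have hLW : L ≤ 40 * W := by nlinarith
  constructor
  · have e1 : (fun x => e.eval x) = fun x => E.eval x - (α * P.eval x + β * (X * P).eval x) := by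
      funext x
      simp only [hE, eval_add, eval_mul, eval_C, eval_X]; ring
    rw [e1]
    have m2 : L2 (fun x => α * P.eval x + β * (X * P).eval x) :=
      ((L2.poly P).const_mul α).add ((L2.poly (X * P)).const_mul β)
    have t1 := l2_sub_le (L2.poly E) m2
    have t2 := l2_add_le ((L2.poly P).const_mul α) ((L2.poly (X * P)).const_mul β)
    rw [l2_const_mul, l2_const_mul] at t2
    have t3 := mul_le_mul_of_nonneg_left (l2_X_mul_le P) (abs_nonneg β)
    refine t1.trans ?_
    linarith
  · have e1 : (fun x => (derivative e).eval x) = fun x => (derivative E).eval x -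
        (α * (derivative P).eval x + β * (P.eval x + (X * derivative P).eval x)) := by
      funext x
      simp only [hE, derivative_add, derivative_mul, derivative_C, derivative_X, eval_add, eval_mul,
        eval_C, eval_X, zero_mul, zero_add, mul_one]
      ring
    rw [e1]
    have t0 : L2 (fun x => P.eval x + (X * derivative P).eval x) :=
      (L2.poly P).add (L2.poly (X * derivative P))
    have m2 : L2 (fun x => α * (derivative P).eval x +
        β * (P.eval x + (X * derivative P).eval x)) :=
      ((L2.poly (derivative P)).const_mul α).add (t0.const_mul β)
    have t1 := l2_sub_le (L2.poly (derivative E)) m2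
    have t2 := l2_add_le ((L2.poly (derivative P)).const_mul α) (t0.const_mul β)
    rw [l2_const_mul, l2_const_mul] at t2
    have t3 := l2_add_le (L2.poly P) (L2.poly (X * derivative P))
    have t4 := (l2_X_mul_le (derivative P)).trans (l2_derivative_legendre_le hn)
    have t5 : l2 (fun x => P.eval x + (X * derivative P).eval x) ≤ 3 * n :=
      t3.trans (by linarith)
    have t6 := mul_le_mul hα2 (l2_derivative_legendre_le hn) (l2_nonneg _) (by positivity)
    have t7 := mul_le_mul hβ2 t5 (l2_nonneg _) (by positivity)
    have t8 : S * (L * n) ≤ S * (40 * W) := by gcongr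
    calc _ ≤ _ := t1
      _ ≤ 80 * W + (2 * S * L * (2 * n) + 8 * S * L * (3 * n)) :=
        add_le_add hE' (t2.trans (add_le_add t6 t7))
      _ = 80 * W + 28 * (S * (L * n)) := by ring
      _ ≤ 80 * (S * W) + 28 * (S * (40 * W)) := by linarith
      _ = 1200 * (S * W) := by ring

/-- The error of collocation in `H¹`. Interpolation reproduces the integrated Legendre projection
`q`, so only the residual is interpolated. -/
theorem exists_collocation_error (s : ℕ) : ∃ K : ℝ, 0 < K ∧ ∀ F : ℕ → ℝ → ℝ, IsChain (s + 2) F →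
    ∀ H : ℝ, (∀ j ≤ s + 2, l2 (F j) ≤ H) → ∀ n : ℕ, 1 ≤ n →
    l2 (fun x => F 0 x - (collocation (F 0) n).eval x) ≤ K * H * (√n / (n : ℝ) ^ (s + 1)) ∧
    l2 (fun x => F 1 x - (derivative (collocation (F 0) n)).eval x) ≤
      K * H * (√n / (n : ℝ) ^ (s + 1)) := by
  obtain ⟨K, hK, hbound⟩ := exists_l2_sub_galerkin_le (s + 1)
  refine ⟨max 4 (1201 * K * 2 ^ (s + 1)), by positivity, fun F hF H hH n hn => ?_⟩
  have hH0 : 0 ≤ H := (l2_nonneg _).trans (hH 0 (Nat.zero_le _))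
  -- residuals are available for `2 ≤ n` only; for `n = 1` the interpolant is a constant
  rcases Nat.lt_or_ge n 2 with h2 | h2
  · obtain rfl : n = 1 := by omega
    have hd : (collocation (F 0) 1).natDegree = 0 := by
      have := natDegree_le_of_degree_le (collocation_degree_lt (F 0) 1).le
      by_contra hne
      have h1 : (collocation (F 0) 1).natDegree = 1 := by omega
      have h0 : collocation (F 0) 1 ≠ 0 := fun h => by simp [h] at h1
      have := (natDegree_lt_iff_degree_lt h0).2 (collocation_degree_lt (F 0) 1)
      omega
    obtain ⟨a, ha⟩ : (nodes 1).Nonempty := Finset.card_pos.1 (by rw [card_nodes]; norm_num)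
    have hadom : a ∈ dom := Set.Ioo_subset_Icc_self (legendre_root_mem (mem_nodes.1 ha))
    have hev : ∀ x, (collocation (F 0) 1).eval x = F 0 a := fun x => by
      rw [← collocation_eval (u := F 0) ha, eq_C_of_natDegree_eq_zero hd]; simp
    have hder : derivative (collocation (F 0) 1) = 0 := by
      rw [eq_C_of_natDegree_eq_zero hd]; simp
    have hH1 := hH 1 (by omega)
    have hle : 4 * H ≤
        max 4 (1201 * K * 2 ^ (s + 1)) * H * (√(1 : ℕ) / ((1 : ℕ) : ℝ) ^ (s + 1)) := by
      simp only [Nat.cast_one, Real.sqrt_one, one_pow, div_one, mul_one]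
      exact mul_le_mul_of_nonneg_right (le_max_left _ _) hH0
    constructor
    · refine le_trans ?_ hle
      simp only [hev]
      have := l2_le_of_bound (u := fun x => F 0 x - F 0 a) (c := 2 * H) (by positivity)
        fun x hx => ((hF.isPrim 0 (by omega)).abs_sub_le hadom hx).trans
          ((integral_abs_le_l2 (hF.memL2 1 (by omega))).trans (by linarith))
      linarith
    · refine le_trans ?_ hle
      simp only [hder, eval_zero, sub_zero]
      change l2 (F 1) ≤ _
      linarith
  · obtain ⟨m, rfl⟩ : ∃ m, n = m + 2 := ⟨n - 2, by omega⟩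
    obtain ⟨q, hqd, hq, hres⟩ := exists_isResidual hF m
    set v := fun x => F 0 x - q.eval x with hv
    set w := fun x => F 1 x - (galerkin (F 1) m).eval x with hw
    have hwle : l2 w ≤ K * H / ((m : ℝ) + 1) ^ (s + 1) :=
      hbound _ hF.tail H (fun j hj => hH (j + 1) (by omega)) m
    have hcont : ContinuousOn w dom :=
      (hF.isPrim 1 (by omega)).continuousOn.sub (galerkin (F 1) m).continuous.continuousOn
    obtain ⟨B, hB⟩ := isCompact_Icc.exists_bound_of_continuousOn hcont
    have hwt : L2 (fun x => √(1 - x ^ 2) * (v x / (1 - x ^ 2))) :=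
      L2.continuousOn_mul continuous_weight.continuousOn
        (.div_one_sub_sq hres.isPrim (B := B) hB hres.one hres.neg_one)
    obtain ⟨h1, h3⟩ := collocation_residual_le hres hwt
    have hqdeg : q.degree < (m + 2 : ℕ) := by
      refine (degree_le_natDegree).trans_lt ?_
      exact_mod_cast (by omega : q.natDegree < m + 2)
    have hcol : collocation (F 0) (m + 2) = collocation v (m + 2) + q := by
      rw [hv, collocation_sub_poly hqdeg]; ring
    set S := √((m + 2 : ℕ) : ℝ) with hS
    have hS1 : 1 ≤ S := Real.one_le_sqrt.2 (by
      push_cast; linarith [(Nat.cast_nonneg m : (0 : ℝ) ≤ m)])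
    have hfin : 1201 * (S * l2 w) ≤
        max 4 (1201 * K * 2 ^ (s + 1)) * H * (S / ((m + 2 : ℕ) : ℝ) ^ (s + 1)) := by
      have h6 : ((m + 2 : ℕ) : ℝ) ^ (s + 1) ≤ 2 ^ (s + 1) * ((m : ℝ) + 1) ^ (s + 1) := by
        rw [← mul_pow]
        refine pow_le_pow_left₀ (by positivity) ?_ _
        push_cast
        linarith [(Nat.cast_nonneg m : (0 : ℝ) ≤ m)]
      have h7 : K * H / ((m : ℝ) + 1) ^ (s + 1) ≤
          K * H * 2 ^ (s + 1) / ((m + 2 : ℕ) : ℝ) ^ (s + 1) := by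
        rw [div_le_div_iff₀ (by positivity) (by positivity)]
        calc K * H * ((m + 2 : ℕ) : ℝ) ^ (s + 1) ≤
            K * H * (2 ^ (s + 1) * ((m : ℝ) + 1) ^ (s + 1)) := by gcongr
          _ = _ := by ring
      calc 1201 * (S * l2 w) ≤
          1201 * (S * (K * H * 2 ^ (s + 1) / ((m + 2 : ℕ) : ℝ) ^ (s + 1))) := by
            gcongr
            exact hwle.trans h7
        _ = (1201 * K * 2 ^ (s + 1)) * H * (S / ((m + 2 : ℕ) : ℝ) ^ (s + 1)) := by ring
        _ ≤ _ := by
          gcongr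
          exact le_max_right _ _
    have hw0 := l2_nonneg w
    have hwS : l2 w ≤ S * l2 w := le_mul_of_one_le_left hw0 hS1
    constructor
    · refine le_trans ?_ hfin
      have e1 : (fun x => F 0 x - (collocation (F 0) (m + 2)).eval x) =
          fun x => v x - (collocation v (m + 2)).eval x := by
        funext x; rw [hcol, eval_add]; simp only [hv]; ring
      rw [e1]
      have t1 := l2_sub_le hres.isPrim.memL2 (L2.poly (collocation v (m + 2)))
      have t2 : l2 v ≤ l2 w := by
        refine hres.le.trans (mul_le_of_le_one_left hw0 ?_)
        rw [div_le_one (by positivity)]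
        linarith [(Nat.cast_nonneg m : (0 : ℝ) ≤ m)]
      linarith
    · refine le_trans ?_ hfin
      have e1 : (fun x => F 1 x - (derivative (collocation (F 0) (m + 2))).eval x) =
          fun x => w x - (derivative (collocation v (m + 2))).eval x := by
        funext x; rw [hcol, derivative_add, eval_add, hq]; simp only [hw]; ring
      rw [e1]
      have t1 := l2_sub_le hres.memL2 (L2.poly (derivative (collocation v (m + 2))))
      linarith

/-! ### Push-forward measures -/

/-- A `C¹` function pulls null sets back to null sets away from its critical points, by the
change of variables formula on small balls where it is injective. -/
theorem volume_preimage_inter_dom_eq_zero {f f1 : ℝ → ℝ} (hf : IsPrim f f1)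
    (hf1 : ContinuousOn f1 dom) (h0 : ∀ᵐ x ∂(volume.restrict dom), f1 x ≠ 0) {N : Set ℝ}
    (hNm : MeasurableSet N) (hN : volume N = 0) : volume.restrict dom (f ⁻¹' N) = 0 := by
  suffices h : volume ({x | x ∈ Set.Ioo (-1 : ℝ) 1 ∧ f1 x ≠ 0} ∩ f ⁻¹' N) = 0 by
    rw [Measure.restrict_apply' measurableSet_dom]
    have h1 := (ae_restrict_iff' measurableSet_dom).1 (ae_mem_Ioo_of_dom.and h0)
    refine measure_mono_null (fun x hx => ?_) (measure_union_null h (ae_iff.1 h1))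
    by_cases hc : x ∈ dom → x ∈ Set.Ioo (-1 : ℝ) 1 ∧ f1 x ≠ 0
    · exact Or.inl ⟨hc hx.2, hx.1⟩
    · exact Or.inr hc
  refine measure_null_of_locally_null _ fun x hx => ?_
  obtain ⟨⟨hx1, hx0⟩, -⟩ := hx
  have hdom : dom ∈ 𝓝 x := Icc_mem_nhds hx1.1 hx1.2
  have hev : ∀ᶠ y in 𝓝 x, y ∈ Set.Ioo (-1 : ℝ) 1 ∧ 0 < f1 x * f1 y := by
    have hc : ContinuousAt (fun y => f1 x * f1 y) x :=
      continuousAt_const.mul (hf1.continuousAt hdom)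
    exact (isOpen_Ioo.eventually_mem hx1).and (hc.eventually (lt_mem_nhds (mul_self_pos.2 hx0)))
  obtain ⟨δ, hδ, hball⟩ := Metric.eventually_nhds_iff_ball.1 hev
  have hsub : Metric.ball x δ ⊆ dom := fun y hy => Set.Ioo_subset_Icc_self (hball y hy).1
  have hder : ∀ y ∈ Metric.ball x δ, HasDerivAt f (f1 y) y := fun y hy =>
    (hf.hasDerivWithinAt hf1 (hsub hy)).hasDerivAt
      (Icc_mem_nhds (hball y hy).1.1 (hball y hy).1.2)
  have hinj : Set.InjOn f (Metric.ball x δ) := by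
    have hmono : StrictMonoOn (fun y => f1 x * f y) (Metric.ball x δ) := by
      refine strictMonoOn_of_deriv_pos (convex_ball x δ)
        (continuousOn_const.mul (hf.continuousOn.mono hsub)) fun y hy => ?_
      rw [interior_eq_iff_isOpen.2 Metric.isOpen_ball] at hy
      rw [((hder y hy).const_mul _).deriv]
      exact (hball y hy).2
    exact fun y hy z hz h => hmono.injOn hy hz (by simp only [h])
  set U := Metric.ball x δ ∩ f ⁻¹' N with hU
  have hUm : MeasurableSet U := by
    have h1 : Measurable ((Metric.ball x δ).domRestrict f) :=
      (continuousOn_iff_continuous_domRestrict.1 (hf.continuousOn.mono hsub)).measurable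
    have := Metric.isOpen_ball.measurableSet.subtype_image (h1 hNm)
    rwa [Set.domRestrict_eq, Set.preimage_comp, Subtype.image_preimage_coe] at this
  refine ⟨U, mem_nhdsWithin.2 ⟨Metric.ball x δ, Metric.isOpen_ball, Metric.mem_ball_self hδ,
    fun y hy => ⟨hy.1, hy.2.2⟩⟩, ?_⟩
  have h1 := lintegral_image_eq_lintegral_abs_deriv_mul hUm
    (fun y hy => (hder y hy.1).hasDerivWithinAt) (hinj.mono Set.inter_subset_left) fun _ => 1
  have h2 : volume (f '' U) = 0 :=
    measure_mono_null (Set.image_subset_iff.2 Set.inter_subset_right) hN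
  rw [Measure.restrict_eq_zero.2 h2, lintegral_zero_measure] at h1
  have hm : AEMeasurable (fun y => ENNReal.ofReal |f1 y| * 1) (volume.restrict U) := by
    refine AEMeasurable.mul_const ?_ _
    exact ((hf1.mono (Set.inter_subset_left.trans hsub)).abs.aemeasurable hUm).ennreal_ofReal
  have h3 := (ae_restrict_iff' hUm).1 ((lintegral_eq_zero_iff' hm).1 h1.symm)
  refine measure_mono_null (fun y hy => ?_) (ae_iff.1 h3)
  intro h4
  have h5 := h4 hy
  have h6 := (hball y hy.1).2
  simp only [mul_one, Pi.zero_apply, ENNReal.ofReal_eq_zero] at h5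
  rw [abs_nonpos_iff.1 h5, mul_zero] at h6
  exact h6.false

theorem aemeasurable_inputMeasure {f : ℝ → ℝ} (hf : ContinuousOn f dom) (r : ℝ → ℝ) :
    AEMeasurable f (inputMeasure r) :=
  (hf.aemeasurable measurableSet_dom).mono_ac (withDensity_absolutelyContinuous _ _)

theorem push_absolutelyContinuous {f f1 : ℝ → ℝ} (hf : IsPrim f f1)
    (hf1 : ContinuousOn f1 dom) (h0 : ∀ᵐ x ∂(volume.restrict dom), f1 x ≠ 0) (r : ℝ → ℝ) :
    push r f ≪ volume := by
  refine Measure.AbsolutelyContinuous.mk fun N hNm hN => ?_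
  rw [push, Measure.map_apply_of_aemeasurable (aemeasurable_inputMeasure hf.continuousOn r) hNm]
  exact withDensity_absolutelyContinuous _ _
    (volume_preimage_inter_dom_eq_zero hf hf1 h0 hNm hN)

theorem push_congr {f g : ℝ → ℝ} (h : Set.EqOn f g dom) (r : ℝ → ℝ) : push r f = push r g :=
  Measure.map_congr ((withDensity_absolutelyContinuous _ _).ae_eq
    ((ae_restrict_mem measurableSet_dom).mono fun _ hx => h hx))

theorem IsC1Density.integrable {r : ℝ → ℝ} (hr : IsC1Density r) :
    Integrable r (volume.restrict dom) :=
  hr.contDiffOn.continuousOn.integrableOn_compact isCompact_Icc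

theorem IsC1Density.isFiniteMeasure_push {r : ℝ → ℝ} (hr : IsC1Density r) (f : ℝ → ℝ) :
    IsFiniteMeasure (push r f) := by
  have : IsFiniteMeasure (inputMeasure r) :=
    isFiniteMeasure_withDensity_ofReal hr.integrable.2
  exact inferInstanceAs (IsFiniteMeasure ((inputMeasure r).map f))

theorem IsC1Density.integral_push {r f φ : ℝ → ℝ} (hr : IsC1Density r) (hf : ContinuousOn f dom)
    (hφ : Continuous φ) : ∫ y, φ y ∂(push r f) = ∫ x in dom, φ (f x) * r x := by
  rw [push, integral_map (aemeasurable_inputMeasure hf r) hφ.aestronglyMeasurable, inputMeasure,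
    integral_withDensity_eq_integral_toReal_smul₀ hr.integrable.1.aemeasurable.ennreal_ofReal
      (ae_of_all _ fun _ => ENNReal.ofReal_lt_top)]
  refine setIntegral_congr_fun measurableSet_dom fun x hx => ?_
  simp only [ENNReal.toReal_ofReal (hr.nonneg x hx), smul_eq_mul]
  ring

/-- The `L¹` distance of the densities is determined by continuous test functions, since the sign of
`p_μ - p_ν` can be approximated in `L¹(μ + ν)`. -/
theorem l1Dist_le {μ ν : Measure ℝ} [IsFiniteMeasure μ] [IsFiniteMeasure ν] (hμ : μ ≪ volume)
    (hν : ν ≪ volume) {B : ℝ} (h : ∀ φ : ℝ → ℝ, Continuous φ → (∀ y, |φ y| ≤ 1) →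
      ∫ y, φ y ∂μ - ∫ y, φ y ∂ν ≤ B) : l1Dist μ ν ≤ ENNReal.ofReal B := by
  have hp : Integrable (density μ) := Measure.integrable_toReal_rnDeriv
  have hq : Integrable (density ν) := Measure.integrable_toReal_rnDeriv
  have hpm : Measurable (density μ) := (Measure.measurable_rnDeriv μ volume).ennreal_toReal
  have hqm : Measurable (density ν) := (Measure.measurable_rnDeriv ν volume).ennreal_toReal
  have e0 := ofReal_integral_norm_eq_lintegral_enorm (hp.sub hq)
  simp only [Pi.sub_apply] at e0
  rw [l1Dist, eLpNorm_one_eq_lintegral_enorm, ← e0]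
  refine ENNReal.ofReal_le_ofReal ?_
  set s : ℝ → ℝ := fun y => if density ν y ≤ density μ y then 1 else -1 with hs
  have hsm : Measurable s :=
    Measurable.ite (measurableSet_le hqm hpm) measurable_const measurable_const
  have hs1 : ∀ y, |s y| ≤ 1 := fun y => by
    simp only [hs]; split_ifs <;> simp
  have hsi : ∀ (m : Measure ℝ) [IsFiniteMeasure m], Integrable s m := fun m _ =>
    Integrable.of_bound hsm.aestronglyMeasurable 1 (ae_of_all _ hs1)
  have e1 : ∀ (m : Measure ℝ) [IsFiniteMeasure m], m ≪ volume →
      ∫ y, density m y * s y = ∫ y, s y ∂m := fun m _ hm =>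
    integral_rnDeriv_smul (f := s) hm
  have hps : Integrable (fun y => density μ y * s y) :=
    hp.mul_bdd (c := 1) hsm.aestronglyMeasurable (ae_of_all _ hs1)
  have hqs : Integrable (fun y => density ν y * s y) :=
    hq.mul_bdd (c := 1) hsm.aestronglyMeasurable (ae_of_all _ hs1)
  have e2 : ∫ y, ‖density μ y - density ν y‖ = ∫ y, s y ∂μ - ∫ y, s y ∂ν := by
    rw [← e1 μ hμ, ← e1 ν hν, ← integral_sub hps hqs]
    refine integral_congr_ae (ae_of_all _ fun y => ?_)
    simp only [hs, Real.norm_eq_abs]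
    split_ifs with hc
    · rw [abs_of_nonneg (by linarith)]; ring
    · rw [abs_of_neg (by linarith [not_le.1 hc])]; ring
  rw [e2]
  refine le_of_forall_pos_le_add fun ε hε => ?_
  obtain ⟨ψ, hψ, -⟩ := ((memLp_one_iff_integrable).2
    (hsi (μ + ν))).exists_boundedContinuous_eLpNorm_sub_le ENNReal.one_ne_top
    (ENNReal.ofReal_pos.2 hε).ne'
  set φ : ℝ → ℝ := fun y => max (-1) (min 1 (ψ y)) with hφ
  have hφc : Continuous φ := by
    have := ψ.continuous
    fun_prop
  have hφ1 : ∀ y, |φ y| ≤ 1 := fun y =>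
    abs_le.2 ⟨le_max_left _ _, max_le (by norm_num) (min_le_left _ _)⟩
  have hφi : ∀ (m : Measure ℝ) [IsFiniteMeasure m], Integrable φ m := fun m _ =>
    Integrable.of_bound hφc.aestronglyMeasurable 1 (ae_of_all _ hφ1)
  have hle : ∀ y, |s y - φ y| ≤ |s y - ψ y| := fun y => by
    obtain ⟨a1, a2⟩ := abs_le.1 (hs1 y)
    simp only [hφ]
    have h1 : s y = max (-1) (min 1 (s y)) := by
      rw [min_eq_right a2, max_eq_right a1]
    nth_rewrite 1 [h1]
    exact (abs_max_sub_max_le_max _ _ _ _).trans (max_le (by simp)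
      ((abs_min_sub_min_le_max _ _ _ _).trans (max_le (by simp) le_rfl)))
  have hint : ∫ y, |s y - ψ y| ∂(μ + ν) ≤ ε := by
    have hi : Integrable (fun y => s y - ψ y) (μ + ν) := (hsi (μ + ν)).sub (ψ.integrable _)
    have h1 := ofReal_integral_norm_eq_lintegral_enorm hi
    rw [← eLpNorm_one_eq_lintegral_enorm] at h1
    have h2 := h1.trans_le hψ
    exact (ENNReal.ofReal_le_ofReal_iff hε.le).1 h2
  have hi2 : Integrable (fun y => |s y - φ y|) (μ + ν) := ((hsi _).sub (hφi _)).abs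
  have hint2 : ∫ y, |s y - φ y| ∂μ + ∫ y, |s y - φ y| ∂ν ≤ ε := by
    rw [← integral_add_measure (hi2.mono_measure (Measure.le_add_right le_rfl))
      (hi2.mono_measure (Measure.le_add_left le_rfl))]
    refine le_trans (integral_mono hi2 ?_ hle) hint
    exact ((hsi (μ + ν)).sub (ψ.integrable _)).abs
  have h3 : ∫ y, s y ∂μ - ∫ y, φ y ∂μ ≤ ∫ y, |s y - φ y| ∂μ := by
    rw [← integral_sub (hsi μ) (hφi μ)]
    exact (le_abs_self _).trans abs_integral_le_integral_abs
  have h4 : ∫ y, φ y ∂ν - ∫ y, s y ∂ν ≤ ∫ y, |s y - φ y| ∂ν := by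
    rw [← integral_sub (hφi ν) (hsi ν)]
    refine (le_abs_self _).trans (abs_integral_le_integral_abs.trans (le_of_eq ?_))
    simp only [abs_sub_comm]
  have := h φ hφc hφ1
  linarith

/-! ### The total variation estimate -/

/-- The duality estimate behind the comparison of the densities. The density `r` is split as
`r = (r - w f') + w f'` with `w = r f' / (f'² + e)`: the first summand is small where `f'` is
not, and the second one allows an integration by parts that turns the test function `φ` into its
Lipschitz primitive. -/
theorem test_difference_le {f f1 f2 r r1 g g1 φ : ℝ → ℝ} {M e η d : ℝ} (hf : IsPrim f f1)
    (hf1 : IsPrim f1 f2) (hf2 : ContinuousOn f2 dom) (hr : IsPrim r r1) (hr1 : ContinuousOn r1 dom)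
    (hg : IsPrim g g1) (hg1 : ContinuousOn g1 dom) (hr0 : ∀ x ∈ dom, 0 ≤ r x)
    (hM : ∀ x ∈ dom, |r x| ≤ M ∧ |r1 x| ≤ M ∧ |f1 x| ≤ M ∧ |f2 x| ≤ M)
    (he : 0 ≤ e) (hη : 0 < η) (hq : ∀ x ∈ dom, η ≤ f1 x ^ 2 + e)
    (hφ : Continuous φ) (hφ1 : ∀ y, |φ y| ≤ 1) (hd : ∀ x ∈ dom, |f x - g x| ≤ d) :
    (∫ x in dom, φ (f x) * r x) - ∫ x in dom, φ (g x) * r x ≤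
      2 * M * (∫ x in dom, e / (f1 x ^ 2 + e)) +
        M ^ 2 / η * (10 * d + ∫ x in dom, |f1 x - g1 x|) := by
  have hM0 : 0 ≤ M := (abs_nonneg _).trans (hM 1 one_mem_dom).1
  have hd0 : 0 ≤ d := (abs_nonneg _).trans (hd 1 one_mem_dom)
  set q : ℝ → ℝ := fun x => f1 x ^ 2 + e with hqdef
  have hqpos : ∀ x ∈ dom, 0 < q x := fun x hx => hη.trans_le (hq x hx)
  set w : ℝ → ℝ := fun x => r x * f1 x / q x with hw
  set w1 : ℝ → ℝ := fun x => r1 x * f1 x / q x + r x * f2 x / q x -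
    2 * (r x * f2 x / q x * (f1 x ^ 2 / q x)) with hw1
  have cf := hf.continuousOn
  have cf1 := hf1.continuousOn
  have cr := hr.continuousOn
  have cg := hg.continuousOn
  have cq : ContinuousOn q dom := (cf1.pow 2).add continuousOn_const
  have hq0 : ∀ x ∈ dom, q x ≠ 0 := fun x hx => (hqpos x hx).ne'
  have cw : ContinuousOn w dom := (cr.mul cf1).div cq hq0
  have cw1 : ContinuousOn w1 dom :=
    (((hr1.mul cf1).div cq hq0).add ((cr.mul hf2).div cq hq0)).sub
      (continuousOn_const.mul (((cr.mul hf2).div cq hq0).mul ((cf1.pow 2).div cq hq0)))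
  have hwP : IsPrim w w1 := by
    refine .of_hasDerivWithinAt cw1 fun x hx => ?_
    have h1 := hr.hasDerivWithinAt hr1 hx
    have h2 := hf1.hasDerivWithinAt hf2 hx
    have h3 : HasDerivWithinAt w _ dom x := (h1.mul h2).div ((h2.pow 2).add_const e) (hq0 x hx)
    refine h3.congr_deriv ?_
    have := hq0 x hx
    simp only [hw1, hqdef, Pi.mul_apply] at this ⊢
    field_simp
    ring
  have hdiv : ∀ x ∈ dom, ∀ {a b : ℝ}, |a| ≤ M → |b| ≤ M → |a * b / q x| ≤ M ^ 2 / η := by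
    intro x hx a b ha hb
    rw [abs_div, abs_mul, abs_of_pos (hqpos x hx), pow_two]
    exact div_le_div₀ (by positivity) (mul_le_mul ha hb (abs_nonneg _) hM0) hη (hq x hx)
  have hwb : ∀ x ∈ dom, |w x| ≤ M ^ 2 / η := fun x hx =>
    hdiv x hx (hM x hx).1 (hM x hx).2.2.1
  have hw1b : ∀ x ∈ dom, |w1 x| ≤ 4 * (M ^ 2 / η) := fun x hx => by
    obtain ⟨m1, m2, m3, m4⟩ := hM x hx
    have a1 := hdiv x hx m2 m3
    have a2 := hdiv x hx m1 m4
    have a3 : |f1 x ^ 2 / q x| ≤ 1 := by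
      rw [abs_of_nonneg (div_nonneg (sq_nonneg _) (hqpos x hx).le), div_le_one (hqpos x hx)]
      simp only [hqdef]; linarith
    have a4 : |r x * f2 x / q x * (f1 x ^ 2 / q x)| ≤ M ^ 2 / η := by
      rw [abs_mul]
      exact (mul_le_of_le_one_right (abs_nonneg _) a3).trans a2
    rw [abs_le] at a1 a2 a4 ⊢
    simp only [hw1]
    constructor <;> linarith [a1.1, a1.2, a2.1, a2.2, a4.1, a4.2]
  -- the primitive of the test function
  set Φ : ℝ → ℝ := fun y => ∫ t in (0 : ℝ)..y, φ t with hΦ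
  have hΦd : ∀ y, HasDerivAt Φ (φ y) y := fun y => (hφ.integral_hasStrictDerivAt 0 y).hasDerivAt
  set D : ℝ → ℝ := fun x => Φ (f x) - Φ (g x) with hD
  set D1 : ℝ → ℝ := fun x => φ (f x) * f1 x - φ (g x) * g1 x with hD1
  have cφf : ContinuousOn (fun x => φ (f x)) dom := hφ.comp_continuousOn cf
  have cφg : ContinuousOn (fun x => φ (g x)) dom := hφ.comp_continuousOn cg
  have cD1 : ContinuousOn D1 dom := (cφf.mul cf1).sub (cφg.mul hg1)
  have hDP : IsPrim D D1 := .of_hasDerivWithinAt cD1 fun x hx =>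
    ((hΦd (f x)).comp_hasDerivWithinAt x (hf.hasDerivWithinAt cf1 hx)).sub
      ((hΦd (g x)).comp_hasDerivWithinAt x (hg.hasDerivWithinAt hg1 hx))
  have hDb : ∀ x ∈ dom, |D x| ≤ d := fun x hx => by
    have h1 : D x = ∫ t in g x..f x, φ t := by
      simp only [hD, hΦ]
      exact intervalIntegral.integral_interval_sub_left (hφ.intervalIntegrable _ _)
        (hφ.intervalIntegrable _ _)
    have h2 := intervalIntegral.norm_integral_le_of_norm_le_const (a := g x) (b := f x) (f := φ)
      (C := 1) fun y _ => hφ1 y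
    rw [h1]
    rw [one_mul] at h2
    exact h2.trans (hd x hx)
  have hIBP : ∫ x in dom, D1 x * w x ≤ 10 * d * (M ^ 2 / η) := by
    have h1 := hDP.integral_mul hwP
    have h2 : |∫ x in dom, D x * w1 x| ≤ d * (4 * (M ^ 2 / η)) * volume.real dom :=
      norm_setIntegral_le_of_norm_le_const (C := d * (4 * (M ^ 2 / η)))
        isCompact_Icc.measure_lt_top fun x hx => by
          rw [Real.norm_eq_abs, abs_mul]
          exact mul_le_mul (hDb x hx) (hw1b x hx) (abs_nonneg _) hd0
    have h3 : ∀ x ∈ dom, |D x * w x| ≤ d * (M ^ 2 / η) := fun x hx => by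
      rw [abs_mul]
      exact mul_le_mul (hDb x hx) (hwb x hx) (abs_nonneg _) hd0
    have h4 := (abs_le.1 (h3 1 one_mem_dom)).2
    have h5 := (abs_le.1 (h3 (-1) neg_one_mem_dom)).1
    rw [volume_dom] at h2
    have h6 := (abs_le.1 h2).1
    linarith
  have hi : ∀ {u : ℝ → ℝ}, ContinuousOn u dom → IntegrableOn u dom := fun hu =>
    hu.integrableOn_compact isCompact_Icc
  have ie : IntegrableOn (fun x => e / q x) dom := hi (continuousOn_const.div cq hq0)
  have iD : IntegrableOn (fun x => D1 x * w x) dom := hi (cD1.mul cw)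
  have ig : IntegrableOn (fun x => |f1 x - g1 x|) dom := hi (cf1.sub hg1).abs
  have hpt : ∀ x ∈ dom, φ (f x) * r x - φ (g x) * r x ≤
      2 * M * (e / q x) + D1 x * w x + M ^ 2 / η * |f1 x - g1 x| := fun x hx => by
    have h0 : r x - w x * f1 x = r x * (e / q x) := by
      have := hq0 x hx
      simp only [hw, hqdef] at this ⊢
      field_simp
      ring
    have h1 : φ (f x) * r x - φ (g x) * r x = (φ (f x) - φ (g x)) * (r x - w x * f1 x) +
        D1 x * w x + φ (g x) * (g1 x - f1 x) * w x := by
      simp only [hD1]; ring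
    have h2 : (φ (f x) - φ (g x)) * (r x * (e / q x)) ≤ 2 * M * (e / q x) := by
      have b1 := (abs_le.1 (hφ1 (f x))).2
      have b2 := (abs_le.1 (hφ1 (g x))).1
      have b3 : 0 ≤ e / q x := div_nonneg he (hqpos x hx).le
      have b4 := (le_abs_self _).trans (hM x hx).1
      rw [← mul_assoc]
      refine mul_le_mul_of_nonneg_right ?_ b3
      have b5 := hr0 x hx
      nlinarith
    have h3 : φ (g x) * (g1 x - f1 x) * w x ≤ M ^ 2 / η * |f1 x - g1 x| := by
      refine (le_abs_self _).trans ?_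
      rw [abs_mul, abs_mul, abs_sub_comm, mul_comm]
      refine mul_le_mul (hwb x hx) (mul_le_of_le_one_left (abs_nonneg _) (hφ1 _)) (by positivity)
        (by positivity)
    rw [h1, h0]
    linarith
  have if1 : IntegrableOn (fun x => φ (f x) * r x) dom := hi (cφf.mul cr)
  have ig1 : IntegrableOn (fun x => φ (g x) * r x) dom := hi (cφg.mul cr)
  rw [← integral_sub if1 ig1]
  refine (setIntegral_mono_on (if1.sub ig1)
    (((ie.const_mul _).add iD).add (ig.const_mul _)) measurableSet_dom hpt).trans ?_
  have s1 := integral_add ((ie.const_mul (2 * M)).add iD) (ig.const_mul (M ^ 2 / η))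
  have s2 := integral_add (ie.const_mul (2 * M)) iD
  simp only [Pi.add_apply] at s1 ⊢
  rw [s1, s2, integral_const_mul, integral_const_mul]
  linarith

theorem integral_dom_inv_one_add_div_sq_le (a : ℝ) {δ : ℝ} (hδ : 0 < δ) :
    ∫ x in dom, (1 + ((x - a) / δ) ^ 2)⁻¹ ≤ Real.pi * δ := by
  rw [integral_dom, intervalIntegral.integral_comp_sub_right (fun x => (1 + (x / δ) ^ 2)⁻¹),
    intervalIntegral.integral_comp_div (fun x => (1 + x ^ 2)⁻¹) hδ.ne', integral_inv_one_add_sq,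
    smul_eq_mul, mul_comm]
  refine mul_le_mul_of_nonneg_right ?_ hδ.le
  linarith [Real.arctan_lt_pi_div_two ((1 - a) / δ), Real.neg_pi_div_two_lt_arctan ((-1 - a) / δ)]

/-- The lower bound `c |x - a|^k` on `|f'|` near each critical point `a` controls the set where
`f'` is small. -/
theorem integral_dom_div_sq_add_le {f1 : ℝ → ℝ} {Z : Finset ℝ} {k : ℕ} {c δ : ℝ}
    (hf1 : ContinuousOn f1 dom) (hc : 0 < c) (hk : 1 ≤ k) (hδ : 0 < δ)
    (hlow : ∀ x ∈ dom, c ≤ |f1 x| ∨ ∃ a ∈ Z, c * |x - a| ^ k ≤ |f1 x|) :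
    ∫ x in dom, (c * δ ^ k) ^ 2 / (f1 x ^ 2 + (c * δ ^ k) ^ 2) ≤
      (2 + 2 * Real.pi * Z.card) * δ := by
  have hi : ∀ {u : ℝ → ℝ}, ContinuousOn u dom → IntegrableOn u dom := fun hu =>
    hu.integrableOn_compact isCompact_Icc
  have hpos : ∀ t : ℝ, 0 < 1 + t ^ 2 := fun t => by positivity
  have he : 0 < (c * δ ^ k) ^ 2 := by positivity
  have hcont : ∀ a : ℝ, Continuous fun x : ℝ => (1 + ((x - a) / δ) ^ 2)⁻¹ := fun a =>
    Continuous.inv₀ (by fun_prop) fun x => (hpos _).ne'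
  have hic : ∀ a, IntegrableOn (fun x => 2 * (1 + ((x - a) / δ) ^ 2)⁻¹) dom := fun a =>
    hi (continuous_const.mul (hcont a)).continuousOn
  have hpt : ∀ x ∈ dom, (c * δ ^ k) ^ 2 / (f1 x ^ 2 + (c * δ ^ k) ^ 2) ≤
      δ + ∑ a ∈ Z, 2 * (1 + ((x - a) / δ) ^ 2)⁻¹ := fun x hx => by
    have hterm : ∀ a ∈ Z, 0 ≤ 2 * (1 + ((x - a) / δ) ^ 2)⁻¹ := fun a _ => by
      have := hpos ((x - a) / δ); positivity
    rcases hlow x hx with h | ⟨a, ha, h⟩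
    · have h1 : (c * δ ^ k) ^ 2 / (f1 x ^ 2 + (c * δ ^ k) ^ 2) ≤ δ := by
        have h2 : c ^ 2 ≤ f1 x ^ 2 := by
          rw [← sq_abs (f1 x)]; gcongr
        rw [div_le_iff₀ (by positivity)]
        rcases le_total 1 δ with h3 | h3
        · nlinarith [sq_nonneg (f1 x)]
        · have h4 : δ ^ k ≤ δ := pow_le_of_le_one hδ.le h3 (by omega)
          have h5 : (δ ^ k) ^ 2 ≤ δ := by
            have : δ ^ k ≤ 1 := h4.trans h3
            nlinarith [pow_pos hδ k]
          have h6 : (c * δ ^ k) ^ 2 ≤ δ * c ^ 2 := by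
            rw [mul_pow]; nlinarith [sq_nonneg c]
          nlinarith
      linarith [Finset.sum_nonneg hterm]
    · have h1 : (c * δ ^ k) ^ 2 / (f1 x ^ 2 + (c * δ ^ k) ^ 2) ≤
          2 * (1 + ((x - a) / δ) ^ 2)⁻¹ := by
        set y := (x - a) / δ with hy
        have h2 : (c * δ ^ k) ^ 2 * (y ^ 2) ^ k ≤ f1 x ^ 2 := by
          have e1 : (c * δ ^ k) ^ 2 * (y ^ 2) ^ k = (c * |x - a| ^ k) ^ 2 := by
            have e2 : |x - a| ^ 2 = δ ^ 2 * y ^ 2 := by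
              rw [sq_abs, hy]; field_simp
            calc (c * δ ^ k) ^ 2 * (y ^ 2) ^ k = c ^ 2 * (δ ^ 2 * y ^ 2) ^ k := by
                  rw [mul_pow, mul_pow (δ ^ 2), ← pow_mul δ, ← pow_mul δ, mul_comm 2 k]; ring
              _ = (c * |x - a| ^ k) ^ 2 := by rw [← e2, mul_pow, ← pow_mul, ← pow_mul, mul_comm 2 k]
          rw [e1, ← sq_abs (f1 x)]
          gcongr
        have h3 : 1 + y ^ 2 ≤ 2 * (1 + (y ^ 2) ^ k) := by
          rcases le_total 1 (y ^ 2) with h4 | h4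
          · have := le_self_pow₀ h4 (by omega : k ≠ 0)
            linarith
          · have : 0 ≤ (y ^ 2) ^ k := by positivity
            linarith
        rw [← div_eq_mul_inv, div_le_div_iff₀ (by positivity) (hpos y)]
        nlinarith
      have h2 := Finset.single_le_sum hterm ha
      linarith
  have ic : IntegrableOn (fun _ : ℝ => δ) dom := hi continuousOn_const
  have is : IntegrableOn (fun x => ∑ a ∈ Z, 2 * (1 + ((x - a) / δ) ^ 2)⁻¹) dom :=
    integrable_finsetSum _ fun a _ => hic a
  have il : IntegrableOn (fun x => (c * δ ^ k) ^ 2 / (f1 x ^ 2 + (c * δ ^ k) ^ 2)) dom :=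
    hi (continuousOn_const.div ((hf1.pow 2).add continuousOn_const) fun x _ => by positivity)
  refine (setIntegral_mono_on il (ic.add is) measurableSet_dom hpt).trans ?_
  have s1 := integral_add ic is
  simp only [Pi.add_apply] at s1 ⊢
  rw [s1, integral_finsetSum _ fun a _ => hic a, setIntegral_const, volume_dom, smul_eq_mul]
  have h2 : ∑ a ∈ Z, ∫ x in dom, 2 * (1 + ((x - a) / δ) ^ 2)⁻¹ ≤ ∑ _a ∈ Z, 2 * (Real.pi * δ) :=
    Finset.sum_le_sum fun a _ => by
      rw [integral_const_mul]
      linarith [integral_dom_inv_one_add_div_sq_le a hδ]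
  rw [Finset.sum_const, nsmul_eq_mul] at h2
  linarith

theorem IsC1Density.exists_isPrim {r : ℝ → ℝ} (hr : IsC1Density r) :
    ∃ r1, IsPrim r r1 ∧ ContinuousOn r1 dom := by
  have hu : UniqueDiffOn ℝ dom := uniqueDiffOn_Icc (by norm_num)
  have hc := hr.contDiffOn.continuousOn_derivWithin hu le_rfl
  exact ⟨_, .of_hasDerivWithinAt hc fun x hx =>
    (hr.contDiffOn.differentiableOn one_ne_zero x hx).hasDerivWithinAt, hc⟩

/-- The `L¹` distance of the densities of `f_* ϱ` and `g_* ϱ` is of the order of the `H¹`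
distance `h` of `f` and `g` to the power `1 / (2k + 1)`, where `k` is the maximal order of
vanishing of `f'`. The duality estimate with `e = (c δ^k)²` yields the bound `δ + h / δ^(2k)`,
and `δ = h^(1 / (2k + 1))` balances the two terms. -/
theorem exists_l1Dist_push_le {f f1 f2 r : ℝ → ℝ} {Z : Finset ℝ} {k : ℕ} {c : ℝ}
    (hf : IsPrim f f1) (hf1 : IsPrim f1 f2) (hf2 : ContinuousOn f2 dom) (hr : IsC1Density r)
    (hc : 0 < c) (hlow : ∀ x ∈ dom, c ≤ |f1 x| ∨ ∃ a ∈ Z, c * |x - a| ^ k ≤ |f1 x|)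
    (hac : push r f ≪ volume) :
    ∃ C : ℝ, 0 < C ∧ ∀ g g1 : ℝ → ℝ, IsPrim g g1 → ContinuousOn g1 dom → push r g ≪ volume →
      l1Dist (push r f) (push r g) ≤ ENNReal.ofReal
        (C * √(l2 (fun x => f x - g x) ^ 2 + l2 (fun x => f1 x - g1 x) ^ 2) ^
          (1 / (2 * (k : ℝ) + 1))) := by
  obtain ⟨r1, hrP, hr1⟩ := hr.exists_isPrim
  obtain ⟨M, hM0, hM⟩ : ∃ M : ℝ, 0 ≤ M ∧
      ∀ x ∈ dom, |r x| ≤ M ∧ |r1 x| ≤ M ∧ |f1 x| ≤ M ∧ |f2 x| ≤ M := by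
    obtain ⟨M1, h1⟩ := isCompact_Icc.exists_bound_of_continuousOn hrP.continuousOn
    obtain ⟨M2, h2⟩ := isCompact_Icc.exists_bound_of_continuousOn hr1
    obtain ⟨M3, h3⟩ := isCompact_Icc.exists_bound_of_continuousOn hf1.continuousOn
    obtain ⟨M4, h4⟩ := isCompact_Icc.exists_bound_of_continuousOn hf2
    have p1 := (norm_nonneg _).trans (h1 1 one_mem_dom)
    have p2 := (norm_nonneg _).trans (h2 1 one_mem_dom)
    have p3 := (norm_nonneg _).trans (h3 1 one_mem_dom)
    have p4 := (norm_nonneg _).trans (h4 1 one_mem_dom)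
    refine ⟨M1 + M2 + M3 + M4, by positivity, fun x hx => ?_⟩
    have q1 := h1 x hx
    have q2 := h2 x hx
    have q3 := h3 x hx
    have q4 := h4 x hx
    rw [Real.norm_eq_abs] at q1 q2 q3 q4
    refine ⟨?_, ?_, ?_, ?_⟩ <;> linarith
  set A := 2 * M * (2 + 2 * Real.pi * Z.card) with hA
  set B := 32 * (M ^ 2 / c ^ 2) with hB
  have hA0 : 0 ≤ A := by have := Real.pi_pos; positivity
  have hB0 : 0 ≤ B := by positivity
  refine ⟨A + B + 1, by positivity, fun g g1 hg hg1 hgac => ?_⟩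
  set h := √(l2 (fun x => f x - g x) ^ 2 + l2 (fun x => f1 x - g1 x) ^ 2) with hh
  have hh0 : 0 ≤ h := Real.sqrt_nonneg _
  have ha : l2 (fun x => f x - g x) ≤ h :=
    Real.le_sqrt_of_sq_le (by nlinarith [sq_nonneg (l2 (fun x => f1 x - g1 x))])
  have hb : l2 (fun x => f1 x - g1 x) ≤ h :=
    Real.le_sqrt_of_sq_le (by nlinarith [sq_nonneg (l2 (fun x => f x - g x))])
  have hL2 : L2 (fun x => f1 x - g1 x) := L2.of_continuousOn (hf1.continuousOn.sub hg1)
  have hd : ∀ x ∈ dom, |f x - g x| ≤ 3 * h := fun x hx => by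
    have := (hf.sub hg).abs_le hL2 hx
    linarith
  have hd1 : ∫ x in dom, |f1 x - g1 x| ≤ 2 * h := (integral_abs_le_l2 hL2).trans (by linarith)
  have key : ∀ φ : ℝ → ℝ, Continuous φ → (∀ y, |φ y| ≤ 1) → ∀ δ : ℝ, 0 < δ →
      (∫ x in dom, φ (f x) * r x) - ∫ x in dom, φ (g x) * r x ≤ A * δ + B * (h / δ ^ (2 * k)) := by
    intro φ hφ hφ1 δ hδ
    -- without critical points no regularization is needed: `e = 0`
    rcases Nat.eq_zero_or_pos k with rfl | hk
    · have hq : ∀ x ∈ dom, c ^ 2 ≤ f1 x ^ 2 + 0 := fun x hx => by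
        have : c ≤ |f1 x| := by
          rcases hlow x hx with h1 | ⟨a, -, h1⟩
          · exact h1
          · simpa using h1
        rw [add_zero, ← sq_abs (f1 x)]
        gcongr
      have t := test_difference_le hf hf1 hf2 hrP hr1 hg hg1 hr.nonneg hM le_rfl
        (by positivity : 0 < c ^ 2) hq hφ hφ1 hd
      simp only [zero_div, integral_zero, mul_zero, zero_add] at t
      have t2 : M ^ 2 / c ^ 2 * (10 * (3 * h) + ∫ x in dom, |f1 x - g1 x|) ≤ B * h := by
        rw [hB, show 32 * (M ^ 2 / c ^ 2) * h = M ^ 2 / c ^ 2 * (10 * (3 * h) + 2 * h) by ring]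
        gcongr
      have t3 : 0 ≤ A * δ := by positivity
      simp only [mul_zero, pow_zero, div_one]
      linarith
    · have hq : ∀ x ∈ dom, (c * δ ^ k) ^ 2 ≤ f1 x ^ 2 + (c * δ ^ k) ^ 2 := fun x _ => by
        linarith [sq_nonneg (f1 x)]
      have t := test_difference_le hf hf1 hf2 hrP hr1 hg hg1 hr.nonneg hM
        (sq_nonneg (c * δ ^ k)) (by positivity : 0 < (c * δ ^ k) ^ 2) hq hφ hφ1 hd
      have t1 := mul_le_mul_of_nonneg_left
        (integral_dom_div_sq_add_le hf1.continuousOn hc hk hδ hlow) (by positivity : 0 ≤ 2 * M)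
      have t2 : M ^ 2 / (c * δ ^ k) ^ 2 * (10 * (3 * h) + ∫ x in dom, |f1 x - g1 x|) ≤
          B * (h / δ ^ (2 * k)) := by
        have e1 : B * (h / δ ^ (2 * k)) = M ^ 2 / (c * δ ^ k) ^ 2 * (10 * (3 * h) + 2 * h) := by
          rw [hB, mul_pow, ← pow_mul, mul_comm k 2]
          field_simp
          ring
        rw [e1]
        gcongr
      linarith
  have := hr.isFiniteMeasure_push f
  have := hr.isFiniteMeasure_push g
  refine l1Dist_le hac hgac fun φ hφ hφ1 => ?_
  rw [hr.integral_push hf.continuousOn hφ, hr.integral_push hg.continuousOn hφ]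
  have hexp : (0 : ℝ) < 1 / (2 * (k : ℝ) + 1) := by positivity
  -- for `h = 0` the choice of `δ` degenerates, and `δ` tends to `0` instead
  rcases hh0.eq_or_lt with h0 | hpos
  · rw [← h0, Real.zero_rpow hexp.ne', mul_zero]
    refine le_of_forall_pos_le_add fun ε hε => ?_
    have t := key φ hφ hφ1 (ε / (A + 1)) (by positivity)
    rw [← h0, zero_div, mul_zero, add_zero] at t
    have t2 : A * (ε / (A + 1)) ≤ ε := by
      rw [← mul_div_assoc, div_le_iff₀ (by positivity)]
      nlinarith
    linarith
  · set δ := h ^ (1 / (2 * (k : ℝ) + 1)) with hδ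
    have hδ0 : 0 < δ := Real.rpow_pos_of_pos hpos _
    have e1 : δ ^ (2 * k + 1) = h := by
      rw [hδ, ← Real.rpow_natCast, ← Real.rpow_mul hh0]
      push_cast
      rw [one_div_mul_cancel (by positivity), Real.rpow_one]
    have e2 : h / δ ^ (2 * k) = δ := by
      rw [← e1, pow_succ]; field_simp
    have t := key φ hφ hφ1 δ hδ0
    rw [e2] at t
    linarith

/-! ### Convergence of the densities -/

theorem approx_congr {f g : ℝ → ℝ} (h : Set.EqOn f g dom) (t : Kind) (n : ℕ) :
    approx t f n = approx t g n := by
  cases t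
  · exact galerkin_congr h n
  · exact collocation_congr h n

theorem IsChain.hNorm_one_sub {s : ℕ} {F : ℕ → ℝ → ℝ} (hF : IsChain s F) (hs : 1 ≤ s) {f : ℝ → ℝ}
    (hf : Set.EqOn f (F 0) dom) (p : ℝ[X]) :
    hNorm 1 (f - fun x => p.eval x) = √(l2 (fun x => F 0 x - p.eval x) ^ 2 +
      l2 (fun x => F 1 x - (derivative p).eval x) ^ 2) := by
  have hchain : IsChain 1 fun j x => F j x - (derivative^[j] p).eval x := by
    refine ⟨fun j hj => ?_, fun j hj => (hF.memL2 j (by omega)).sub (L2.poly _)⟩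
    rw [Function.iterate_succ_apply']
    exact (hF.isPrim j (by omega)).sub (.poly _)
  rw [hchain.hNorm_eq (u := f - fun x => p.eval x) ((ae_restrict_mem measurableSet_dom).mono
    fun x hx => by simp [hf hx]), Finset.sum_range_succ, Finset.sum_range_one]
  simp

/-- The error of both approximations in `H¹`, at the common rate `n ^ (3/2 - s)` in `H^s`. -/
theorem exists_hNorm_sub_approxFun_le (s : ℕ) : ∃ K : ℝ, 0 < K ∧ ∀ (t : Kind) (F : ℕ → ℝ → ℝ),
    IsChain (s + 2) F → ∀ f : ℝ → ℝ, Set.EqOn f (F 0) dom → ∀ n : ℕ, 1 ≤ n →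
    hNorm 1 (f - approxFun t f n) ≤
      K * (hNorm (s + 2) f * (n : ℝ) ^ ((3 : ℝ) / 2 - ((s + 2 : ℕ) : ℝ))) := by
  obtain ⟨K1, hK1, h1⟩ := exists_galerkin_error s
  obtain ⟨K2, hK2, h2⟩ := exists_collocation_error s
  refine ⟨2 * (K1 + K2), by positivity, fun t F hF f hf n hn => ?_⟩
  have hn0 : (0 : ℝ) < n := by exact_mod_cast hn
  have hae : f =ᵐ[volume.restrict dom] F 0 :=
    (ae_restrict_mem measurableSet_dom).mono fun x hx => hf hx
  have hH : ∀ j ≤ s + 2, l2 (F j) ≤ hNorm (s + 2) f := fun j hj => hF.l2_le_hNorm hae hj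
  have hH0 : 0 ≤ hNorm (s + 2) f := (l2_nonneg _).trans (hH 0 (Nat.zero_le _))
  have hrate : √(n : ℝ) / (n : ℝ) ^ (s + 1) = (n : ℝ) ^ ((3 : ℝ) / 2 - ((s + 2 : ℕ) : ℝ)) := by
    rw [Real.sqrt_eq_rpow, ← Real.rpow_natCast, ← Real.rpow_sub hn0]
    congr 1
    push_cast
    ring
  set R := √(n : ℝ) / (n : ℝ) ^ (s + 1) with hR
  have hR0 : 0 ≤ R := by positivity
  have key : l2 (fun x => F 0 x - (approx t f n).eval x) ≤ (K1 + K2) * (hNorm (s + 2) f * R) ∧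
      l2 (fun x => F 1 x - (derivative (approx t f n)).eval x) ≤
        (K1 + K2) * (hNorm (s + 2) f * R) := by
    rw [approx_congr hf]
    have hHR : 0 ≤ hNorm (s + 2) f * R := mul_nonneg hH0 hR0
    have m1 : K1 * hNorm (s + 2) f * R ≤ (K1 + K2) * (hNorm (s + 2) f * R) := by nlinarith
    have m2 : K2 * hNorm (s + 2) f * R ≤ (K1 + K2) * (hNorm (s + 2) f * R) := by nlinarith
    cases t
    · exact ⟨(h1 F hF _ hH n hn).1.trans m1, (h1 F hF _ hH n hn).2.trans m1⟩
    · exact ⟨(h2 F hF _ hH n hn).1.trans m2, (h2 F hF _ hH n hn).2.trans m2⟩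
  rw [← hrate]
  change hNorm 1 (f - fun x => (approx t f n).eval x) ≤ _
  rw [hF.hNorm_one_sub (by omega) hf]
  refine (Real.sqrt_le_left (by positivity)).2 ?_
  have a1 := l2_nonneg (fun x => F 0 x - (approx t f n).eval x)
  have a2 := l2_nonneg (fun x => F 1 x - (derivative (approx t f n)).eval x)
  nlinarith [key.1, key.2]

theorem ae_eval_ne_zero {p : ℝ[X]} (hp : p ≠ 0) :
    ∀ᵐ x ∂(volume.restrict dom), p.eval x ≠ 0 := by
  refine ae_restrict_of_ae (measure_mono_null (fun x hx => ?_)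
    (p.roots.toFinset.finite_toSet.measure_zero volume))
  simpa [hp] using hx

/-- Convergence of the densities of the push-forwards, given a lower bound for `|f'|` in terms of
the distance to a finite set `Z`. The push-forward by `g_n` is absolutely continuous as soon as
`g_n` is not constant, and this is the case eventually because `f'` is not zero in `L²`. -/
theorem push_approxFun {s : ℕ} {F : ℕ → ℝ → ℝ} (hF : IsChain (s + 3) F) {f r : ℝ → ℝ}
    (hf : Set.EqOn f (F 0) dom) (hr : IsC1Density r) {Z : Finset ℝ} {k : ℕ} {c : ℝ} (hc : 0 < c)
    (hlow : ∀ x ∈ dom, c ≤ |F 1 x| ∨ ∃ a ∈ Z, c * |x - a| ^ k ≤ |F 1 x|) (t : Kind) :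
    push r f ≪ volume ∧ (∀ᶠ n : ℕ in atTop, push r (approxFun t f n) ≪ volume) ∧
      ∃ C : ℝ, 0 < C ∧ ∀ n : ℕ, push r (approxFun t f n) ≪ volume →
        l1Dist (push r f) (push r (approxFun t f n)) ≤ ENNReal.ofReal
          (C * hNorm 1 (f - approxFun t f n) ^ (1 / (2 * (k : ℝ) + 1))) := by
  have p0 := hF.isPrim 0 (by omega)
  have p1 := hF.isPrim 1 (by omega)
  have p2 := hF.isPrim 2 (by omega)
  rw [zero_add] at p0
  have hne : ∀ᵐ x ∂(volume.restrict dom), F 1 x ≠ 0 := by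
    refine (ae_restrict_iff' measurableSet_dom).2
      (measure_mono_null (fun x hx => ?_) (Z.finite_toSet.measure_zero volume))
    simp only [Set.mem_compl_iff, Set.mem_ofPred_eq, Classical.not_imp, not_not] at hx
    obtain ⟨hx, h0⟩ := hx
    rcases hlow x hx with h | ⟨a, ha, h⟩
    · rw [h0, abs_zero] at h; linarith
    · rw [h0, abs_zero] at h
      have h1 : |x - a| ^ k = 0 :=
        le_antisymm (le_of_mul_le_mul_left (by rwa [mul_zero]) hc) (by positivity)
      rw [sub_eq_zero.1 (abs_eq_zero.1 (eq_zero_of_pow_eq_zero h1))]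
      exact ha
  have hac : push r (F 0) ≪ volume := push_absolutelyContinuous p0 p1.continuousOn hne r
  rw [push_congr hf]
  have hnorm : ∀ n, hNorm 1 (f - approxFun t f n) =
      √(l2 (fun x => F 0 x - (approx t f n).eval x) ^ 2 +
        l2 (fun x => F 1 x - (derivative (approx t f n)).eval x) ^ 2) := fun n =>
    hF.hNorm_one_sub (by omega) hf _
  refine ⟨hac, ?_, ?_⟩
  · have hpos : 0 < l2 (F 1) := by
      refine (l2_nonneg _).lt_of_ne fun h0 => ?_
      have h1 := sq_l2 (F 1)
      rw [← h0, zero_pow two_ne_zero, eq_comm, integral_eq_zero_iff_of_nonneg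
        (fun x => sq_nonneg _) p1.memL2.sq] at h1
      have h2 : ∀ᵐ _x ∂(volume.restrict dom), False := by
        filter_upwards [h1, hne] with x h3 h4
        exact h4 (pow_eq_zero_iff two_ne_zero |>.1 h3)
      rw [eventually_false_iff_eq_bot, ae_eq_bot, Measure.restrict_eq_zero] at h2
      have h3 := volume_dom
      rw [measureReal_def, h2] at h3
      norm_num at h3
    obtain ⟨K, hK, hb⟩ := exists_hNorm_sub_approxFun_le (s + 1)
    have hlim : Tendsto (fun n : ℕ => K * (hNorm (s + 1 + 2) f *
        (n : ℝ) ^ ((3 : ℝ) / 2 - ((s + 1 + 2 : ℕ) : ℝ)))) atTop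
        (𝓝 (K * (hNorm (s + 1 + 2) f * 0))) := by
      refine Tendsto.const_mul _ (Tendsto.const_mul _ ?_)
      have h1 := (tendsto_rpow_neg_atTop (y := ((s + 1 + 2 : ℕ) : ℝ) - 3 / 2)
        (by push_cast; linarith [(Nat.cast_nonneg s : (0 : ℝ) ≤ s)])).comp
        tendsto_natCast_atTop_atTop
      simpa [Function.comp_def] using h1
    rw [mul_zero, mul_zero] at hlim
    filter_upwards [hlim.eventually (gt_mem_nhds hpos), eventually_ge_atTop 1] with n hn hn1
    have hd : derivative (approx t f n) ≠ 0 := fun h0 => by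
      have h1 := (hb t F hF f hf n hn1).trans_lt hn
      rw [hnorm, h0] at h1
      simp only [eval_zero, sub_zero] at h1
      have h2 : l2 (F 1) ≤ √(l2 (fun x => F 0 x - (approx t f n).eval x) ^ 2 +
          l2 (fun x => F 1 x) ^ 2) :=
        Real.le_sqrt_of_sq_le (by
          nlinarith [sq_nonneg (l2 (fun x => F 0 x - (approx t f n).eval x))])
      exact (h2.trans_lt h1).false
    exact push_absolutelyContinuous (.poly (approx t f n))
      (derivative (approx t f n)).continuous.continuousOn (ae_eval_ne_zero hd) r
  · obtain ⟨C, hC, h⟩ := exists_l1Dist_push_le p0 p1 p2.continuousOn hr hc hlow hac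
    refine ⟨C, hC, fun n hn => ?_⟩
    rw [hnorm]
    exact h _ _ (.poly (approx t f n)) (derivative (approx t f n)).continuous.continuousOn hn

/-! ### Lower bounds for the derivative -/

/-- Local lower bounds by powers of the distance make up a global one, by compactness. The exponents
can be raised to a common `k`, since `|u|` is bounded below where the distance exceeds `1`. -/
theorem exists_lower_bound {u : ℝ → ℝ} {κ : ℝ → ℕ}
    (h : ∀ a ∈ dom, ∃ c : ℝ, 0 < c ∧ ∀ᶠ x in 𝓝[dom] a, c * |x - a| ^ κ a ≤ |u x|) :
    ∃ Z : Finset ℝ, (∀ a ∈ Z, a ∈ dom) ∧ ∀ k : ℕ, (∀ a ∈ Z, κ a ≤ k) → ∃ c : ℝ, 0 < c ∧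
      ∀ x ∈ dom, c ≤ |u x| ∨ ∃ a ∈ Z, c * |x - a| ^ k ≤ |u x| := by
  choose! c hc hloc using h
  obtain ⟨Z, hZ, hcover⟩ := isCompact_Icc.elim_nhdsWithin_subcover
    (fun a => {x | c a * |x - a| ^ κ a ≤ |u x|}) hloc
  refine ⟨Z, hZ, fun k hk => ?_⟩
  have hne : Z.Nonempty := by
    obtain ⟨a, ha, -⟩ := Set.mem_iUnion₂.1 (hcover one_mem_dom)
    exact ⟨a, ha⟩
  refine ⟨Z.inf' hne c, (Finset.lt_inf'_iff hne).2 fun a ha => hc a (hZ a ha), fun x hx => ?_⟩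
  obtain ⟨a, ha, hxa⟩ := Set.mem_iUnion₂.1 (hcover hx)
  have h1 : Z.inf' hne c ≤ c a := Finset.inf'_le _ ha
  have h2 : c a * |x - a| ^ κ a ≤ |u x| := hxa
  have h3 : 0 < c a := hc a (hZ a ha)
  rcases le_total 1 |x - a| with h4 | h4
  · left
    have := one_le_pow₀ h4 (n := κ a)
    nlinarith
  · refine Or.inr ⟨a, ha, le_trans ?_ h2⟩
    exact mul_le_mul h1 (pow_le_pow_of_le_one (abs_nonneg _) h4 (hk a ha)) (by positivity) h3.le

/-- Integration of a Peano expansion. -/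
theorem isLittleO_integrate {u v : ℝ → ℝ} {a C : ℝ} {p : ℕ} (ha : a ∈ dom)
    (hu : ∀ᶠ x in 𝓝[dom] a, HasDerivWithinAt u (v x) dom x) (hua : u a = 0)
    (h : (fun x => v x - C * (x - a) ^ p) =o[𝓝[dom] a] fun x => (x - a) ^ p) :
    (fun x => u x - C / (p + 1) * (x - a) ^ (p + 1)) =o[𝓝[dom] a]
      fun x => (x - a) ^ (p + 1) := by
  rw [Asymptotics.isLittleO_iff] at h ⊢
  intro ε hε
  have hev := hu.and (h hε)
  obtain ⟨δ, hδ, hball⟩ := Metric.mem_nhdsWithin_iff.1 hev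
  filter_upwards [inter_mem_nhdsWithin dom (Metric.ball_mem_nhds a hδ)] with x hx
  have hdist : |x - a| < δ := by simpa [Real.dist_eq] using hx.2
  set s := Set.uIcc a x with hs
  have hsub : s ⊆ dom := Set.uIcc_subset_Icc ha hx.1
  have hsd : ∀ y ∈ s, |y - a| ≤ |x - a| := fun y hy => Set.abs_sub_left_of_mem_uIcc hy
  have hmem : ∀ y ∈ s, HasDerivWithinAt u (v y) dom y ∧
      ‖v y - C * (y - a) ^ p‖ ≤ ε * ‖(y - a) ^ p‖ := fun y hy =>
    hball ⟨by simpa [Real.dist_eq] using (hsd y hy).trans_lt hdist, hsub hy⟩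
  have hder : ∀ y ∈ s, HasDerivWithinAt (fun y => u y - C / (p + 1) * (y - a) ^ (p + 1))
      (v y - C * (y - a) ^ p) s y := fun y hy => by
    have h1 := ((hmem y hy).1.mono hsub).sub
      ((((hasDerivAt_id y).sub_const a).pow (p + 1)).const_mul (C / (p + 1))).hasDerivWithinAt
    refine h1.congr_deriv ?_
    have : (p : ℝ) + 1 ≠ 0 := by positivity
    simp only [id, Nat.add_sub_cancel]
    push_cast
    field_simp
  have hb : ∀ y ∈ s, ‖v y - C * (y - a) ^ p‖ ≤ ε * |x - a| ^ p := fun y hy => by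
    refine (hmem y hy).2.trans ?_
    rw [norm_pow, Real.norm_eq_abs]
    have := hsd y hy
    gcongr
  have key := (convex_uIcc a x).norm_image_sub_le_of_norm_hasDerivWithin_le hder hb
    Set.left_mem_uIcc Set.right_mem_uIcc
  rw [hua, sub_self, zero_pow (Nat.succ_ne_zero p), mul_zero, sub_zero, sub_zero] at key
  refine key.trans (le_of_eq ?_)
  rw [norm_pow, Real.norm_eq_abs]
  ring

theorem eventually_le_of_isLittleO {v : ℝ → ℝ} {a C : ℝ} {p : ℕ} {l : Filter ℝ} (hC : C ≠ 0)
    (h : (fun x => v x - C * (x - a) ^ p) =o[l] fun x => (x - a) ^ p) :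
    ∀ᶠ x in l, |C| / 2 * |x - a| ^ p ≤ |v x| := by
  filter_upwards [(Asymptotics.isLittleO_iff.1 h) (half_pos (abs_pos.2 hC))] with x hx
  rw [norm_pow, Real.norm_eq_abs, Real.norm_eq_abs, abs_sub_comm] at hx
  have h1 := abs_sub_abs_le_abs_sub (C * (x - a) ^ p) (v x)
  rw [abs_mul, abs_pow] at h1
  linarith

/-- At a critical point of finite order `κ`, the derivative is bounded below by a multiple of
`|x - a| ^ κ`. Lower derivatives that happen not to vanish only improve the bound. -/
theorem HasDerivsAt.exists_lower_bound {f : ℝ → ℝ} {a : ℝ} {κ : ℕ} (ha : a ∈ dom) (hκ : 1 ≤ κ)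
    (h0 : derivWithin f dom a = 0) (h : HasDerivsAt (κ + 1) f a)
    (hne : iteratedDerivWithin (κ + 1) f dom a ≠ 0) :
    ∃ c : ℝ, 0 < c ∧ ∀ᶠ x in 𝓝[dom] a, c * |x - a| ^ κ ≤ |derivWithin f dom x| := by
  classical
  set D := fun i => iteratedDerivWithin i f dom with hD
  have hsucc : ∀ i, D (i + 1) = derivWithin (D i) dom := fun i => by
    funext x; simp only [hD, iteratedDerivWithin_succ]
  have hex : ∃ m, 1 ≤ m ∧ D (m + 1) a ≠ 0 := ⟨κ, hκ, hne⟩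
  set m := Nat.find hex with hm
  obtain ⟨hm1, hmne⟩ := Nat.find_spec hex
  rw [← hm] at hm1 hmne
  have hmκ : m ≤ κ := Nat.find_min' hex ⟨hκ, hne⟩
  have hzero : ∀ i, 1 ≤ i → i ≤ m → D i a = 0 := fun i hi him => by
    rcases Nat.eq_or_lt_of_le hi with rfl | hi
    · rw [← h0, show (1 : ℕ) = 0 + 1 from rfl, hsucc]
      simp [hD]
    · obtain ⟨j, rfl⟩ : ∃ j, i = j + 1 := ⟨i - 1, by omega⟩
      by_contra hj
      exact Nat.find_min hex (by omega : j < m) ⟨by omega, hj⟩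
  have hexp : ∀ j < m, ∃ C : ℝ, C ≠ 0 ∧ (fun x => D (m - j) x - C * (x - a) ^ (j + 1))
      =o[𝓝[dom] a] fun x => (x - a) ^ (j + 1) := by
    intro j
    induction j with
    | zero =>
      intro _
      refine ⟨D (m + 1) a, hmne, ?_⟩
      have h1 := (h.2 m (by omega)).hasDerivWithinAt
      rw [hasDerivWithinAt_iff_isLittleO] at h1
      have h2 : derivWithin (iteratedDerivWithin m f dom) dom a = D (m + 1) a := by rw [hsucc]
      have h3 : iteratedDerivWithin m f dom a = 0 := hzero m hm1 le_rfl
      rw [h2, h3] at h1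
      simpa [hD, mul_comm] using h1
    | succ j ih =>
      intro hj
      obtain ⟨C, hC, hCo⟩ := ih (by omega)
      obtain ⟨i, hi⟩ : ∃ i, m - (j + 1) = i := ⟨_, rfl⟩
      have hij : m - j = i + 1 := by omega
      rw [hi]
      rw [hij] at hCo
      refine ⟨C / ((j + 1 : ℕ) + 1), div_ne_zero hC (by positivity), ?_⟩
      refine isLittleO_integrate ha ?_ (hzero i (by omega) (by omega)) hCo
      filter_upwards [h.1 i (by omega)] with x hx
      rw [hsucc]
      exact hx.hasDerivWithinAt
  obtain ⟨C, hC, hCo⟩ := hexp (m - 1) (by omega)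
  rw [show m - (m - 1) = 0 + 1 by omega, show m - 1 + 1 = m by omega, hsucc] at hCo
  have hD0 : D 0 = f := by funext x; simp [hD]
  rw [hD0] at hCo
  refine ⟨|C| / 2, by positivity, ?_⟩
  filter_upwards [eventually_le_of_isLittleO hC hCo,
    mem_nhdsWithin_of_mem_nhds (Metric.ball_mem_nhds a one_pos)] with x hx hx1
  refine le_trans (mul_le_mul_of_nonneg_left ?_ (by positivity)) hx
  refine pow_le_pow_of_le_one (abs_nonneg _) ?_ hmκ
  rw [Metric.mem_ball, Real.dist_eq] at hx1
  exact hx1.le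

theorem eventually_lower_bound_of_ne_zero {u : ℝ → ℝ} {a : ℝ} (hu : ContinuousOn u dom)
    (ha : a ∈ dom) (h : u a ≠ 0) :
    ∃ c : ℝ, 0 < c ∧ ∀ᶠ x in 𝓝[dom] a, c * |x - a| ^ 0 ≤ |u x| := by
  refine ⟨|u a| / 2, by positivity, ?_⟩
  have h1 : Tendsto (fun x => |u x|) (𝓝[dom] a) (𝓝 |u a|) := (hu a ha).abs
  filter_upwards [h1.eventually (lt_mem_nhds (half_lt_self (abs_pos.2 h)))] with x hx
  rw [pow_zero, mul_one]
  exact hx.le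

/-- At every point, a real analytic function on `Ω` that does not vanish identically is bounded
below by a multiple of a power of the distance. -/
theorem exists_pow_lower_bound_of_analytic {u : ℝ → ℝ} (hu : AnalyticOnNhd ℝ u dom)
    (hne : ¬ Set.EqOn u 0 dom) {a : ℝ} (ha : a ∈ dom) :
    ∃ (p : ℕ) (c : ℝ), 0 < c ∧ ∀ᶠ x in 𝓝[dom] a, c * |x - a| ^ p ≤ |u x| := by
  have h1 : ¬ ∀ᶠ z in 𝓝 a, u z = 0 := fun h =>
    hne (hu.eqOn_zero_of_preconnected_of_eventuallyEq_zero isPreconnected_Icc ha h)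
  obtain ⟨p, g, hg, hg0, hug⟩ := ((hu a ha).exists_eventuallyEq_pow_smul_nonzero_iff).2 h1
  refine ⟨p, |g a| / 2, by positivity, mem_nhdsWithin_of_mem_nhds ?_⟩
  filter_upwards [hug, hg.continuousAt.abs.eventually (lt_mem_nhds (half_lt_self (abs_pos.2 hg0)))]
    with x hx hgx
  rw [hx, smul_eq_mul, abs_mul, abs_pow, mul_comm]
  exact mul_le_mul_of_nonneg_left hgx.le (by positivity)

/-! ### Smooth and analytic functions -/

theorem IsChain.derivWithin_eq {s : ℕ} {F : ℕ → ℝ → ℝ} (hF : IsChain s F) (hs : 2 ≤ s) {f : ℝ → ℝ}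
    (hf : Set.EqOn f (F 0) dom) {x : ℝ} (hx : x ∈ dom) : derivWithin f dom x = F 1 x := by
  rw [derivWithin_congr hf (hf hx)]
  exact ((hF.isPrim 0 (by omega)).hasDerivWithinAt (hF.isPrim 1 (by omega)).continuousOn
    hx).derivWithin (uniqueDiffOn_Icc (by norm_num) x hx)

theorem dom_subset_bernsteinEllipse {ρ : ℝ} (hρ : 1 < ρ) {x : ℝ} (hx : x ∈ dom) :
    (x : ℂ) ∈ bernsteinEllipse ρ := by
  have h1 : ‖(x : ℂ) - 1‖ = 1 - x := by
    rw [← Complex.ofReal_one, ← Complex.ofReal_sub, Complex.norm_real, Real.norm_eq_abs,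
      abs_sub_comm, abs_of_nonneg (by linarith [hx.2])]
  have h2 : ‖(x : ℂ) + 1‖ = x + 1 := by
    rw [← Complex.ofReal_one, ← Complex.ofReal_add, Complex.norm_real, Real.norm_eq_abs,
      abs_of_nonneg (by linarith [hx.1])]
  change ‖(x : ℂ) - 1‖ + ‖(x : ℂ) + 1‖ < ρ + ρ⁻¹
  rw [h1, h2]
  have h3 : 0 < ρ := by linarith
  have h4 : ρ * ρ⁻¹ = 1 := mul_inv_cancel₀ h3.ne'
  have h5 : 0 < ρ⁻¹ := by positivity
  nlinarith [mul_pos (sub_pos.2 hρ) (sub_pos.2 hρ)]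

/-- The restriction to `Ω` of a function that is analytic near `Ω` belongs to all `H^s(Ω)`. -/
theorem exists_isChain_of_analytic {f : ℝ → ℝ} {ρ : ℝ} {F : ℂ → ℂ} (hρ : 1 < ρ)
    (hF : AnalyticOnNhd ℂ F (bernsteinEllipse ρ)) (hfF : ∀ x ∈ dom, F (x : ℂ) = (f x : ℂ)) :
    ∃ G : ℕ → ℝ → ℝ, (∀ s, IsChain s G) ∧ AnalyticOnNhd ℝ (G 1) dom ∧ Set.EqOn f (G 0) dom := by
  have h0 : AnalyticOnNhd ℝ (fun x : ℝ => (F x).re) dom := fun x hx => by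
    have h1 : AnalyticAt ℝ F (x : ℂ) := (hF _ (dom_subset_bernsteinEllipse hρ hx)).restrictScalars
    exact (Complex.reCLM.analyticAt _).comp (h1.comp (Complex.ofRealCLM.analyticAt x))
  set G : ℕ → ℝ → ℝ := fun j => deriv^[j] fun x : ℝ => (F x).re with hG
  have han : ∀ j, AnalyticOnNhd ℝ (G j) dom := fun j => h0.iterated_deriv j
  have hprim : ∀ j, IsPrim (G j) (G (j + 1)) := fun j =>
    .of_hasDerivWithinAt (han (j + 1)).continuousOn fun x hx => by
      have := ((han j) x hx).differentiableAt.hasDerivAt.hasDerivWithinAt (s := dom)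
      simpa only [hG, Function.iterate_succ_apply'] using this
  exact ⟨G, fun s => ⟨fun j _ => hprim j, fun j _ => (hprim j).memL2⟩, han 1,
    fun x hx => by simp [hG, hfF x hx]⟩

end GPC

theorem theorem3p2 :
    -- finite regularity; the constant `K` of the approximation rate depends on `σ` only
    (∀ σ : ℕ, 6 ≤ σ → ∃ K : ℝ, 0 < K ∧
      ∀ (t : GPC.Kind) (r : ℝ → ℝ), GPC.IsC1Density r →
      ∀ f : ℝ → ℝ, ContinuousOn f GPC.dom → GPC.MemH σ f →
        -- finitely many critical points, each of finite order
        (∀ (Z : Finset ℝ) (κ : ℝ → ℕ) (k : ℕ),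
          {x ∈ GPC.dom | derivWithin f GPC.dom x = 0} = (Z : Set ℝ) →
          (∀ a ∈ Z, 1 ≤ κ a ∧ GPC.HasDerivsAt (κ a + 1) f a ∧
            iteratedDerivWithin (κ a + 1) f GPC.dom a ≠ 0) →
          k = Z.sup κ →
          GPC.push r f ≪ volume ∧
          (∀ᶠ n : ℕ in atTop, GPC.push r (GPC.approxFun t f n) ≪ volume) ∧
          ∃ C : ℝ, 0 < C ∧ ∀ n : ℕ, 1 ≤ n →
            (GPC.push r (GPC.approxFun t f n) ≪ volume →
              GPC.l1Dist (GPC.push r f) (GPC.push r (GPC.approxFun t f n)) ≤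
                ENNReal.ofReal
                  (C * GPC.hNorm 1 (f - GPC.approxFun t f n) ^ (1 / (2 * (k : ℝ) + 1)))) ∧
            GPC.hNorm 1 (f - GPC.approxFun t f n) ^ (1 / (2 * (k : ℝ) + 1)) ≤
              K * (GPC.hNorm σ f ^ (1 / (2 * (k : ℝ) + 1)) *
                (n : ℝ) ^ (-((2 * (σ : ℝ) - 3) / (2 * (2 * (k : ℝ) + 1)))))) ∧
        -- no critical point
        (∀ κf : ℝ, 0 < κf → (∀ x ∈ GPC.dom, κf < |derivWithin f GPC.dom x|) →
          GPC.push r f ≪ volume ∧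
          (∀ᶠ n : ℕ in atTop, GPC.push r (GPC.approxFun t f n) ≪ volume) ∧
          ∃ C : ℝ, 0 < C ∧ ∀ n : ℕ, 1 ≤ n →
            (GPC.push r (GPC.approxFun t f n) ≪ volume →
              GPC.l1Dist (GPC.push r f) (GPC.push r (GPC.approxFun t f n)) ≤
                ENNReal.ofReal (C * GPC.hNorm 1 (f - GPC.approxFun t f n))) ∧
            GPC.hNorm 1 (f - GPC.approxFun t f n) ≤
              K * (GPC.hNorm σ f * (n : ℝ) ^ (3 / 2 - (σ : ℝ))))) ∧
    -- analytic, non-constant `f`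
    (∀ (t : GPC.Kind) (r : ℝ → ℝ), GPC.IsC1Density r →
      ∀ (f : ℝ → ℝ) (ρ : ℝ) (F : ℂ → ℂ), 1 < ρ →
        AnalyticOnNhd ℂ F (GPC.bernsteinEllipse ρ) →
        (∀ x ∈ GPC.dom, F (x : ℂ) = (f x : ℂ)) →
        (¬ ∃ c : ℝ, ∀ x ∈ GPC.dom, f x = c) →
          GPC.push r f ≪ volume ∧
          (∀ᶠ n : ℕ in atTop, GPC.push r (GPC.approxFun t f n) ≪ volume) ∧
          ∀ m : ℕ, Tendsto
            (fun n : ℕ => (n : ℝ≥0∞) ^ m *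
              GPC.l1Dist (GPC.push r f) (GPC.push r (GPC.approxFun t f n)))
            atTop (𝓝 0)) := by
  constructor
  · intro σ hσ
    obtain ⟨s, rfl⟩ : ∃ s, σ = s + 3 := ⟨σ - 3, by omega⟩
    obtain ⟨K, hK, hrate⟩ := GPC.exists_hNorm_sub_approxFun_le (s + 1)
    refine ⟨max K 1, by positivity, fun t r hr f hfc hfH => ?_⟩
    obtain ⟨F, hF, hf⟩ := hfH.exists_isChain hfc (by omega)
    have hF1 : ∀ x ∈ GPC.dom, derivWithin f GPC.dom x = F 1 x := fun x hx =>
      hF.derivWithin_eq (by omega) hf hx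
    have hcF1 : ContinuousOn (F 1) GPC.dom := (hF.isPrim 1 (by omega)).continuousOn
    have hH0 : 0 ≤ GPC.hNorm (s + 3) f := Real.sqrt_nonneg _
    refine ⟨fun Z κ k hZ hκ hk => ?_, fun κf hκf hlow => ?_⟩
    · have hloc : ∀ a ∈ GPC.dom, ∃ c : ℝ, 0 < c ∧
          ∀ᶠ x in 𝓝[GPC.dom] a, c * |x - a| ^ (if a ∈ Z then κ a else 0) ≤ |F 1 x| := by
        intro a ha
        split_ifs with haZ
        · obtain ⟨h1, h2, h3⟩ := hκ a haZ
          have h0 : a ∈ {x ∈ GPC.dom | derivWithin f GPC.dom x = 0} := hZ ▸ haZ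
          obtain ⟨c, hc, hev⟩ := h2.exists_lower_bound ha h1 h0.2 h3
          refine ⟨c, hc, ?_⟩
          filter_upwards [hev, self_mem_nhdsWithin] with x hx hxd
          rwa [hF1 x hxd] at hx
        · refine GPC.eventually_lower_bound_of_ne_zero hcF1 ha fun h0 => haZ ?_
          have : a ∈ {x ∈ GPC.dom | derivWithin f GPC.dom x = 0} := ⟨ha, (hF1 a ha).trans h0⟩
          rwa [hZ] at this
      obtain ⟨Y, -, hY⟩ := GPC.exists_lower_bound hloc
      obtain ⟨c, hc, hlow⟩ := hY k fun a _ => by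
        split_ifs with haZ
        · exact hk ▸ Finset.le_sup haZ
        · exact Nat.zero_le _
      obtain ⟨h1, h2, C, hC, h3⟩ := GPC.push_approxFun hF hf hr hc hlow t
      refine ⟨h1, h2, C, hC, fun n hn => ⟨h3 n, ?_⟩⟩
      have hn0 : (0 : ℝ) ≤ n := Nat.cast_nonneg n
      have he0 : (0 : ℝ) < 1 / (2 * (k : ℝ) + 1) := by positivity
      have he1 : 1 / (2 * (k : ℝ) + 1) ≤ 1 := by
        rw [div_le_one (by positivity)]; linarith [(Nat.cast_nonneg k : (0 : ℝ) ≤ k)]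
      refine (Real.rpow_le_rpow (Real.sqrt_nonneg _) (hrate t F hF f hf n hn) he0.le).trans ?_
      rw [Real.mul_rpow hK.le (by positivity), Real.mul_rpow hH0 (by positivity),
        ← Real.rpow_mul hn0]
      have hKe : K ^ (1 / (2 * (k : ℝ) + 1)) ≤ max K 1 :=
        (Real.rpow_le_rpow hK.le (le_max_left _ _) he0.le).trans
          ((Real.rpow_le_rpow_of_exponent_le (le_max_right _ _) he1).trans_eq (Real.rpow_one _))
      have hexp : ((3 : ℝ) / 2 - ((s + 1 + 2 : ℕ) : ℝ)) * (1 / (2 * (k : ℝ) + 1)) =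
          -((2 * ((s + 3 : ℕ) : ℝ) - 3) / (2 * (2 * (k : ℝ) + 1))) := by
        push_cast
        field_simp
        ring
      rw [hexp]
      gcongr
    · have hlow' : ∀ x ∈ GPC.dom, κf ≤ |F 1 x| ∨
          ∃ a ∈ (∅ : Finset ℝ), κf * |x - a| ^ 0 ≤ |F 1 x| := fun x hx =>
        Or.inl (hF1 x hx ▸ (hlow x hx).le)
      obtain ⟨h1, h2, C, hC, h3⟩ := GPC.push_approxFun hF hf hr hκf hlow' t
      refine ⟨h1, h2, C, hC, fun n hn => ⟨fun hac => ?_, ?_⟩⟩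
      · simpa using h3 n hac
      · refine (hrate t F hF f hf n hn).trans ?_
        gcongr
        exact le_max_left _ _
  · intro t r hr f ρ F hρ hF hfF hconst
    obtain ⟨G, hG, hGan, hfG⟩ := GPC.exists_isChain_of_analytic hρ hF hfF
    have hne : ¬ Set.EqOn (G 1) 0 GPC.dom := fun h0 => hconst ⟨G 0 (-1), fun x hx => by
      have h1 := ((hG 1).isPrim 0 one_pos).eq x hx
      rw [hfG hx, h1, intervalIntegral.integral_congr (g := fun _ => (0 : ℝ))]
      · simp
      · intro y hy
        rw [Set.uIcc_of_le hx.1] at hy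
        exact h0 ⟨hy.1, hy.2.trans hx.2⟩⟩
    choose! p hloc using fun a ha => GPC.exists_pow_lower_bound_of_analytic hGan hne (a := a) ha
    obtain ⟨Z, -, hZ⟩ := GPC.exists_lower_bound hloc
    obtain ⟨c, hc, hlow⟩ := hZ (Z.sup p) fun a ha => Finset.le_sup ha
    set k := Z.sup p
    obtain ⟨h1, h2, C, hC, h3⟩ := GPC.push_approxFun (hG 3) (s := 0) hfG hr hc hlow t
    refine ⟨h1, h2, fun m => ?_⟩
    -- the order of smoothness is chosen so large that the rate beats `n ^ (m + 1)`
    set s := (m + 1) * (2 * k + 1)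
    obtain ⟨K, hK, hrate⟩ := GPC.exists_hNorm_sub_approxFun_le s
    set H := GPC.hNorm (s + 2) f
    have hH0 : 0 ≤ H := Real.sqrt_nonneg _
    have he0 : (0 : ℝ) < 1 / (2 * (k : ℝ) + 1) := by positivity
    set A := C * (K * H) ^ (1 / (2 * (k : ℝ) + 1))
    have hA0 : 0 ≤ A := by positivity
    have hlim : Tendsto (fun n : ℕ => ENNReal.ofReal (A / n)) atTop (𝓝 0) := by
      have := ENNReal.tendsto_ofReal (tendsto_const_div_atTop_nhds_zero_nat A)
      rwa [ENNReal.ofReal_zero] at this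
    refine tendsto_of_tendsto_of_tendsto_of_le_of_le' tendsto_const_nhds hlim
      (Eventually.of_forall fun _ => zero_le) ?_
    filter_upwards [h2, eventually_ge_atTop 1] with n hac hn
    have hn1 : (1 : ℝ) ≤ n := by exact_mod_cast hn
    have hn0 : (0 : ℝ) < n := by exact_mod_cast hn
    rw [show (n : ℝ≥0∞) ^ m = ENNReal.ofReal ((n : ℝ) ^ m) by
      rw [ENNReal.ofReal_pow hn0.le, ENNReal.ofReal_natCast]]
    refine (mul_le_mul_right (h3 n hac) _).trans ?_
    rw [← ENNReal.ofReal_mul (by positivity)]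
    refine ENNReal.ofReal_le_ofReal ?_
    have hrn : ((n : ℝ) ^ ((3 : ℝ) / 2 - ((s + 2 : ℕ) : ℝ))) ^ (1 / (2 * (k : ℝ) + 1)) ≤
        1 / (n : ℝ) ^ (m + 1) := by
      rw [← Real.rpow_mul hn0.le, one_div ((n : ℝ) ^ (m + 1)), ← Real.rpow_natCast,
        ← Real.rpow_neg hn0.le]
      refine Real.rpow_le_rpow_of_exponent_le hn1 ?_
      rw [mul_one_div, div_le_iff₀ (by positivity)]
      simp only [s]
      push_cast
      linarith
    have h4 : GPC.hNorm 1 (f - GPC.approxFun t f n) ^ (1 / (2 * (k : ℝ) + 1)) ≤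
        (K * H) ^ (1 / (2 * (k : ℝ) + 1)) * (1 / (n : ℝ) ^ (m + 1)) := by
      refine (Real.rpow_le_rpow (Real.sqrt_nonneg _) (hrate t G (hG _) f hfG n hn) he0.le).trans ?_
      rw [← mul_assoc, Real.mul_rpow (by positivity) (by positivity)]
      gcongr
    calc (n : ℝ) ^ m * (C * GPC.hNorm 1 (f - GPC.approxFun t f n) ^ (1 / (2 * (k : ℝ) + 1))) ≤
        (n : ℝ) ^ m * (C * ((K * H) ^ (1 / (2 * (k : ℝ) + 1)) * (1 / (n : ℝ) ^ (m + 1)))) := by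
          gcongr
      _ = A / n := by
          simp only [A]
          field_simp
          ring
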